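/- Let $\mathfrak k$ be a separable complex Hilbert space, $A_1,A_0,A_{-1},B\in B(\mathfrak k)$ and $s\in\mathbb R$. Let $\mathfrak R=\{\emptyset\}+\mathbb R+\mathbb R^2+\cdots$ (disjoint union) carry the measure $\int f(w)\,dw=f(\emptyset)+\sum_{n\ge1}\frac1{n!}\int_{\mathbb R^n}f(t_1,\dots,t_n)\,dt_1\cdots dt_n$. Let $\mathcal K$ be the space of symmetric continuous functions $\mathfrak R\to\mathfrak k$ with compact support, and put $\langle f|g\rangle=\int\langle f(w),g(w)\rangle\,dw$ and $(a(r)f)(t_1,\dots,t_n)=f(r,t_1,\dots,t_n)$. For $F:\mathfrak R^3\to B(\mathfrak k)$ symmetric in each variable and locally integrable, let $$\langle f|\mathcal B(F)|g\rangle=\int\big\langle f(\sigma+\tau+\omega),\,F(\sigma,\tau,\upsilon)\,g(\tau+\upsilon+\omega)\big\rangle\,d\sigma\,d\tau\,d\upsilon\,d\omega\qquad(f,g\in\mathcal K),$$ where $+$ between words denotes concatenation, and let $A\,\mathcal B(F)=\mathcal B(AF)$ for $A\in B(\mathfrak k)$. A solution of the normal-ordered quantum stochastic differential equation $dU^t_s/dt=A_1a^+_tU^t_s+A_0a^+_tU^t_sa_t+A_{-1}U^t_sa_t+BU^t_s$,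 $U^s_s=1$, in weak integral form is a family $(U^t_s)_{t\ge s}$ of sesquilinear forms on $\mathcal K$ of the form $U^t_s=\mathcal B(x_t)$, where the kernels $x_t:\mathfrak R^3\to B(\mathfrak k)$ are symmetric in each word variable, locally integrable in $(t,\sigma,\tau,\upsilon)\in[s,\infty)\times\mathfrak R^3$ and, for each $t\ge s$, locally integrable in $(\sigma,\tau,\upsilon)$, such that for all $f,g\in\mathcal K$ and all $t\ge s$ $$\langle f|U^t_s|g\rangle=\langle f|g\rangle+\int_s^t\!\langle a(r)f|A_1U^r_s|g\rangle\,dr+\int_s^t\!\langle a(r)f|A_0U^r_s|a(r)g\rangle\,dr+\int_s^t\!\langle f|A_{-1}U^r_s|a(r)g\rangle\,dr+\int_s^t\!\langle f|BU^r_s|g\rangle\,dr.\tag{$*$}$$ For $t\ge s$ define $u^t_s=u^t_s(A_1,A_0,A_{-1};B):\mathfrak R^3\to B(\mathfrak k)$ as follows. If the letters of $\sigma,\tau,\upsilon$ are all different and lie in $]s,t[$, order them as $s_1<\dots<s_n$, put $i_j=1,0,-1$ according to whether $s_j$ is a letter of $\sigma$, $\tau$ or $\upsilon$, and let $$u^t_s(\sigma,\tau,\upsilon)=e^{(t-s_n)B}A_{i_n}e^{(s_n-s_{n-1})B}A_{i_{n-1}}\cdots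 A_{i_2}e^{(s_2-s_1)B}A_{i_1}e^{(s_1-s)B}$$ (which is $e^{(t-s)B}$ if $n=0$); otherwise $u^t_s(\sigma,\tau,\upsilon)=0$. Then equation $(*)$ has exactly one solution, namely $U^t_s=\mathcal B(u^t_s)$, $t\ge s$; the kernels $u^t_s$ satisfy the symmetry and integrability conditions above, and all integrals in $(*)$ converge for them. Moreover the kernel is unique up to null sets: if $(x_t)_{t\ge s}$ is any family of kernels as above for which $\mathcal B(x_t)$ satisfies $(*)$, then for every $t\ge s$, $x_t=u^t_s$ almost everywhere on $\mathfrak R^3$. -/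

import Mathlib

open MeasureTheory

noncomputable section

/-- The space `ℝ⁰ + ℝ¹ + ℝ² + ⋯` (disjoint union) of finite words of real numbers, with the
topology and the σ-algebra of a disjoint union. -/
abbrev Word : Type := Σ n : ℕ, (Fin n → ℝ)

/-- The Lebesgue measure on words:
`∫ f dw = f(∅) + ∑ₙ (1/n!) ∫ f(t₁, …, tₙ) dt₁ ⋯ dtₙ`. -/
def wordMeasure : Measure Word :=
  Measure.sum fun n : ℕ =>
    ENNReal.ofReal (1 / (n.factorial : ℝ)) •
      Measure.map (fun v : Fin n → ℝ => (⟨n, v⟩ : Word)) volume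

/-- Concatenation of words; for a symmetric function `f` it realizes `f(α + β)`. -/
def Word.append (v w : Word) : Word := ⟨v.1 + w.1, Fin.append v.2 w.2⟩

/-- The word `(r, t₁, …, tₙ)`. -/
def Word.cons (r : ℝ) (w : Word) : Word := ⟨w.1 + 1, Fin.cons r w.2⟩

/-- A function of words that is invariant under permutation of the letters. -/
def IsSymmetricOnWords {E : Type*} (f : Word → E) : Prop :=
  ∀ (n : ℕ) (π : Equiv.Perm (Fin n)) (v : Fin n → ℝ), f ⟨n, v ∘ π⟩ = f ⟨n, v⟩

/-- The space of symmetric continuous functions with compact support from the words to `𝔨`. -/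
def TestFn (𝔨 : Type*) [NormedAddCommGroup 𝔨] : Type _ :=
  {f : Word → 𝔨 // IsSymmetricOnWords f ∧ Continuous f ∧ HasCompactSupport f}

/-- The annihilation operator at the point `r`: `(a(r)f)(t₁, …, tₙ) = f(r, t₁, …, tₙ)`. -/
def annihilate {E : Type*} (r : ℝ) (f : Word → E) : Word → E := fun w => f (Word.cons r w)

section Forms

variable {𝔨 : Type*} [NormedAddCommGroup 𝔨] [InnerProductSpace ℂ 𝔨]

/-- `⟨f|g⟩ = ∫ f⁺(w) g(w) dw`. -/
def wordPairing (f g : Word → 𝔨) : ℂ :=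
  ∫ w, inner ℂ (f w) (g w) ∂wordMeasure

/-- The function `f⁺(σ + τ + ω) F(σ, τ, υ) g(τ + υ + ω)` of `(σ, τ, υ, ω)`. -/
def formIntegrand (F : Word → Word → Word → (𝔨 →L[ℂ] 𝔨)) (f g : Word → 𝔨) :
    Word × Word × Word × Word → ℂ := fun p =>
  inner ℂ (f ((p.1.append p.2.1).append p.2.2.2))
    (F p.1 p.2.1 p.2.2.1 (g ((p.2.1.append p.2.2.1).append p.2.2.2)))

/-- The sesquilinear form
`⟨f|𝓑(F)|g⟩ = ∫ f⁺(σ + τ + ω) F(σ, τ, υ) g(τ + υ + ω) dσ dτ dυ dω`. -/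
def kernelForm (F : Word → Word → Word → (𝔨 →L[ℂ] 𝔨)) (f g : Word → 𝔨) : ℂ :=
  ∫ p, formIntegrand F f g p
    ∂(wordMeasure.prod (wordMeasure.prod (wordMeasure.prod wordMeasure)))

/-- The kernel `(σ, τ, υ) ↦ A F(σ, τ, υ)` of `A 𝓑(F)`. -/
def leftMul (A : 𝔨 →L[ℂ] 𝔨) (F : Word → Word → Word → (𝔨 →L[ℂ] 𝔨)) :
    Word → Word → Word → (𝔨 →L[ℂ] 𝔨) := fun σ τ υ => A * F σ τ υ

/-- The families `(x_t)`, `t ≥ s`, of kernels that are admitted: symmetric in each of the three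
word variables, locally integrable jointly in `(t, σ, τ, υ)`, and locally integrable for each
`t ≥ s` (so that `𝓑(x_t)` is defined). Values at `t < s` play no role. -/
structure IsAdmissibleKernel (s : ℝ) (x : ℝ → Word → Word → Word → (𝔨 →L[ℂ] 𝔨)) : Prop where
  symm_left : ∀ t, s ≤ t → ∀ τ υ, IsSymmetricOnWords fun σ => x t σ τ υ
  symm_mid : ∀ t, s ≤ t → ∀ σ υ, IsSymmetricOnWords fun τ => x t σ τ υ
  symm_right : ∀ t, s ≤ t → ∀ σ τ, IsSymmetricOnWords fun υ => x t σ τ υ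
  locInt_joint : LocallyIntegrableOn
    (fun p : ℝ × Word × Word × Word => x p.1 p.2.1 p.2.2.1 p.2.2.2)
    (Set.Ici s ×ˢ Set.univ)
    ((volume : Measure ℝ).prod (wordMeasure.prod (wordMeasure.prod wordMeasure)))
  locInt : ∀ t, s ≤ t → LocallyIntegrable
    (fun p : Word × Word × Word => x t p.1 p.2.1 p.2.2)
    (wordMeasure.prod (wordMeasure.prod wordMeasure))

/-- The weak integral equation for `U_s^t = 𝓑(x_t)`, `t ≥ s`:
`⟨f|U_s^t|g⟩ = ⟨f|g⟩ + ∫ₛᵗ ⟨a(r)f|A₁U_s^r|g⟩ dr + ∫ₛᵗ ⟨a(r)f|A₀U_s^r|a(r)g⟩ dr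
  + ∫ₛᵗ ⟨f|A₋₁U_s^r|a(r)g⟩ dr + ∫ₛᵗ ⟨f|BU_s^r|g⟩ dr`.
For an admissible kernel all integrands here are integrable. -/
def SatisfiesQSDE (A₁ A₀ Am₁ B : 𝔨 →L[ℂ] 𝔨) (s : ℝ)
    (x : ℝ → Word → Word → Word → (𝔨 →L[ℂ] 𝔨)) : Prop :=
  ∀ f g : TestFn 𝔨, ∀ t, s ≤ t →
    kernelForm (x t) f.1 g.1 = wordPairing f.1 g.1
      + (∫ r in s..t, kernelForm (leftMul A₁ (x r)) (annihilate r f.1) g.1)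
      + (∫ r in s..t, kernelForm (leftMul A₀ (x r)) (annihilate r f.1) (annihilate r g.1))
      + (∫ r in s..t, kernelForm (leftMul Am₁ (x r)) f.1 (annihilate r g.1))
      + (∫ r in s..t, kernelForm (leftMul B (x r)) f.1 g.1)

/-- All integrals that occur in the weak integral equation converge. -/
def QSDEIntegralsConverge (A₁ A₀ Am₁ B : 𝔨 →L[ℂ] 𝔨) (s : ℝ)
    (x : ℝ → Word → Word → Word → (𝔨 →L[ℂ] 𝔨)) : Prop :=
  ∀ f g : TestFn 𝔨, ∀ t, s ≤ t →
    (∀ A ∈ ({1, A₁, A₀, Am₁, B} : Set (𝔨 →L[ℂ] 𝔨)),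
      ∀ f' ∈ ({f.1, annihilate t f.1} : Set (Word → 𝔨)),
      ∀ g' ∈ ({g.1, annihilate t g.1} : Set (Word → 𝔨)),
        Integrable (formIntegrand (leftMul A (x t)) f' g')
          (wordMeasure.prod (wordMeasure.prod (wordMeasure.prod wordMeasure)))) ∧
    IntervalIntegrable
      (fun r => kernelForm (leftMul A₁ (x r)) (annihilate r f.1) g.1) volume s t ∧
    IntervalIntegrable
      (fun r => kernelForm (leftMul A₀ (x r)) (annihilate r f.1) (annihilate r g.1))
      volume s t ∧
    IntervalIntegrable
      (fun r => kernelForm (leftMul Am₁ (x r)) f.1 (annihilate r g.1)) volume s t ∧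
    IntervalIntegrable (fun r => kernelForm (leftMul B (x r)) f.1 g.1) volume s t

/-- A family `U = (U_s^t)`, `t ≥ s`, of forms on the test functions solves the weak equation:
it is given by an admissible family of kernels and satisfies the integral equation. -/
def IsQSDESolution (A₁ A₀ Am₁ B : 𝔨 →L[ℂ] 𝔨) (s : ℝ)
    (U : Set.Ici s → TestFn 𝔨 → TestFn 𝔨 → ℂ) : Prop :=
  ∃ x : ℝ → Word → Word → Word → (𝔨 →L[ℂ] 𝔨),
    IsAdmissibleKernel s x ∧
    (∀ (t : Set.Ici s) (f g : TestFn 𝔨), U t f g = kernelForm (x t) f.1 g.1) ∧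
    SatisfiesQSDE A₁ A₀ Am₁ B s x

/-- For the list `(s₁, i₁), …, (sₙ, iₙ)` the product
`exp((t - sₙ)B) A_{iₙ} exp((sₙ - sₙ₋₁)B) ⋯ A_{i₁} exp((s₁ - s)B)`. -/
def orderedProduct (A : Fin 3 → (𝔨 →L[ℂ] 𝔨)) (B : 𝔨 →L[ℂ] 𝔨) (t : ℝ) :
    ℝ → List (ℝ ×ₗ Fin 3) → (𝔨 →L[ℂ] 𝔨)
  | s, [] => NormedSpace.exp (((t - s : ℝ) : ℂ) • B)
  | s, p :: L =>
      orderedProduct A B t (ofLex p).1 L * A (ofLex p).2 *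
        NormedSpace.exp ((((ofLex p).1 - s : ℝ) : ℂ) • B)

/-- The letters of a word, each marked with the label `i`. -/
def Word.labelled (i : Fin 3) (w : Word) : Multiset (ℝ ×ₗ Fin 3) :=
  (Finset.univ : Finset (Fin w.1)).val.map fun j => toLex (w.2 j, i)

open Classical in
/-- The kernel `u_s^t(A₁, A₀, A₋₁; B)(σ, τ, υ)`: the labelled points of `σ` (operator `A₁`), `τ`
(operator `A₀`) and `υ` (operator `A₋₁`) are put in increasing order `s₁ < ⋯ < sₙ`; the value is
`exp((t - sₙ)B) A_{iₙ} ⋯ A_{i₁} exp((s₁ - s)B)` if they are distinct and all lie in `]s, t[`,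
and `0` otherwise. -/
def qsdeKernel (A₁ A₀ Am₁ B : 𝔨 →L[ℂ] 𝔨) (s t : ℝ) (σ τ υ : Word) : 𝔨 →L[ℂ] 𝔨 :=
  let ξ := σ.labelled 0 + τ.labelled 1 + υ.labelled 2
  if (∀ p ∈ ξ, s < (ofLex p).1 ∧ (ofLex p).1 < t) ∧ (ξ.map fun p => (ofLex p).1).Nodup then
    orderedProduct ![A₁, A₀, Am₁] B t s (ξ.sort (· ≤ ·))
  else 0

end Forms

end

/-! Existence. Sort the labelled letters of `(σ, τ, υ)` and split off the last one. The kernel at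
time `t` is then `exp((t - s)B)` on empty words, plus a sum over letters `r` in `]s, t[` of `exp((t
- r)B) A` times the kernel at time `r` without that letter. Only the largest letter contributes,
because any other one leaves behind a letter that is too late (`configurationKernel_eq_add_sum`).
Integrating `B` times this identity turns the exponentials into differences and gives the pointwise
form of the equation: kernel = identity on empty words + sum over letters of `A` times an earlier
kernel + `∫ B u_r dr` (`hasIntegral_configurationKernel`). After pairing with `f` and `g`, a sum
over the letters of a word becomes an integral over a free real variable, by the sum-integral lemma
`integral_letterSum`. By symmetry the removed letter can be put in front in `f` or `g`, where it
appears as `a(r)`. The letters of `σ`, `τ`, `υ` give the three noise terms.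

Uniqueness of the form. The difference `y` of two solutions satisfies the homogeneous equation.
Annihilation shortens the words in the support of a test function, so by induction on the length
bounds for `f` and `g` the three noise terms vanish. What remains is `⟨f|y_t|g⟩ = ∫ ⟨B*f|y_r|g⟩ dr`.
Iterating it gives a bound of order `(‖B‖(t - s))ᵏ / k!`, hence zero
(`kernelForm_eq_zero_of_homogeneous`).

Uniqueness of the kernel. A symmetric, locally integrable kernel `F` with vanishing form is zero
almost everywhere (`ae_eq_zero_of_kernelForm_eq_zero`). Test functions approximate indicators of
compact symmetric sets. Fix distinct centres, divided into three groups, and small disjoint balls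
around them. Let `f` be the indicator of the words matching groups one and two, and `g` that of the
words matching groups two and three. Letters of `τ` and `ω` occur in both arguments, so they can
only match group two. By induction on the length of the middle word `F` vanishes for shorter `τ`;
then counting forces `ω = ∅` and makes `σ`, `τ`, `υ` match the three groups exactly. The form is
thus a nonzero multiple of a matrix coefficient of the integral of `F` over a ball, and Lebesgue
differentiation finishes the proof. -/

noncomputable section

/-! ### Words: topology, multisets of letters, compact boxes, measure. -/

section

namespace Word

/-- The inclusion of the words of length `n`. -/
abbrev ofFn (n : ℕ) (v : Fin n → ℝ) : Word := ⟨n, v⟩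

lemma measurableSet_iff {S : Set Word} :
    MeasurableSet S ↔ ∀ n, MeasurableSet (ofFn n ⁻¹' S) := by
  simp only [MeasurableSpace.measurableSet_iInf]
  rfl

lemma isOpenEmbedding_ofFn (n : ℕ) : Topology.IsOpenEmbedding (ofFn n) :=
  Topology.IsOpenEmbedding.sigmaMk (σ := fun n => Fin n → ℝ)

instance : BorelSpace Word := by
  refine ⟨le_antisymm ?_ ?_⟩
  · intro S hS
    rw [measurableSet_iff] at hS
    have h : S = ⋃ n, ofFn n '' (ofFn n ⁻¹' S) := by
      ext ⟨n, v⟩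
      simp only [Set.mem_iUnion, Set.mem_image, Set.mem_preimage]
      constructor
      · exact fun h => ⟨n, v, h, rfl⟩
      · rintro ⟨m, w, h, e⟩
        exact e ▸ h
    rw [h]
    let : MeasurableSpace Word := borel Word
    have : BorelSpace Word := ⟨rfl⟩
    exact MeasurableSet.iUnion fun n =>
      (isOpenEmbedding_ofFn n).measurableEmbedding.measurableSet_image.2 (hS n)
  · refine MeasurableSpace.generateFrom_le fun S hS => ?_
    rw [measurableSet_iff]
    exact fun n => (hS.preimage (isOpenEmbedding_ofFn n).continuous).measurableSet

lemma measurableEmbedding_ofFn (n : ℕ) : MeasurableEmbedding (ofFn n) :=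
  (isOpenEmbedding_ofFn n).measurableEmbedding

/-- The multiset of the letters of a word. -/
def letters (w : Word) : Multiset ℝ := (Finset.univ : Finset (Fin w.1)).val.map w.2

lemma letters_ofFn {n : ℕ} (v : Fin n → ℝ) : letters ⟨n, v⟩ = (List.ofFn v : Multiset ℝ) := by
  simp only [letters, List.ofFn_eq_map]
  rfl

lemma card_letters (w : Word) : w.letters.card = w.1 := by simp [letters]

lemma letters_append (v w : Word) : (v.append w).letters = v.letters + w.letters := by
  obtain ⟨n, v⟩ := v
  obtain ⟨m, w⟩ := w
  simp only [append, letters_ofFn, List.ofFn_fin_append, Multiset.coe_add]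

lemma letters_cons (r : ℝ) (w : Word) : (cons r w).letters = r ::ₘ w.letters := by
  obtain ⟨n, v⟩ := w
  simp only [cons, letters_ofFn, List.ofFn_cons, Multiset.cons_coe]

lemma mem_letters {w : Word} {r : ℝ} : r ∈ w.letters ↔ ∃ i, w.2 i = r := by
  simp [letters]

/-- The word with the `i`-th letter removed. -/
def erase : (w : Word) → Fin w.1 → Word
  | ⟨0, _⟩, i => i.elim0
  | ⟨n + 1, v⟩, i => ⟨n, i.removeNth v⟩

lemma letters_erase (w : Word) (i : Fin w.1) : w.letters = w.2 i ::ₘ (w.erase i).letters := by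
  obtain ⟨_ | n, v⟩ := w
  · exact i.elim0
  · simp only [erase, letters]
    rw [Fin.univ_succAbove n i]
    simp only [Finset.cons_val, Finset.map_val, Multiset.map_cons, Multiset.map_map]
    rfl

end Word

/-- Sorting is a permutation, and words with equal letters have the same sorted rearrangement.
Identities for symmetric functions thereby reduce to identities of multisets. -/
lemma IsSymmetricOnWords.eq_of_letters_eq {E : Type*} {f : Word → E} (hf : IsSymmetricOnWords f)
    {v w : Word} (h : v.letters = w.letters) : f v = f w := by
  obtain ⟨n, v⟩ := v
  obtain ⟨m, w⟩ := w
  have hnm : n = m := by simpa [Word.card_letters] using congrArg Multiset.card h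
  subst hnm
  rw [Word.letters_ofFn, Word.letters_ofFn, Multiset.coe_eq_coe] at h
  have e : v ∘ Tuple.sort v = w ∘ Tuple.sort w := by
    refine List.ofFn_injective (List.Perm.eq_of_pairwise' (r := (· ≤ ·))
      (Tuple.monotone_sort v).sortedLE_ofFn.pairwise (Tuple.monotone_sort w).sortedLE_ofFn.pairwise ?_)
    exact ((Tuple.sort v).ofFn_comp_perm v).trans (h.trans ((Tuple.sort w).ofFn_comp_perm w).symm)
  rw [← hf n (Tuple.sort v) v, e, hf]

lemma isSymmetricOnWords_of_letters {E : Type*} {f : Word → E}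
    (h : ∀ v w : Word, v.letters = w.letters → f v = f w) : IsSymmetricOnWords f := by
  intro n π v
  apply h
  simp only [Word.letters_ofFn, Multiset.coe_eq_coe]
  exact Equiv.Perm.ofFn_comp_perm π v

open Filter in
lemma continuous_of_openEmbedding_cover {ι X Y : Type*} {Z : ι → Type*} [TopologicalSpace X]
    [TopologicalSpace Y] [∀ i, TopologicalSpace (Z i)] {e : ∀ i, Z i → X}
    (he : ∀ i, Topology.IsOpenEmbedding (e i)) (hcov : ∀ x, ∃ i z, e i z = x) {f : X → Y}
    (hf : ∀ i, Continuous (f ∘ e i)) : Continuous f := by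
  rw [continuous_iff_continuousAt]
  intro x
  obtain ⟨i, z, rfl⟩ := hcov x
  exact (he i).continuousAt_iff.1 (hf i).continuousAt

namespace Word

lemma continuous_append : Continuous fun p : Word × Word => p.1.append p.2 := by
  refine continuous_of_openEmbedding_cover (ι := ℕ × ℕ)
    (e := fun i => Prod.map (ofFn i.1) (ofFn i.2))
    (fun i => (isOpenEmbedding_ofFn i.1).prodMap (isOpenEmbedding_ofFn i.2))
    (fun ⟨v, w⟩ => ⟨(v.1, w.1), (v.2, w.2), rfl⟩) fun ⟨n, m⟩ => ?_
  refine (isOpenEmbedding_ofFn (n + m)).continuous.comp (g := ofFn (n + m))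
    (f := fun p : (Fin n → ℝ) × (Fin m → ℝ) => Fin.append p.1 p.2) ?_
  refine continuous_pi fun i => ?_
  induction i using Fin.addCases with
  | left i => simpa [Function.comp_def] using (continuous_apply i).comp continuous_fst
  | right i => simpa [Function.comp_def] using (continuous_apply i).comp continuous_snd

lemma continuous_cons : Continuous fun p : ℝ × Word => cons p.1 p.2 := by
  refine continuous_of_openEmbedding_cover (ι := ℕ)
    (e := fun n => Prod.map id (ofFn n))
    (fun n => Topology.IsOpenEmbedding.id.prodMap (isOpenEmbedding_ofFn n))
    (fun ⟨r, w⟩ => ⟨w.1, (r, w.2), rfl⟩) fun n => ?_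
  refine (isOpenEmbedding_ofFn (n + 1)).continuous.comp (g := ofFn (n + 1))
    (f := fun p : ℝ × (Fin n → ℝ) => (Fin.cons p.1 p.2 : Fin (n + 1) → ℝ)) ?_
  exact Continuous.finCons (A := fun _ => ℝ) continuous_fst continuous_snd

/-- The words with at most `N` letters, all of absolute value at most `N`. -/
def box (N : ℕ) : Set Word := {w | w.1 ≤ N ∧ ∀ i, |w.2 i| ≤ N}

lemma mem_box {N : ℕ} {w : Word} : w ∈ box N ↔ w.letters.card ≤ N ∧ ∀ r ∈ w.letters, |r| ≤ N := by
  simp [box, card_letters, mem_letters]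

lemma box_mono : Monotone box := fun N M h w hw =>
  ⟨hw.1.trans h, fun i => (hw.2 i).trans (by exact_mod_cast h)⟩

/-- This heredity is the reason for bounding both the length and the letters: if `σ + τ + ω` lies in
a box, so does each of its parts. -/
lemma mem_box_of_letters_le {N : ℕ} {v w : Word} (h : v.letters ≤ w.letters) (hw : w ∈ box N) :
    v ∈ box N := by
  rw [mem_box] at hw ⊢
  exact ⟨(Multiset.card_le_card h).trans hw.1, fun r hr => hw.2 r (Multiset.mem_of_le h hr)⟩

lemma mem_box_of_cons {N : ℕ} {r : ℝ} {w : Word} (h : cons r w ∈ box N) : w ∈ box N :=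
  mem_box_of_letters_le (by rw [letters_cons]; exact Multiset.le_cons_self _ _) h

lemma box_eq (N : ℕ) : box N = ⋃ n ∈ Finset.range (N + 1), ofFn n '' Metric.closedBall 0 N := by
  ext ⟨n, v⟩
  simp only [box, Set.mem_ofPred_eq, Finset.mem_range, Set.mem_iUnion, Set.mem_image]
  constructor
  · rintro ⟨h, hv⟩
    refine ⟨n, by omega, v, ?_, rfl⟩
    rw [mem_closedBall_zero_iff, pi_norm_le_iff_of_nonneg (by positivity)]
    exact hv
  · rintro ⟨m, h, w, hw, e⟩
    obtain rfl : m = n := congrArg Sigma.fst e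
    obtain rfl : w = v := by simpa using e
    rw [mem_closedBall_zero_iff, pi_norm_le_iff_of_nonneg (by positivity)] at hw
    exact ⟨by omega, hw⟩

lemma isCompact_box (N : ℕ) : IsCompact (box N) := by
  rw [box_eq]
  exact (Finset.range (N + 1)).isCompact_biUnion fun n _ =>
    (isCompact_closedBall _ _).image (isOpenEmbedding_ofFn n).continuous

lemma measurableSet_box (N : ℕ) : MeasurableSet (box N) := (isCompact_box N).measurableSet

lemma exists_box_mem_nhds (w : Word) : ∃ N, box N ∈ nhds w := by
  obtain ⟨n, v⟩ := w
  obtain ⟨N, hN⟩ := exists_nat_gt (max (n : ℝ) ‖v‖)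
  refine ⟨N, Filter.mem_of_superset (((isOpenEmbedding_ofFn n).isOpen_iff_image_isOpen.1
    (Metric.isOpen_ball (x := 0) (ε := (N : ℝ)))).mem_nhds ⟨v, ?_, rfl⟩) ?_⟩
  · exact mem_ball_zero_iff.2 ((le_max_right _ _).trans_lt hN)
  · rintro _ ⟨w, hw, rfl⟩
    rw [mem_ball_zero_iff] at hw
    exact ⟨by exact_mod_cast ((le_max_left _ _).trans hN.le), fun i => (norm_le_pi_norm w i).trans hw.le⟩

lemma exists_subset_box {K : Set Word} (hK : IsCompact K) : ∃ N, K ⊆ box N := by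
  refine hK.induction_on (p := fun K => ∃ N, K ⊆ box N) ⟨0, Set.empty_subset _⟩
    (fun _ _ h ⟨N, hN⟩ => ⟨N, h.trans hN⟩) ?_ ?_
  · rintro S T ⟨N, hN⟩ ⟨M, hM⟩
    exact ⟨max N M, Set.union_subset (hN.trans (box_mono (le_max_left _ _)))
      (hM.trans (box_mono (le_max_right _ _)))⟩
  · intro w _
    obtain ⟨N, hN⟩ := exists_box_mem_nhds w
    exact ⟨box N, mem_nhdsWithin_of_mem_nhds hN, N, subset_rfl⟩

end Word

instance : SFinite wordMeasure := by unfold wordMeasure; infer_instance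

lemma wordMeasure_apply {S : Set Word} (hS : MeasurableSet S) :
    wordMeasure S = ∑' n : ℕ, ENNReal.ofReal (1 / (n.factorial : ℝ)) *
      volume (Word.ofFn n ⁻¹' S) := by
  rw [wordMeasure, Measure.sum_apply _ hS]
  refine tsum_congr fun n => ?_
  rw [Measure.smul_apply, smul_eq_mul, (Word.measurableEmbedding_ofFn n).map_apply]

lemma wordMeasure_box_lt_top (N : ℕ) : wordMeasure (Word.box N) < ⊤ := by
  rw [wordMeasure_apply (Word.measurableSet_box N), tsum_eq_sum (s := Finset.range (N + 1))]
  · refine ENNReal.sum_lt_top.2 fun n _ => ENNReal.mul_lt_top ENNReal.ofReal_lt_top ?_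
    refine (measure_mono fun v hv => ?_).trans_lt (measure_closedBall_lt_top (x := 0) (r := (N : ℝ)))
    rw [mem_closedBall_zero_iff, pi_norm_le_iff_of_nonneg (by positivity)]
    exact hv.2
  · intro n hn
    have : Word.ofFn n ⁻¹' Word.box N = ∅ := by
      ext v
      simp only [Finset.mem_range] at hn
      simp only [Word.box, Set.mem_preimage, Set.mem_ofPred_eq, Set.mem_empty_iff_false, iff_false]
      exact fun h => by have := h.1; omega
    rw [this]; simp

end

/-! ### Integrability of the forms given by kernels. -/

section

/-- The measure of triples of words. -/
abbrev wordMeasure₃ : Measure (Word × Word × Word) :=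
  wordMeasure.prod (wordMeasure.prod wordMeasure)

/-- The measure of quadruples of words. -/
abbrev wordMeasure₄ : Measure (Word × Word × Word × Word) :=
  wordMeasure.prod (wordMeasure.prod (wordMeasure.prod wordMeasure))

/-- Triples of words with all components in `Word.box N`. -/
def box₃ (N : ℕ) : Set (Word × Word × Word) := Word.box N ×ˢ Word.box N ×ˢ Word.box N

lemma isCompact_box₃ (N : ℕ) : IsCompact (box₃ N) :=
  (Word.isCompact_box N).prod ((Word.isCompact_box N).prod (Word.isCompact_box N))

lemma measurableSet_box₃ (N : ℕ) : MeasurableSet (box₃ N) := (isCompact_box₃ N).measurableSet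

/-- Reassociation of a triple of words and a word to a quadruple of words. -/
def wordAssoc : (Word × Word × Word) × Word ≃ᵐ Word × Word × Word × Word :=
  MeasurableEquiv.prodAssoc.trans (MeasurableEquiv.prodCongr (.refl _) MeasurableEquiv.prodAssoc)

lemma measurePreserving_wordAssoc :
    MeasurePreserving wordAssoc (wordMeasure₃.prod wordMeasure) wordMeasure₄ :=
  (measurePreserving_prodAssoc _ _ _).trans
    ((MeasurePreserving.id _).prod (measurePreserving_prodAssoc _ _ _))

/-- Reassociation of a real number, a triple of words and a word. -/
def realWordAssoc : (ℝ × Word × Word × Word) × Word ≃ᵐ ℝ × Word × Word × Word × Word :=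
  MeasurableEquiv.prodAssoc.trans (MeasurableEquiv.prodCongr (.refl _) wordAssoc)

lemma measurePreserving_realWordAssoc (ρ : Measure ℝ) [SFinite ρ] :
    MeasurePreserving realWordAssoc ((ρ.prod wordMeasure₃).prod wordMeasure)
      (ρ.prod wordMeasure₄) :=
  (measurePreserving_prodAssoc _ _ _).trans
    ((MeasurePreserving.id _).prod measurePreserving_wordAssoc)

variable {𝔨 : Type*} [NormedAddCommGroup 𝔨]

/-- Families of functions on words, jointly continuous, with a common bound `M` and a common
support in `Word.box N`. -/
structure IsTestFamily (N : ℕ) (M : ℝ) (φ : ℝ → Word → 𝔨) : Prop where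
  continuous : Continuous fun p : ℝ × Word => φ p.1 p.2
  norm_le : ∀ r w, ‖φ r w‖ ≤ M
  mem_box : ∀ r w, φ r w ≠ 0 → w ∈ Word.box N

lemma IsTestFamily.mono {N N' : ℕ} {M M' : ℝ} {φ : ℝ → Word → 𝔨} (h : IsTestFamily N M φ)
    (hN : N ≤ N') (hM : M ≤ M') : IsTestFamily N' M' φ :=
  ⟨h.continuous, fun r w => (h.norm_le r w).trans hM,
    fun r w hw => Word.box_mono hN (h.mem_box r w hw)⟩

lemma IsTestFamily.const {N : ℕ} {M : ℝ} {φ : ℝ → Word → 𝔨}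
    (hφ : IsTestFamily N M φ) (r : ℝ) : IsTestFamily N M fun _ => φ r :=
  ⟨hφ.continuous.comp (.prodMk continuous_const continuous_snd), fun _ => hφ.norm_le r,
    fun _ => hφ.mem_box r⟩

/-- The equation involves `f` and `a(r)f`. Treating both as families with common bounds lets one
integrability argument cover all its terms; annihilation does not enlarge the box, since deleting a
letter keeps a word inside it. -/
lemma TestFn.exists_isTestFamily (f : TestFn 𝔨) : ∃ N M, IsTestFamily N M (fun _ => f.1) ∧
    IsTestFamily N M (fun r => annihilate r f.1) := by
  obtain ⟨f, -, hc, hs⟩ := f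
  obtain ⟨N, hN⟩ := Word.exists_subset_box hs.isCompact
  obtain ⟨M, hM⟩ := hs.exists_bound_of_continuous hc
  have hb : ∀ w, f w ≠ 0 → w ∈ Word.box N := fun w hw => hN (subset_tsupport _ hw)
  exact ⟨N, M, ⟨hc.comp continuous_snd, fun _ w => hM w, fun _ w => hb w⟩,
    ⟨hc.comp Word.continuous_cons, fun _ w => hM _,
      fun _ w h => Word.mem_box_of_cons (hb _ h)⟩⟩

lemma TestFn.exists_isTestFamily₂ (f g : TestFn 𝔨) : ∃ N M, IsTestFamily N M (fun _ => f.1) ∧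
    IsTestFamily N M (fun r => annihilate r f.1) ∧ IsTestFamily N M (fun _ => g.1) ∧
    IsTestFamily N M (fun r => annihilate r g.1) := by
  obtain ⟨N, M, h₁, h₂⟩ := f.exists_isTestFamily
  obtain ⟨N', M', h₃, h₄⟩ := g.exists_isTestFamily
  exact ⟨max N N', max M M', h₁.mono (le_max_left _ _) (le_max_left _ _),
    h₂.mono (le_max_left _ _) (le_max_left _ _), h₃.mono (le_max_right _ _) (le_max_right _ _),
    h₄.mono (le_max_right _ _) (le_max_right _ _)⟩

lemma isTestFn_of_isTestFamily {N : ℕ} {M : ℝ} {f : Word → 𝔨} (hf : IsTestFamily N M fun _ => f)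
    (hs : IsSymmetricOnWords f) :
    IsSymmetricOnWords f ∧ Continuous f ∧ HasCompactSupport f :=
  ⟨hs, hf.continuous.comp (Continuous.prodMk_right (0 : ℝ)),
    HasCompactSupport.of_support_subset_isCompact (Word.isCompact_box N) fun w hw => hf.mem_box 0 w hw⟩

lemma isSymmetricOnWords_annihilate {E : Type*} {f : Word → E} (hf : IsSymmetricOnWords f) (r : ℝ) :
    IsSymmetricOnWords (annihilate r f) :=
  isSymmetricOnWords_of_letters fun v w h => hf.eq_of_letters_eq (by simp [Word.letters_cons, h])

/-- The annihilation operator at `r` on test functions. -/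
def TestFn.annihilate (r : ℝ) (f : TestFn 𝔨) : TestFn 𝔨 :=
  ⟨_root_.annihilate r f.1, by
    obtain ⟨N, M, -, h⟩ := f.exists_isTestFamily
    refine isTestFn_of_isTestFamily (N := N) (M := M)
      ⟨h.continuous.comp (.prodMk continuous_const continuous_snd), fun _ => h.norm_le r,
        fun _ => h.mem_box r⟩ (isSymmetricOnWords_annihilate f.2.1 r)⟩

variable [InnerProductSpace ℂ 𝔨]

/-- The norm of a kernel, cut off outside `Word.box N`, as a function of four words. -/
def boxNorm (N : ℕ) (F : Word → Word → Word → (𝔨 →L[ℂ] 𝔨)) (p : Word × Word × Word × Word) : ℝ :=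
  (box₃ N).indicator (fun q => ‖F q.1 q.2.1 q.2.2‖) (p.1, p.2.1, p.2.2.1) *
    (Word.box N).indicator 1 p.2.2.2

lemma boxNorm_nonneg (N : ℕ) (F : Word → Word → Word → (𝔨 →L[ℂ] 𝔨)) (p) : 0 ≤ boxNorm N F p :=
  mul_nonneg (Set.indicator_nonneg (fun _ _ => norm_nonneg _) _)
    (Set.indicator_nonneg (fun _ _ => zero_le_one) _)

lemma boxNorm_of_mem {N : ℕ} {F : Word → Word → Word → (𝔨 →L[ℂ] 𝔨)}
    {p : Word × Word × Word × Word} (h₃ : (p.1, p.2.1, p.2.2.1) ∈ box₃ N)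
    (hω : p.2.2.2 ∈ Word.box N) : boxNorm N F p = ‖F p.1 p.2.1 p.2.2.1‖ := by
  simp [boxNorm, h₃, hω]

lemma mem_box_of_formIntegrand_ne_zero {N : ℕ} {f g : Word → 𝔨}
    (hf : ∀ w, f w ≠ 0 → w ∈ Word.box N) (hg : ∀ w, g w ≠ 0 → w ∈ Word.box N)
    {F : Word → Word → Word → (𝔨 →L[ℂ] 𝔨)} {p : Word × Word × Word × Word}
    (hp : formIntegrand F f g p ≠ 0) :
    (p.1, p.2.1, p.2.2.1) ∈ box₃ N ∧ p.2.2.2 ∈ Word.box N := by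
  obtain ⟨σ, τ, υ, ω⟩ := p
  have h₁ : (σ.append τ).append ω ∈ Word.box N := hf _ fun h => hp (by simp [formIntegrand, h])
  have h₂ : (τ.append υ).append ω ∈ Word.box N := hg _ fun h => hp (by simp [formIntegrand, h])
  have aux : ∀ {v w : Word}, v.letters ≤ w.letters → w ∈ Word.box N → v ∈ Word.box N :=
    Word.mem_box_of_letters_le
  refine ⟨⟨aux ?_ h₁, aux ?_ h₁, aux ?_ h₂⟩, aux ?_ h₁⟩ <;>
    simp only [Word.letters_append]
  · exact (Multiset.le_add_right _ _).trans (Multiset.le_add_right _ _)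
  · exact (Multiset.le_add_left _ _).trans (Multiset.le_add_right _ _)
  · exact (Multiset.le_add_left _ _).trans (Multiset.le_add_right _ _)
  · exact Multiset.le_add_left _ _

/-- The kernel does not depend on `ω`; integrability in that variable comes from the supports of `f`
and `g`, which confine `ω` to a box of finite measure. -/
lemma norm_formIntegrand_le {N : ℕ} {M M' : ℝ} {f g : Word → 𝔨}
    (hf : ∀ w, f w ≠ 0 → w ∈ Word.box N) (hg : ∀ w, g w ≠ 0 → w ∈ Word.box N)
    (hM : ∀ w, ‖f w‖ ≤ M) (hM' : ∀ w, ‖g w‖ ≤ M')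
    (F : Word → Word → Word → (𝔨 →L[ℂ] 𝔨)) (p : Word × Word × Word × Word) :
    ‖formIntegrand F f g p‖ ≤ M * M' * boxNorm N F p := by
  have h0 : 0 ≤ M := (norm_nonneg _).trans (hM p.1)
  have h0' : 0 ≤ M' := (norm_nonneg _).trans (hM' p.1)
  by_cases hp : formIntegrand F f g p = 0
  · rw [hp, norm_zero]
    exact mul_nonneg (mul_nonneg h0 h0') (boxNorm_nonneg _ _ _)
  · obtain ⟨h₃, hω⟩ := mem_box_of_formIntegrand_ne_zero hf hg hp
    rw [boxNorm_of_mem h₃ hω]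
    refine (norm_inner_le_norm _ _).trans ?_
    calc _ ≤ M * (‖F p.1 p.2.1 p.2.2.1‖ * M') := by
          refine mul_le_mul (hM _) ((ContinuousLinearMap.le_opNorm _ _).trans ?_)
            (norm_nonneg _) h0
          exact mul_le_mul_of_nonneg_left (hM' _) (norm_nonneg _)
      _ = _ := by ring

lemma integrable_boxNorm {ρ : Measure ℝ} [SFinite ρ]
    {x : ℝ → Word → Word → Word → (𝔨 →L[ℂ] 𝔨)} {N : ℕ}
    (hx : IntegrableOn (fun q : ℝ × Word × Word × Word => x q.1 q.2.1 q.2.2.1 q.2.2.2)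
      (Set.univ ×ˢ box₃ N) (ρ.prod wordMeasure₃)) :
    Integrable (fun q : ℝ × Word × Word × Word × Word => boxNorm N (x q.1) q.2)
      (ρ.prod wordMeasure₄) := by
  rw [← (measurePreserving_realWordAssoc ρ).integrable_comp_emb realWordAssoc.measurableEmbedding]
  have h₁ := (integrable_indicator_iff (MeasurableSet.univ.prod (measurableSet_box₃ N))).2 hx.norm
  have h₂ : Integrable ((Word.box N).indicator (1 : Word → ℝ)) wordMeasure :=
    (integrable_indicator_iff (Word.measurableSet_box N)).2
      (integrableOn_const (wordMeasure_box_lt_top N).ne)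
  refine (h₁.mul_prod h₂).congr (.of_forall fun ⟨⟨r, σ, τ, υ⟩, ω⟩ => ?_)
  change (Set.univ ×ˢ box₃ N).indicator
      (fun q : ℝ × Word × Word × Word => ‖x q.1 q.2.1 q.2.2.1 q.2.2.2‖) (r, σ, τ, υ) * _ =
    (box₃ N).indicator (fun q => ‖x r q.1 q.2.1 q.2.2‖) (σ, τ, υ) * _
  by_cases h : (σ, τ, υ) ∈ box₃ N
  · rw [Set.indicator_of_mem (show (r, σ, τ, υ) ∈ Set.univ ×ˢ box₃ N from ⟨trivial, h⟩),
      Set.indicator_of_mem h]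
    rfl
  · rw [Set.indicator_of_notMem (show (r, σ, τ, υ) ∉ Set.univ ×ˢ box₃ N from fun h' => h h'.2),
      Set.indicator_of_notMem h]
    rfl

/-- The measure `ρ` in time is left free: Lebesgue measure on `[s, t]` gives joint integrability, a
Dirac mass gives integrability at a fixed time. -/
lemma integrable_formIntegrand {ρ : Measure ℝ} [SFinite ρ]
    {x : ℝ → Word → Word → Word → (𝔨 →L[ℂ] 𝔨)} {N : ℕ} {M M' : ℝ} {φ γ : ℝ → Word → 𝔨}
    (hφ : IsTestFamily N M φ) (hγ : IsTestFamily N M' γ)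
    (hx : IntegrableOn (fun q : ℝ × Word × Word × Word => x q.1 q.2.1 q.2.2.1 q.2.2.2)
      (Set.univ ×ˢ box₃ N) (ρ.prod wordMeasure₃)) :
    Integrable (fun q : ℝ × Word × Word × Word × Word =>
      formIntegrand (x q.1) (φ q.1) (γ q.1) q.2) (ρ.prod wordMeasure₄) := by
  refine ((integrable_boxNorm hx).const_mul (M * M')).mono' ?_ (.of_forall fun q =>
    norm_formIntegrand_le (hφ.mem_box _) (hγ.mem_box _) (hφ.norm_le _) (hγ.norm_le _) _ _)
  -- The kernel is only known to be measurable over the box, so it is cut off there. The integrand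
  -- is unchanged, as it vanishes when one of the words leaves the box.
  have h₁ := (aestronglyMeasurable_indicator_iff
    (MeasurableSet.univ.prod (measurableSet_box₃ N))).2 hx.aestronglyMeasurable
  have h₂ : AEStronglyMeasurable (fun q : ℝ × Word × Word × Word × Word =>
      (Set.univ ×ˢ box₃ N).indicator
        (fun q : ℝ × Word × Word × Word => x q.1 q.2.1 q.2.2.1 q.2.2.2)
        (q.1, q.2.1, q.2.2.1, q.2.2.2.1)) (ρ.prod wordMeasure₄) := by
    rw [← (measurePreserving_realWordAssoc ρ).aestronglyMeasurable_comp_iff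
      realWordAssoc.measurableEmbedding]
    exact h₁.comp_fst
  have ca : Continuous fun q : ℝ × Word × Word × Word × Word =>
      φ q.1 ((q.2.1.append q.2.2.1).append q.2.2.2.2) :=
    hφ.continuous.comp (continuous_fst.prodMk (Word.continuous_append.comp
      ((Word.continuous_append.comp (by fun_prop : Continuous fun q :
        ℝ × Word × Word × Word × Word => (q.2.1, q.2.2.1))).prodMk (by fun_prop))))
  have cb : Continuous fun q : ℝ × Word × Word × Word × Word =>
      γ q.1 ((q.2.2.1.append q.2.2.2.1).append q.2.2.2.2) :=
    hγ.continuous.comp (continuous_fst.prodMk (Word.continuous_append.comp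
      ((Word.continuous_append.comp (by fun_prop : Continuous fun q :
        ℝ × Word × Word × Word × Word => (q.2.2.1, q.2.2.2.1))).prodMk (by fun_prop))))
  refine (ca.aestronglyMeasurable.inner (𝕜 := ℂ)
    ((ContinuousLinearMap.id ℂ (𝔨 →L[ℂ] 𝔨)).aestronglyMeasurable_comp₂ h₂
      cb.aestronglyMeasurable)).congr (.of_forall fun q => ?_)
  by_cases hq : (q.2.1, q.2.2.1, q.2.2.2.1) ∈ box₃ N
  · simp [formIntegrand, hq]
  · by_cases h : formIntegrand (x q.1) (φ q.1) (γ q.1) q.2 = 0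
    · simp [hq, h]
    · exact absurd (mem_box_of_formIntegrand_ne_zero (hφ.mem_box _) (hγ.mem_box _) h).1 hq

lemma integrable_prod_dirac_iff {E : Type*} [NormedAddCommGroup E] {X : Type*} [MeasurableSpace X]
    {μ : Measure X} [SFinite μ] {t : ℝ} {h : ℝ × X → E} :
    Integrable h ((Measure.dirac t).prod μ) ↔ Integrable (fun p => h (t, p)) μ := by
  rw [Measure.dirac_prod, (measurableEmbedding_prodMk_left t).integrable_map_iff]
  rfl

/-- The integrability of a family of kernels that the weak integral equation uses. -/
structure IsBoxIntegrable (s : ℝ) (x : ℝ → Word → Word → Word → (𝔨 →L[ℂ] 𝔨)) : Prop where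
  joint : ∀ t N, IntegrableOn (fun q : ℝ × Word × Word × Word => x q.1 q.2.1 q.2.2.1 q.2.2.2)
    (Set.univ ×ˢ box₃ N) ((volume.restrict (Set.Icc s t)).prod wordMeasure₃)
  single : ∀ t, s ≤ t → ∀ N, IntegrableOn (fun q : Word × Word × Word => x t q.1 q.2.1 q.2.2)
    (box₃ N) wordMeasure₃

variable {s : ℝ} {x y : ℝ → Word → Word → Word → (𝔨 →L[ℂ] 𝔨)}

/-- Boxes are compact, so local integrability restricts to them. The convergence and uniqueness
arguments for forms need only this, and it passes to differences and left multiples. -/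
lemma IsAdmissibleKernel.isBoxIntegrable (hx : IsAdmissibleKernel s x) : IsBoxIntegrable s x where
  joint t N := by
    have h := hx.locInt_joint.integrableOn_compact_subset (t := Set.Icc s t ×ˢ box₃ N)
      (Set.prod_mono Set.Icc_subset_Ici_self (Set.subset_univ _))
      (isCompact_Icc.prod (isCompact_box₃ N))
    rw [IntegrableOn, ← Measure.prod_restrict] at h ⊢
    rwa [Measure.restrict_univ]
  single t ht N := (hx.locInt t ht).integrableOn_isCompact (isCompact_box₃ N)

lemma IsBoxIntegrable.leftMul (A : 𝔨 →L[ℂ] 𝔨) (hx : IsBoxIntegrable s x) :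
    IsBoxIntegrable s fun t => leftMul A (x t) where
  joint t N := ContinuousLinearMap.integrable_comp (ContinuousLinearMap.mul ℂ (𝔨 →L[ℂ] 𝔨) A)
    (hx.joint t N)
  single t ht N := ContinuousLinearMap.integrable_comp (ContinuousLinearMap.mul ℂ (𝔨 →L[ℂ] 𝔨) A)
    (hx.single t ht N)

lemma IsBoxIntegrable.sub (hx : IsBoxIntegrable s x) (hy : IsBoxIntegrable s y) :
    IsBoxIntegrable s fun t σ τ υ => x t σ τ υ - y t σ τ υ where
  joint t N := (hx.joint t N).sub (hy.joint t N)
  single t ht N := (hx.single t ht N).sub (hy.single t ht N)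

variable {N : ℕ} {M M' : ℝ} {φ γ : ℝ → Word → 𝔨}

lemma IsBoxIntegrable.integrable_formIntegrand_prod (hx : IsBoxIntegrable s x)
    (hφ : IsTestFamily N M φ) (hγ : IsTestFamily N M' γ) (t : ℝ) :
    Integrable (fun q : ℝ × Word × Word × Word × Word =>
      formIntegrand (x q.1) (φ q.1) (γ q.1) q.2)
      ((volume.restrict (Set.Icc s t)).prod wordMeasure₄) :=
  integrable_formIntegrand hφ hγ (hx.joint t N)

lemma integrable_formIntegrand_single {F : Word → Word → Word → (𝔨 →L[ℂ] 𝔨)} {f g : Word → 𝔨}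
    (hf : IsTestFamily N M fun _ => f) (hg : IsTestFamily N M' fun _ => g)
    (hF : IntegrableOn (fun q : Word × Word × Word => F q.1 q.2.1 q.2.2) (box₃ N) wordMeasure₃) :
    Integrable (formIntegrand F f g) wordMeasure₄ := by
  refine integrable_prod_dirac_iff (t := 0) (h := fun q : ℝ × _ => formIntegrand F f g q.2)|>.1
    (integrable_formIntegrand (x := fun _ => F) hf hg ?_)
  rw [IntegrableOn, ← Measure.prod_restrict, Measure.restrict_univ, integrable_prod_dirac_iff]
  exact hF

lemma integrable_boxNorm_single {F : Word → Word → Word → (𝔨 →L[ℂ] 𝔨)}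
    (hF : IntegrableOn (fun q : Word × Word × Word => F q.1 q.2.1 q.2.2) (box₃ N) wordMeasure₃) :
    Integrable (boxNorm N F) wordMeasure₄ := by
  refine integrable_prod_dirac_iff (t := 0) (h := fun q : ℝ × _ => boxNorm N F q.2)|>.1
    (integrable_boxNorm (x := fun _ => F) ?_)
  rw [IntegrableOn, ← Measure.prod_restrict, Measure.restrict_univ, integrable_prod_dirac_iff]
  exact hF

lemma IsBoxIntegrable.integrable_formIntegrand (hx : IsBoxIntegrable s x)
    (hφ : IsTestFamily N M φ) (hγ : IsTestFamily N M' γ) {t : ℝ} (ht : s ≤ t) (r r' : ℝ) :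
    Integrable (formIntegrand (x t) (φ r) (γ r')) wordMeasure₄ :=
  integrable_formIntegrand_single (hφ.const r) (hγ.const r') (hx.single t ht N)

lemma IsBoxIntegrable.intervalIntegrable_kernelForm (hx : IsBoxIntegrable s x)
    (hφ : IsTestFamily N M φ) (hγ : IsTestFamily N M' γ) {t : ℝ} (ht : s ≤ t) :
    IntervalIntegrable (fun r => kernelForm (x r) (φ r) (γ r)) volume s t :=
  (intervalIntegrable_iff_integrableOn_Icc_of_le ht).2
    (hx.integrable_formIntegrand_prod hφ hγ t).integral_prod_left

lemma IsBoxIntegrable.integral_kernelForm (hx : IsBoxIntegrable s x)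
    (hφ : IsTestFamily N M φ) (hγ : IsTestFamily N M' γ) {t : ℝ} (ht : s ≤ t) :
    ∫ r in s..t, kernelForm (x r) (φ r) (γ r) =
      ∫ q, formIntegrand (x q.1) (φ q.1) (γ q.1) q.2
        ∂((volume.restrict (Set.Icc s t)).prod wordMeasure₄) := by
  rw [intervalIntegral.integral_of_le ht, ← integral_Icc_eq_integral_Ioc,
    integral_prod _ (hx.integrable_formIntegrand_prod hφ hγ t)]
  rfl

lemma IsBoxIntegrable.qsdeIntegralsConverge (hx : IsBoxIntegrable s x)
    (A₁ A₀ Am₁ B : 𝔨 →L[ℂ] 𝔨) : QSDEIntegralsConverge A₁ A₀ Am₁ B s x := by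
  intro f g t ht
  obtain ⟨N, M, hf, hf', hg, hg'⟩ := f.exists_isTestFamily₂ g
  refine ⟨?_, (hx.leftMul A₁).intervalIntegrable_kernelForm hf' hg ht,
    (hx.leftMul A₀).intervalIntegrable_kernelForm hf' hg' ht,
    (hx.leftMul Am₁).intervalIntegrable_kernelForm hf hg' ht,
    (hx.leftMul B).intervalIntegrable_kernelForm hf hg ht⟩
  rintro A - _ (rfl | rfl) _ (rfl | rfl)
  · exact (hx.leftMul A).integrable_formIntegrand hf hg ht t t
  · exact (hx.leftMul A).integrable_formIntegrand hf hg' ht t t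
  · exact (hx.leftMul A).integrable_formIntegrand hf' hg ht t t
  · exact (hx.leftMul A).integrable_formIntegrand hf' hg' ht t t

lemma IsBoxIntegrable.kernelForm_sub (hx : IsBoxIntegrable s x) (hy : IsBoxIntegrable s y)
    (hφ : IsTestFamily N M φ) (hγ : IsTestFamily N M' γ) {t : ℝ} (ht : s ≤ t) (r r' : ℝ) :
    kernelForm (fun σ τ υ => x t σ τ υ - y t σ τ υ) (φ r) (γ r') =
      kernelForm (x t) (φ r) (γ r') - kernelForm (y t) (φ r) (γ r') := by
  rw [kernelForm, kernelForm, kernelForm, ← integral_sub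
    (hx.integrable_formIntegrand hφ hγ ht r r') (hy.integrable_formIntegrand hφ hγ ht r r')]
  simp [formIntegrand]

lemma leftMul_sub (A : 𝔨 →L[ℂ] 𝔨) (F G : Word → Word → Word → (𝔨 →L[ℂ] 𝔨)) :
    leftMul A (fun σ τ υ => F σ τ υ - G σ τ υ) =
      fun σ τ υ => leftMul A F σ τ υ - leftMul A G σ τ υ := by
  funext σ τ υ
  exact mul_sub _ _ _

/-- Moving `A` onto the test function keeps the kernel fixed, so statements about all test functions
can be applied to every term of the equation. -/
lemma kernelForm_leftMul [CompleteSpace 𝔨] (A : 𝔨 →L[ℂ] 𝔨)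
    (F : Word → Word → Word → (𝔨 →L[ℂ] 𝔨)) (f g : Word → 𝔨) :
    kernelForm (leftMul A F) f g =
      kernelForm F (fun w => ContinuousLinearMap.adjoint A (f w)) g := by
  simp [kernelForm, formIntegrand, leftMul, ContinuousLinearMap.adjoint_inner_left]

end

/-! ### Uniqueness of the form. -/

section

/-- A Gronwall iteration in which `c` is only integrable, not bounded. The first integration is
spent on replacing `c` by its integral; each later one contributes a factor `b (t - s)` and a
factorial. Hence the power `j + k + 1` of `b` against the power `k` of `t - s`. -/
lemma norm_le_of_iterated_integral {e : ℕ → ℝ → ℂ} {c : ℝ → ℝ} {b s T : ℝ} (hb : 0 ≤ b)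
    (hsT : s ≤ T) (he : ∀ j t, s ≤ t → e j t = ∫ r in s..t, e (j + 1) r)
    (hc : ∀ j t, s ≤ t → ‖e j t‖ ≤ b ^ j * c t) (hi : IntervalIntegrable c volume s T)
    (k : ℕ) : ∀ j t, s ≤ t → t ≤ T →
      ‖e j t‖ ≤ b ^ (j + k + 1) * (∫ r in s..T, c r) * (t - s) ^ k / k.factorial := by
  have c0 : ∀ t, s ≤ t → 0 ≤ c t := fun t ht => by
    simpa using (norm_nonneg _).trans (hc 0 t ht)
  induction k with
  | zero =>
    intro j t hst htT
    have hi' : IntervalIntegrable c volume s t :=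
      hi.mono_set (by rw [Set.uIcc_of_le hst, Set.uIcc_of_le hsT]; exact Set.Icc_subset_Icc_right htT)
    have h₁ : ‖e j t‖ ≤ ∫ r in s..t, b ^ (j + 1) * c r := by
      rw [he j t hst]
      exact intervalIntegral.norm_integral_le_of_norm_le hst
        (.of_forall fun r hr => hc (j + 1) r hr.1.le) (hi'.const_mul _)
    rw [intervalIntegral.integral_const_mul] at h₁
    have h₂ : ∫ r in s..t, c r ≤ ∫ r in s..T, c r :=
      intervalIntegral.integral_mono_interval le_rfl hst htT
        ((ae_restrict_iff' measurableSet_Ioc).2 (.of_forall fun r hr => c0 r hr.1.le)) hi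
    simpa using h₁.trans (mul_le_mul_of_nonneg_left h₂ (pow_nonneg hb _))
  | succ k ih =>
    intro j t hst htT
    set κ := ∫ r in s..T, c r
    have h₁ : ‖e j t‖ ≤ ∫ r in s..t, b ^ (j + 1 + k + 1) * κ * (r - s) ^ k / k.factorial := by
      rw [he j t hst]
      exact intervalIntegral.norm_integral_le_of_norm_le hst
        (.of_forall fun r hr => ih (j + 1) r hr.1.le (hr.2.trans htT))
        (Continuous.intervalIntegrable (by fun_prop) _ _)
    refine h₁.trans_eq ?_
    simp_rw [mul_div_assoc]
    rw [intervalIntegral.integral_const_mul, intervalIntegral.integral_div,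
      intervalIntegral.integral_comp_sub_right (fun r => r ^ k), integral_pow, sub_self,
      Nat.factorial_succ]
    push_cast
    have : (k.factorial : ℝ) ≠ 0 := by positivity
    have h' : ((k : ℝ) + 1) ≠ 0 := by positivity
    field_simp
    ring

lemma eq_zero_of_iterated_integral {e : ℕ → ℝ → ℂ} {c : ℝ → ℝ} {b s T : ℝ} (hb : 0 ≤ b)
    (hsT : s ≤ T) (he : ∀ j t, s ≤ t → e j t = ∫ r in s..t, e (j + 1) r)
    (hc : ∀ j t, s ≤ t → ‖e j t‖ ≤ b ^ j * c t) (hi : IntervalIntegrable c volume s T) :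
    e 0 T = 0 := by
  rw [← norm_le_zero_iff]
  refine ge_of_tendsto' (x := Filter.atTop) (f := fun k : ℕ => b * (∫ r in s..T, c r) *
    ((b * (T - s)) ^ k / k.factorial)) ?_ fun k => ?_
  · simpa using (FloorSemiring.tendsto_pow_div_factorial_atTop (b * (T - s))).const_mul
      (b * ∫ r in s..T, c r)
  · refine (norm_le_of_iterated_integral hb hsT he hc hi k 0 T hsT le_rfl).trans_eq ?_
    rw [mul_pow]; ring

lemma TestFn.exists_length_bound {𝔨 : Type*} [NormedAddCommGroup 𝔨] (f : TestFn 𝔨) :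
    ∃ m, ∀ w : Word, m ≤ w.1 → f.1 w = 0 := by
  obtain ⟨N, M, hf, -⟩ := f.exists_isTestFamily
  refine ⟨N + 1, fun w hw => by_contra fun h => ?_⟩
  have := (hf.mem_box 0 w h).1
  omega

section Uniqueness

variable {𝔨 : Type*} [NormedAddCommGroup 𝔨] [InnerProductSpace ℂ 𝔨]

/-- Composition of a test function with a bounded operator. -/
def TestFn.map (A : 𝔨 →L[ℂ] 𝔨) (f : TestFn 𝔨) : TestFn 𝔨 :=
  ⟨fun w => A (f.1 w), fun n π v => congrArg A (f.2.1 n π v), A.continuous.comp f.2.2.1,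
    f.2.2.2.comp_left (map_zero A)⟩

variable {s : ℝ} {y : ℝ → Word → Word → Word → (𝔨 →L[ℂ] 𝔨)}

lemma IsBoxIntegrable.intervalIntegrable_integral_boxNorm (hy : IsBoxIntegrable s y) (N : ℕ)
    {t : ℝ} (ht : s ≤ t) :
    IntervalIntegrable (fun r => ∫ p, boxNorm N (y r) p ∂wordMeasure₄) volume s t :=
  (intervalIntegrable_iff_integrableOn_Icc_of_le ht).2
    (integrable_boxNorm (hy.joint t N)).integral_prod_left

lemma kernelForm_zero_left (F : Word → Word → Word → (𝔨 →L[ℂ] 𝔨)) {f g : Word → 𝔨}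
    (hf : ∀ w, f w = 0) : kernelForm F f g = 0 := by simp [kernelForm, formIntegrand, hf]

lemma kernelForm_zero_right (F : Word → Word → Word → (𝔨 →L[ℂ] 𝔨)) {f g : Word → 𝔨}
    (hg : ∀ w, g w = 0) : kernelForm F f g = 0 := by simp [kernelForm, formIntegrand, hg]

variable [CompleteSpace 𝔨] {A₁ A₀ Am₁ B : 𝔨 →L[ℂ] 𝔨}

/-- Each use of the equation costs one application of `B*` to `f`. This multiplies the bound by
`‖B‖` and leaves the supporting box unchanged, since `B*` acts on values; the iterated-integral
estimate then applies. -/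
lemma IsBoxIntegrable.kernelForm_eq_zero_of_integral_eq (hy : IsBoxIntegrable s y)
    (f g : TestFn 𝔨)
    (hf : ∀ (j : ℕ) (t : ℝ), s ≤ t →
      kernelForm (y t) ((TestFn.map (ContinuousLinearMap.adjoint B))^[j] f).1 g.1 =
        ∫ r in s..t, kernelForm (y r)
          ((TestFn.map (ContinuousLinearMap.adjoint B))^[j + 1] f).1 g.1) {t : ℝ} (ht : s ≤ t) :
    kernelForm (y t) f.1 g.1 = 0 := by
  obtain ⟨N, M, hf₁, -, hg₁, -⟩ := f.exists_isTestFamily₂ g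
  have hM : 0 ≤ M := (norm_nonneg _).trans (hf₁.norm_le 0 ⟨0, 0⟩)
  have key : ∀ j w, ‖((TestFn.map (ContinuousLinearMap.adjoint B))^[j] f).1 w‖ ≤ ‖B‖ ^ j * M ∧
      (((TestFn.map (ContinuousLinearMap.adjoint B))^[j] f).1 w ≠ 0 → w ∈ Word.box N) := by
    intro j w
    induction j with
    | zero => exact ⟨by simpa using hf₁.norm_le 0 w, hf₁.mem_box 0 w⟩
    | succ j ih =>
      rw [Function.iterate_succ_apply']
      refine ⟨?_, fun h => ih.2 fun h0 => h (by simp [TestFn.map, h0])⟩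
      refine (ContinuousLinearMap.le_opNorm _ _).trans ?_
      rw [LinearIsometryEquiv.norm_map, pow_succ', mul_assoc]
      exact mul_le_mul_of_nonneg_left ih.1 (norm_nonneg _)
  refine eq_zero_of_iterated_integral (T := t)
    (e := fun j t => kernelForm (y t) ((TestFn.map (ContinuousLinearMap.adjoint B))^[j] f).1 g.1)
    (c := fun t => M * M * ∫ p, boxNorm N (y t) p ∂wordMeasure₄) (norm_nonneg B) ht hf ?_
    ((hy.intervalIntegrable_integral_boxNorm N ht).const_mul _)
  intro j t ht
  rw [← mul_assoc, ← integral_const_mul]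
  refine norm_integral_le_of_norm_le ((integrable_boxNorm_single (hy.single t ht N)).const_mul _)
    (.of_forall fun p => ?_)
  refine (norm_formIntegrand_le (fun w => (key j w).2) (hg₁.mem_box 0) (fun w => (key j w).1)
    (hg₁.norm_le 0) _ _).trans_eq (by ring)

/-- Induction on the sum of the bounds `m`, `n`, below which the lengths of the words in the
supports of `f` and `g` lie. Each noise term contains at least one annihilation, which lowers a
bound by one, so the induction hypothesis removes it and only the `B` term survives. -/
lemma kernelForm_eq_zero_of_homogeneous (hy : IsBoxIntegrable s y)
    (h : ∀ f g : TestFn 𝔨, ∀ t, s ≤ t → kernelForm (y t) f.1 g.1 =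
      (∫ r in s..t, kernelForm (leftMul A₁ (y r)) (annihilate r f.1) g.1)
      + (∫ r in s..t, kernelForm (leftMul A₀ (y r)) (annihilate r f.1) (annihilate r g.1))
      + (∫ r in s..t, kernelForm (leftMul Am₁ (y r)) f.1 (annihilate r g.1))
      + (∫ r in s..t, kernelForm (leftMul B (y r)) f.1 g.1)) (k : ℕ) :
    ∀ m n, m + n ≤ k → ∀ f g : TestFn 𝔨, (∀ w : Word, m ≤ w.1 → f.1 w = 0) →
      (∀ w : Word, n ≤ w.1 → g.1 w = 0) → ∀ t, s ≤ t → kernelForm (y t) f.1 g.1 = 0 := by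
  induction k with
  | zero =>
    intro m n hmn f g hf _ t _
    exact kernelForm_zero_left _ fun w => hf w (by omega)
  | succ k ih =>
    intro m n hmn f g hf hg
    rcases m with _ | m
    · exact fun t _ => kernelForm_zero_left _ fun w => hf w (by omega)
    rcases n with _ | n
    · exact fun t _ => kernelForm_zero_right _ fun w => hg w (by omega)
    intro t ht
    -- Stated for every `f` with this length bound, because the iteration needs it for all `(B*)ʲ
    -- f`; these satisfy the same bound.
    have van : ∀ f : TestFn 𝔨, (∀ w : Word, m + 1 ≤ w.1 → f.1 w = 0) → ∀ t, s ≤ t →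
        kernelForm (y t) f.1 g.1 =
          ∫ r in s..t, kernelForm (y r) (f.map (ContinuousLinearMap.adjoint B)).1 g.1 := by
      intro f hf t ht
      have hf' : ∀ (A : 𝔨 →L[ℂ] 𝔨) r (w : Word), m ≤ w.1 →
          ((f.annihilate r).map A).1 w = 0 := fun A r w hw => by
        have : f.1 (Word.cons r w) = 0 := hf _ (by simpa [Word.cons] using hw)
        simp [TestFn.map, TestFn.annihilate, annihilate, this]
      have hg' : ∀ r (w : Word), n ≤ w.1 → (g.annihilate r).1 w = 0 := fun r w hw =>
        hg _ (by simpa [Word.cons] using hw)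
      have v : ∀ F : ℝ → ℂ, (∀ r, s ≤ r → F r = 0) → ∫ r in s..t, F r = 0 := fun F hF => by
        rw [intervalIntegral.integral_congr (g := fun _ => (0 : ℂ)) fun r hr =>
          hF r (by rw [Set.uIcc_of_le ht] at hr; exact hr.1)]
        simp
      rw [h f g t ht,
        v (fun r => kernelForm (leftMul A₁ (y r)) (annihilate r f.1) g.1) fun r hr =>
          (kernelForm_leftMul _ _ _ _).trans
            (ih m (n + 1) (by omega) ((f.annihilate r).map _) g (hf' _ r) hg r hr),
        v (fun r => kernelForm (leftMul A₀ (y r)) (annihilate r f.1) (annihilate r g.1)) fun r hr =>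
          (kernelForm_leftMul _ _ _ _).trans
            (ih m n (by omega) ((f.annihilate r).map _) (g.annihilate r) (hf' _ r) (hg' r) r hr),
        v (fun r => kernelForm (leftMul Am₁ (y r)) f.1 (annihilate r g.1)) fun r hr =>
          (kernelForm_leftMul _ _ _ _).trans
            (ih (m + 1) n (by omega) (f.map _) (g.annihilate r)
              (fun w hw => by simp [TestFn.map, hf w hw]) (hg' r) r hr), zero_add, zero_add,
        zero_add]
      exact intervalIntegral.integral_congr fun r _ => kernelForm_leftMul _ _ _ _
    refine hy.kernelForm_eq_zero_of_integral_eq (B := B) f g (fun j t ht => ?_) ht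
    rw [Function.iterate_succ_apply']
    refine van _ (fun w hw => ?_) t ht
    induction j with
    | zero => exact hf w hw
    | succ j ihj => rw [Function.iterate_succ_apply']; simp [TestFn.map, ihj]

theorem kernelForm_eq_of_satisfiesQSDE {x u : ℝ → Word → Word → Word → (𝔨 →L[ℂ] 𝔨)}
    (hx : IsBoxIntegrable s x) (hu : IsBoxIntegrable s u)
    (ex : SatisfiesQSDE A₁ A₀ Am₁ B s x) (eu : SatisfiesQSDE A₁ A₀ Am₁ B s u)
    (f g : TestFn 𝔨) {t : ℝ} (ht : s ≤ t) :
    kernelForm (fun σ τ υ => x t σ τ υ - u t σ τ υ) f.1 g.1 = 0 := by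
  obtain ⟨m, hm⟩ := f.exists_length_bound
  obtain ⟨n, hn⟩ := g.exists_length_bound
  refine kernelForm_eq_zero_of_homogeneous (hx.sub hu) (A₁ := A₁) (A₀ := A₀) (Am₁ := Am₁) (B := B) ?_
    (m + n) m n le_rfl f g hm hn t ht
  intro f g t ht
  obtain ⟨N, M, hf, hf', hg, hg'⟩ := f.exists_isTestFamily₂ g
  have key : ∀ (A : 𝔨 →L[ℂ] 𝔨) {φ γ : ℝ → Word → 𝔨}, IsTestFamily N M φ → IsTestFamily N M γ →
      ∫ r in s..t, kernelForm (leftMul A fun σ τ υ => x r σ τ υ - u r σ τ υ) (φ r) (γ r) =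
        (∫ r in s..t, kernelForm (leftMul A (x r)) (φ r) (γ r)) -
          ∫ r in s..t, kernelForm (leftMul A (u r)) (φ r) (γ r) := by
    intro A φ γ hφ hγ
    rw [← intervalIntegral.integral_sub
      ((hx.leftMul A).intervalIntegrable_kernelForm hφ hγ ht)
      ((hu.leftMul A).intervalIntegrable_kernelForm hφ hγ ht)]
    refine intervalIntegral.integral_congr fun r hr => ?_
    rw [Set.uIcc_of_le ht] at hr
    simp only [leftMul_sub]
    exact (hx.leftMul A).kernelForm_sub (hu.leftMul A) hφ hγ hr.1 r r
  rw [key A₁ hf' hg, key A₀ hf' hg', key Am₁ hf hg', key B hf hg,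
    hx.kernelForm_sub hu hf hg ht t t, ex f g t ht, eu f g t ht]
  ring

end Uniqueness

end

/-! ### Recursion of the kernel in its last letter. -/

section

section Recursion

variable {𝔨 : Type*} [NormedAddCommGroup 𝔨] [InnerProductSpace ℂ 𝔨]

/-- Labelled points with distinct positions in `]s, t[`. -/
def IsConfiguration (s t : ℝ) (ξ : Multiset (ℝ ×ₗ Fin 3)) : Prop :=
  (∀ p ∈ ξ, s < (ofLex p).1 ∧ (ofLex p).1 < t) ∧ (ξ.map fun p => (ofLex p).1).Nodup

open Classical in
/-- The kernel `u_s^t` as a function of the multiset of labelled points. -/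
def configurationKernel (A : Fin 3 → (𝔨 →L[ℂ] 𝔨)) (B : 𝔨 →L[ℂ] 𝔨) (s t : ℝ)
    (ξ : Multiset (ℝ ×ₗ Fin 3)) : 𝔨 →L[ℂ] 𝔨 :=
  if IsConfiguration s t ξ then orderedProduct A B t s (ξ.sort (· ≤ ·)) else 0

lemma qsdeKernel_eq (A₁ A₀ Am₁ B : 𝔨 →L[ℂ] 𝔨) (s t : ℝ) (σ τ υ : Word) :
    qsdeKernel A₁ A₀ Am₁ B s t σ τ υ = configurationKernel ![A₁, A₀, Am₁] B s t
      (σ.labelled 0 + τ.labelled 1 + υ.labelled 2) := by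
  unfold qsdeKernel configurationKernel
  simp only [IsConfiguration]
  congr

/-- The operator `exp((t - s)B)`. -/
def expB (B : 𝔨 →L[ℂ] 𝔨) (s t : ℝ) : 𝔨 →L[ℂ] 𝔨 := NormedSpace.exp (((t - s : ℝ) : ℂ) • B)

variable (A : Fin 3 → (𝔨 →L[ℂ] 𝔨)) (B : 𝔨 →L[ℂ] 𝔨) (s t : ℝ)

/-- The definition peels off the earliest letter; an evolution equation in `t` requires peeling off
the latest. -/
lemma orderedProduct_append_singleton (p : ℝ ×ₗ Fin 3) (L : List (ℝ ×ₗ Fin 3)) :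
    orderedProduct A B t s (L ++ [p]) =
      expB B (ofLex p).1 t * A (ofLex p).2 * orderedProduct A B (ofLex p).1 s L := by
  induction L generalizing s with
  | nil => rfl
  | cons q L ih =>
    simp only [List.cons_append, orderedProduct, ih, mul_assoc]

lemma isConfiguration_cons_iff {s t : ℝ} {p : ℝ ×ₗ Fin 3} {ξ : Multiset (ℝ ×ₗ Fin 3)} :
    IsConfiguration s t (p ::ₘ ξ) ↔ (s < (ofLex p).1 ∧ (ofLex p).1 < t) ∧
      (∀ q ∈ ξ, (ofLex q).1 ≠ (ofLex p).1) ∧ IsConfiguration s t ξ := by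
  simp only [IsConfiguration, Multiset.mem_cons, forall_eq_or_imp, Multiset.map_cons,
    Multiset.nodup_cons, Multiset.mem_map, not_exists, not_and]
  tauto

lemma IsConfiguration.mono {s t t' : ℝ} (h : t ≤ t') {ξ : Multiset (ℝ ×ₗ Fin 3)}
    (hξ : IsConfiguration s t ξ) : IsConfiguration s t' ξ :=
  ⟨fun p hp => ⟨(hξ.1 p hp).1, (hξ.1 p hp).2.trans_le h⟩, hξ.2⟩

open Classical in
/-- The contribution of the last point `p` to the kernel. -/
def lastPoint (p : ℝ ×ₗ Fin 3) (ξ : Multiset (ℝ ×ₗ Fin 3)) : 𝔨 →L[ℂ] 𝔨 :=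
  if s < (ofLex p).1 ∧ (ofLex p).1 < t then
    expB B (ofLex p).1 t * A (ofLex p).2 * configurationKernel A B s (ofLex p).1 ξ else 0

open Classical in
-- In a configuration only the latest point gives a nonzero term. If `ξ` is not a configuration
-- every term vanishes, since a nonzero one would make `ξ` a configuration. Writing the single term
-- as a sum over all points avoids any selection of a maximum and fits the sum-integral lemma.
lemma configurationKernel_eq_add_sum (ξ : Multiset (ℝ ×ₗ Fin 3)) :
    configurationKernel A B s t ξ = (if ξ = 0 then expB B s t else 0) +
      (ξ.map fun p => lastPoint A B s t p (ξ.erase p)).sum := by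
  rcases eq_or_ne ξ 0 with rfl | h0
  · simp [configurationKernel, IsConfiguration, orderedProduct, expB]
  rw [if_neg h0, zero_add]
  by_cases hξ : IsConfiguration s t ξ
  · obtain h | ⟨L, p, hL⟩ := List.eq_nil_or_concat (ξ.sort (· ≤ ·))
    · exact absurd (by rw [← Multiset.sort_eq ξ (· ≤ ·), h]; rfl) h0
    rw [List.concat_eq_append] at hL
    have hp : ξ = p ::ₘ (L : Multiset _) := by
      rw [← Multiset.sort_eq ξ (· ≤ ·), hL, ← Multiset.coe_add, add_comm]; rfl
    have hs : (L ++ [p]).Pairwise (· ≤ ·) := hL ▸ Multiset.pairwise_sort ξ (· ≤ ·)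
    rw [List.pairwise_append] at hs
    have hc := hξ
    rw [hp, isConfiguration_cons_iff] at hc
    have hlt : ∀ q ∈ L, (ofLex q).1 < (ofLex p).1 := fun q hq =>
      lt_of_le_of_ne (Prod.Lex.monotone_fst _ _ (hs.2.2 q hq p (by simp)))
        (hc.2.1 q (by simpa using hq))
    have hL' : IsConfiguration s (ofLex p).1 (L : Multiset _) :=
      ⟨fun q hq => ⟨(hc.2.2.1 q hq).1, hlt q (by simpa using hq)⟩, hc.2.2.2⟩
    have hsort : (L : Multiset (ℝ ×ₗ Fin 3)).sort (· ≤ ·) = L := by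
      rw [Multiset.coe_sort]
      exact List.mergeSort_eq_self _ hs.1
    -- Removing an earlier point `q` leaves `p`, which lies after `q` and so outside `]s, q[`.
    have hz : ∀ q ∈ (L : Multiset (ℝ ×ₗ Fin 3)), lastPoint A B s t q (ξ.erase q) = 0 := by
      intro q hq
      have : ¬ IsConfiguration s (ofLex q).1 (ξ.erase q) := fun h => by
        have hne : p ≠ q := fun e => (hlt q (by simpa using hq)).ne (by rw [e])
        have := (h.1 p ((Multiset.mem_erase_of_ne hne).2 (by rw [hp]; simp))).2
        exact this.not_gt (hlt q (by simpa using hq))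
      simp [lastPoint, configurationKernel, this]
    have hsum : (ξ.map fun p => lastPoint A B s t p (ξ.erase p)).sum =
        lastPoint A B s t p (L : Multiset _) := by
      conv_lhs => arg 1; arg 2; rw [hp]
      rw [Multiset.map_cons, Multiset.sum_cons, Multiset.map_congr rfl hz]
      simp [hp]
    rw [hsum, configurationKernel, if_pos hξ, hL, orderedProduct_append_singleton, lastPoint,
      if_pos hc.1, configurationKernel, if_pos hL', hsort]
  · rw [configurationKernel, if_neg hξ]
    refine (Multiset.sum_eq_zero fun x hx => ?_).symm
    obtain ⟨p, hp, rfl⟩ := Multiset.mem_map.1 hx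
    by_cases h : (s < (ofLex p).1 ∧ (ofLex p).1 < t) ∧
        IsConfiguration s (ofLex p).1 (ξ.erase p)
    · refine absurd ?_ hξ
      rw [← Multiset.cons_erase hp, isConfiguration_cons_iff]
      exact ⟨h.1, fun q hq => (h.2.1 q hq).2.ne, h.2.mono h.1.2.le⟩
    · rw [lastPoint]
      split_ifs with h'
      · rw [configurationKernel, if_neg fun h'' => h ⟨h', h''⟩, mul_zero]
      · rfl

variable [CompleteSpace 𝔨]


lemma continuous_expB : Continuous fun p : ℝ × ℝ => expB B p.1 p.2 := by
  let _ : NormedAlgebra ℚ (𝔨 →L[ℂ] 𝔨) := .restrictScalars ℚ ℂ (𝔨 →L[ℂ] 𝔨)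
  exact (NormedSpace.exp_continuous).comp (by fun_prop)

lemma hasDerivAt_expB : HasDerivAt (expB B s) (B * expB B s t) t := by
  have h := (hasDerivAt_exp_smul_const' (𝕂 := ℂ) B ((t - s : ℝ) : ℂ)).scomp (𝕜 := ℝ) t
    (((hasDerivAt_id t).sub_const s).ofReal_comp)
  exact HasDerivAt.congr_deriv (show HasDerivAt (expB B s) _ t from h) (by simp [expB])

lemma integral_mul_expB : ∫ r in s..t, B * expB B s r = expB B s t - 1 := by
  rw [intervalIntegral.integral_eq_sub_of_hasDerivAt (f := expB B s) (f' := fun r => B * expB B s r)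
    (fun r _ => hasDerivAt_expB B s r)]
  · simp [expB]
  · exact (continuous_const.mul
      ((continuous_expB B).comp (.prodMk_right s))).intervalIntegrable _ _

lemma hasIntegral_multiset_sum {ι E : Type*} [NormedAddCommGroup E] [NormedSpace ℝ E]
    (m : Multiset ι) (h : ι → ℝ → E) (c : ι → E)
    (hh : ∀ i ∈ m, IntervalIntegrable (h i) volume s t ∧ ∫ r in s..t, h i r = c i) :
    IntervalIntegrable (fun r => (m.map fun i => h i r).sum) volume s t ∧
      ∫ r in s..t, (m.map fun i => h i r).sum = (m.map c).sum := by
  induction m using Multiset.induction with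
  | empty => simp
  | cons i m ih =>
    obtain ⟨h₁, h₂⟩ := hh i (Multiset.mem_cons_self i m)
    obtain ⟨h₃, h₄⟩ := ih fun j hj => hh j (Multiset.mem_cons_of_mem hj)
    simp only [Multiset.map_cons, Multiset.sum_cons]
    exact ⟨h₁.add h₃, by rw [intervalIntegral.integral_add h₁ h₃, h₂, h₄]⟩

open Classical in
-- As a function of `r` the contribution is zero up to the position `q` of the point, jumps there to
-- `C`, and then solves `X' = BX`. The integral of `BX` is therefore the final value minus the jump.
lemma hasIntegral_lastPoint {s t : ℝ} (hst : s ≤ t) (p : ℝ ×ₗ Fin 3)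
    (ξ : Multiset (ℝ ×ₗ Fin 3)) :
    IntervalIntegrable (fun r => B * lastPoint A B s r p ξ) volume s t ∧
      ∫ r in s..t, B * lastPoint A B s r p ξ = lastPoint A B s t p ξ -
        if s < (ofLex p).1 ∧ (ofLex p).1 < t then
          A (ofLex p).2 * configurationKernel A B s (ofLex p).1 ξ else 0 := by
  set q := (ofLex p).1
  set C := A (ofLex p).2 * configurationKernel A B s q ξ
  have hl : ∀ r, lastPoint A B s r p ξ = if s < q ∧ q < r then expB B q r * C else 0 :=
    fun r => by simp only [lastPoint, C, mul_assoc]; rfl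
  by_cases h : s < q ∧ q < t
  · have hz : Set.EqOn (fun _ => 0) (fun r => B * lastPoint A B s r p ξ) (Set.uIoc s q) := by
      intro r hr
      rw [Set.uIoc_of_le h.1.le] at hr
      simp only [hl]
      rw [if_neg fun h' => h'.2.not_ge hr.2, mul_zero]
    have hq : Set.EqOn (fun r => B * expB B q r * C) (fun r => B * lastPoint A B s r p ξ)
        (Set.uIoc q t) := by
      intro r hr
      rw [Set.uIoc_of_le h.2.le] at hr
      simp only [hl]
      rw [if_pos ⟨h.1, hr.1⟩, mul_assoc]
    have hc : IntervalIntegrable (fun r => B * expB B q r) volume q t :=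
      (continuous_const.mul ((continuous_expB B).comp (.prodMk_right q))).intervalIntegrable _ _
    have i₁ : IntervalIntegrable (fun r => B * lastPoint A B s r p ξ) volume s q :=
      intervalIntegrable_const.congr hz
    have i₂ : IntervalIntegrable (fun r => B * lastPoint A B s r p ξ) volume q t :=
      (hc.mul_const C).congr hq
    have hm : ∫ r in q..t, B * expB B q r * C = (∫ r in q..t, B * expB B q r) * C :=
      ((ContinuousLinearMap.mul ℝ (𝔨 →L[ℂ] 𝔨)).flip C).intervalIntegral_comp_comm hc
    refine ⟨i₁.trans i₂, ?_⟩
    rw [← intervalIntegral.integral_add_adjacent_intervals i₁ i₂,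
      ← intervalIntegral.integral_congr_ae (μ := volume) (.of_forall fun _ h => hz h), ← intervalIntegral.integral_congr_ae (μ := volume) (.of_forall fun _ h => hq h),
      hm, integral_mul_expB, hl, if_pos h, if_pos h]
    simp [sub_mul]
  · have hz : Set.EqOn (fun _ => 0) (fun r => B * lastPoint A B s r p ξ) (Set.uIoc s t) := by
      intro r hr
      rw [Set.uIoc_of_le hst] at hr
      simp only [hl]
      rw [if_neg fun h' => h ⟨h'.1, h'.2.trans_le hr.2⟩, mul_zero]
    refine ⟨intervalIntegrable_const.congr hz, ?_⟩
    rw [← intervalIntegral.integral_congr_ae (μ := volume) (.of_forall fun _ h => hz h), hl, if_neg h, if_neg h]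
    simp

open Classical in
-- The pointwise counterpart of the weak equation: integrating the last-letter recursion removes the
-- exponentials, and the jumps remain as the three noise terms.
lemma hasIntegral_configurationKernel {s t : ℝ} (hst : s ≤ t) (ξ : Multiset (ℝ ×ₗ Fin 3)) :
    IntervalIntegrable (fun r => B * configurationKernel A B s r ξ) volume s t ∧
    configurationKernel A B s t ξ = (if ξ = 0 then 1 else 0) +
      (ξ.map fun p => if s < (ofLex p).1 ∧ (ofLex p).1 < t then
        A (ofLex p).2 * configurationKernel A B s (ofLex p).1 (ξ.erase p) else 0).sum +
      ∫ r in s..t, B * configurationKernel A B s r ξ := by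
  have h₀ : IntervalIntegrable (fun r => if ξ = 0 then B * expB B s r else 0) volume s t := by
    split_ifs
    · exact (continuous_const.mul
        ((continuous_expB B).comp (.prodMk_right s))).intervalIntegrable _ _
    · exact intervalIntegrable_const
  obtain ⟨h₁, h₂⟩ := hasIntegral_multiset_sum s t ξ _ _
    fun p _ => hasIntegral_lastPoint A B hst p (ξ.erase p)
  have e : (fun r => B * configurationKernel A B s r ξ) = fun r =>
      (if ξ = 0 then B * expB B s r else 0) +
        (ξ.map fun p => B * lastPoint A B s r p (ξ.erase p)).sum := by
    funext r
    rw [configurationKernel_eq_add_sum, mul_add, mul_ite, mul_zero, Multiset.sum_map_mul_left]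
  refine ⟨e ▸ h₀.add h₁, ?_⟩
  rw [e, intervalIntegral.integral_add h₀ h₁, h₂, Multiset.sum_map_sub,
    configurationKernel_eq_add_sum A B s t]
  split_ifs with h
  · rw [integral_mul_expB]; abel
  · simp

end Recursion
end

/-! ### Measurability, bounds and admissibility of the kernel. -/

section

/-- The space of bounded operators need not be separable in norm, so separability of the range is
carried along; a countable cover preserves it. -/
lemma stronglyMeasurable_of_cover {ι X E : Type*} {Z : ι → Type*} [Countable ι] [MeasurableSpace X]
    [∀ i, MeasurableSpace (Z i)] [TopologicalSpace E] [TopologicalSpace.PseudoMetrizableSpace E]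
    {e : ∀ i, Z i → X} (he : ∀ i, MeasurableEmbedding (e i)) (hcov : ∀ x, ∃ i z, e i z = x)
    {f : X → E} (hf : ∀ i, StronglyMeasurable (f ∘ e i)) : StronglyMeasurable f := by
  borelize E
  rw [stronglyMeasurable_iff_measurable_separable]
  constructor
  · intro S hS
    have : f ⁻¹' S = ⋃ i, e i '' ((f ∘ e i) ⁻¹' S) := by
      ext x
      simp only [Set.mem_preimage, Set.mem_iUnion, Set.mem_image, Function.comp]
      constructor
      · intro h
        obtain ⟨i, z, rfl⟩ := hcov x
        exact ⟨i, z, h, rfl⟩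
      · rintro ⟨i, z, h, rfl⟩
        exact h
    rw [this]
    exact .iUnion fun i => (he i).measurableSet_image.2 ((hf i).measurable hS)
  · have : Set.range f = ⋃ i, Set.range (f ∘ e i) := by
      ext y
      simp only [Set.mem_range, Set.mem_iUnion, Function.comp]
      constructor
      · rintro ⟨x, rfl⟩
        obtain ⟨i, z, rfl⟩ := hcov x
        exact ⟨i, z, rfl⟩
      · rintro ⟨i, z, rfl⟩
        exact ⟨_, rfl⟩
    rw [this]
    exact .iUnion fun i => (hf i).isSeparable_range

lemma Word.stronglyMeasurable_prod {X E : Type*} [MeasurableSpace X] [TopologicalSpace E]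
    [TopologicalSpace.PseudoMetrizableSpace E] {f : Word × X → E}
    (hf : ∀ n, StronglyMeasurable fun q : (Fin n → ℝ) × X => f (⟨n, q.1⟩, q.2)) :
    StronglyMeasurable f :=
  stronglyMeasurable_of_cover (e := fun n => Prod.map (Word.ofFn n) id)
    (fun n => (Word.measurableEmbedding_ofFn n).prodMap .id)
    (fun ⟨w, x⟩ => ⟨w.1, (w.2, x), rfl⟩) hf

/-- The sum of `H(wᵢ, w ∖ wᵢ, x)` over the letters of `w`. -/
def letterSum {X E : Type*} [AddCommMonoid E] (H : ℝ → Word → X → E) (w : Word) (x : X) : E :=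
  ∑ i : Fin w.1, H (w.2 i) (w.erase i) x

lemma Word.measurable_erase_succ (n : ℕ) (i : Fin (n + 1)) :
    Measurable fun v : Fin (n + 1) → ℝ => (v i, ofFn n (i.removeNth v)) :=
  (measurable_pi_apply i).prodMk ((measurableEmbedding_ofFn n).measurable.comp
    (measurable_pi_lambda _ fun j => measurable_pi_apply (i.succAbove j)))

lemma letterSum_ofFn_succ {X E : Type*} [AddCommMonoid E] (H : ℝ → Word → X → E) (n : ℕ)
    (v : Fin (n + 1) → ℝ) (x : X) : letterSum H ⟨n + 1, v⟩ x =
      ∑ i : Fin (n + 1), H (v i) (Word.ofFn n (i.removeNth v)) x := rfl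

lemma letterSum_ofFn_zero {X E : Type*} [AddCommMonoid E] (H : ℝ → Word → X → E)
    (v : Fin 0 → ℝ) (x : X) : letterSum H ⟨0, v⟩ x = 0 := rfl

lemma stronglyMeasurable_letterSum {X E : Type*} [MeasurableSpace X] [TopologicalSpace E]
    [TopologicalSpace.PseudoMetrizableSpace E] [AddCommMonoid E] [ContinuousAdd E]
    {H : ℝ → Word → X → E} (hH : StronglyMeasurable fun q : ℝ × Word × X => H q.1 q.2.1 q.2.2) :
    StronglyMeasurable fun q : Word × X => letterSum H q.1 q.2 := by
  refine Word.stronglyMeasurable_prod fun n => ?_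
  cases n with
  | zero => simpa only [letterSum_ofFn_zero] using stronglyMeasurable_const
  | succ n =>
    simp only [letterSum_ofFn_succ]
    refine Finset.stronglyMeasurable_fun_sum _ fun i _ => ?_
    have h := Word.measurable_erase_succ n i
    exact hH.comp_measurable (g := fun q : (Fin (n + 1) → ℝ) × X =>
      (q.1 i, Word.ofFn n (i.removeNth q.1), q.2)) ((h.fst.comp measurable_fst).prodMk
        ((h.snd.comp measurable_fst).prodMk measurable_snd))

lemma Word.measurable_length : Measurable fun w : Word => w.1 :=
  (Continuous.measurable (continuous_of_openEmbedding_cover isOpenEmbedding_ofFn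
    (fun w => ⟨w.1, w.2, rfl⟩) fun _ => continuous_const))

lemma Word.labelled_eq (i : Fin 3) (w : Word) :
    w.labelled i = w.letters.map fun r => toLex (r, i) := by
  simp only [labelled, letters, Multiset.map_map, Function.comp_def]

lemma Word.labelled_eq_cons (i : Fin 3) (w : Word) (j : Fin w.1) :
    w.labelled i = toLex (w.2 j, i) ::ₘ (w.erase j).labelled i := by
  rw [labelled_eq, letters_erase w j, Multiset.map_cons, labelled_eq]

section

variable {𝔨 : Type*} [NormedAddCommGroup 𝔨] [InnerProductSpace ℂ 𝔨]

/-- A labelled point comes from a letter of the word carrying its label, and erasing the point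
erases that letter. The sum over points thus splits by label. -/
lemma sum_map_labelled {E : Type*} [AddCommMonoid E]
    (Φ : ℝ ×ₗ Fin 3 → Multiset (ℝ ×ₗ Fin 3) → E) (σ τ υ : Word) :
    ((σ.labelled 0 + τ.labelled 1 + υ.labelled 2).map fun p =>
        Φ p ((σ.labelled 0 + τ.labelled 1 + υ.labelled 2).erase p)).sum =
      letterSum (fun r σ _ => Φ (toLex (r, 0)) (σ.labelled 0 + τ.labelled 1 + υ.labelled 2)) σ () +
      letterSum (fun r τ _ => Φ (toLex (r, 1)) (σ.labelled 0 + τ.labelled 1 + υ.labelled 2)) τ () +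
      letterSum (fun r υ _ => Φ (toLex (r, 2)) (σ.labelled 0 + τ.labelled 1 + υ.labelled 2)) υ () := by
  have h₀ : ∀ j, (σ.labelled 0 + τ.labelled 1 + υ.labelled 2).erase (toLex (σ.2 j, 0)) =
      (σ.erase j).labelled 0 + τ.labelled 1 + υ.labelled 2 := fun j => by
    rw [Word.labelled_eq_cons 0 σ j, Multiset.cons_add, Multiset.cons_add,
      Multiset.erase_cons_head]
  have h₁ : ∀ j, (σ.labelled 0 + τ.labelled 1 + υ.labelled 2).erase (toLex (τ.2 j, 1)) =
      σ.labelled 0 + (τ.erase j).labelled 1 + υ.labelled 2 := fun j => by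
    rw [Word.labelled_eq_cons 1 τ j, Multiset.add_cons, Multiset.cons_add,
      Multiset.erase_cons_head]
  have h₂ : ∀ j, (σ.labelled 0 + τ.labelled 1 + υ.labelled 2).erase (toLex (υ.2 j, 2)) =
      σ.labelled 0 + τ.labelled 1 + (υ.erase j).labelled 2 := fun j => by
    rw [Word.labelled_eq_cons 2 υ j, Multiset.add_cons, Multiset.erase_cons_head]
  rw [Multiset.map_add, Multiset.map_add, Multiset.sum_add, Multiset.sum_add]
  simp only [letterSum, ← h₀, ← h₁, ← h₂]
  simp only [Word.labelled, Multiset.map_map, Function.comp]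
  rfl

lemma labelled_eq_zero_iff (σ τ υ : Word) :
    σ.labelled 0 + τ.labelled 1 + υ.labelled 2 = 0 ↔ σ.1 + τ.1 + υ.1 = 0 := by
  rw [← Multiset.card_eq_zero]
  simp [Word.labelled, and_assoc]

variable (A₁ A₀ Am₁ B : 𝔨 →L[ℂ] 𝔨) (s : ℝ)

open Classical in
lemma qsdeKernel_eq_letterSum (t : ℝ) (σ τ υ : Word) : qsdeKernel A₁ A₀ Am₁ B s t σ τ υ =
    (if σ.1 + τ.1 + υ.1 = 0 then expB B s t else 0) +
    (letterSum (fun r σ _ => if s < r ∧ r < t then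
        expB B r t * A₁ * qsdeKernel A₁ A₀ Am₁ B s r σ τ υ else 0) σ () +
      letterSum (fun r τ _ => if s < r ∧ r < t then
        expB B r t * A₀ * qsdeKernel A₁ A₀ Am₁ B s r σ τ υ else 0) τ () +
      letterSum (fun r υ _ => if s < r ∧ r < t then
        expB B r t * Am₁ * qsdeKernel A₁ A₀ Am₁ B s r σ τ υ else 0) υ ()) := by
  simp only [qsdeKernel_eq]
  rw [configurationKernel_eq_add_sum, sum_map_labelled (fun p ξ => lastPoint _ B s t p ξ)]
  simp only [labelled_eq_zero_iff, lastPoint, ofLex_toLex, Matrix.cons_val]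
  congr!

open Classical in
lemma hasIntegral_qsdeKernel [CompleteSpace 𝔨] {t : ℝ} (ht : s ≤ t) (σ τ υ : Word) :
    IntervalIntegrable (fun r => B * qsdeKernel A₁ A₀ Am₁ B s r σ τ υ) volume s t ∧
    qsdeKernel A₁ A₀ Am₁ B s t σ τ υ = (if σ.1 + τ.1 + υ.1 = 0 then 1 else 0) +
    (letterSum (fun r σ _ => if s < r ∧ r < t then
        A₁ * qsdeKernel A₁ A₀ Am₁ B s r σ τ υ else 0) σ () +
      letterSum (fun r τ _ => if s < r ∧ r < t then
        A₀ * qsdeKernel A₁ A₀ Am₁ B s r σ τ υ else 0) τ () +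
      letterSum (fun r υ _ => if s < r ∧ r < t then
        Am₁ * qsdeKernel A₁ A₀ Am₁ B s r σ τ υ else 0) υ ()) +
    ∫ r in s..t, B * qsdeKernel A₁ A₀ Am₁ B s r σ τ υ := by
  obtain ⟨h₁, h₂⟩ := hasIntegral_configurationKernel ![A₁, A₀, Am₁] B ht
    (σ.labelled 0 + τ.labelled 1 + υ.labelled 2)
  simp only [qsdeKernel_eq]
  refine ⟨h₁, ?_⟩
  rw [h₂, sum_map_labelled (fun p ξ => if s < (ofLex p).1 ∧ (ofLex p).1 < t then
        (![A₁, A₀, Am₁] : Fin 3 → (𝔨 →L[ℂ] 𝔨)) (ofLex p).2 *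
          configurationKernel ![A₁, A₀, Am₁] B s (ofLex p).1 ξ else 0)]
  simp only [labelled_eq_zero_iff, ofLex_toLex, Matrix.cons_val]
  congr!


lemma stronglyMeasurable_lastLetter {X : Type*} [MeasurableSpace X] [CompleteSpace 𝔨]
    (A : 𝔨 →L[ℂ] 𝔨) {K : ℝ → Word → X → (𝔨 →L[ℂ] 𝔨)}
    (hK : StronglyMeasurable fun q : ℝ × Word × X => K q.1 q.2.1 q.2.2) :
    StronglyMeasurable fun q : ℝ × Word × X => letterSum (fun r σ (p : ℝ × X) =>
      if s < r ∧ r < p.1 then expB B r p.1 * A * K r σ p.2 else 0) q.2.1 (q.1, q.2.2) := by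
  refine (stronglyMeasurable_letterSum (H := fun r σ (p : ℝ × X) =>
      if s < r ∧ r < p.1 then expB B r p.1 * A * K r σ p.2 else 0) ?_).comp_measurable
    (by fun_prop : Measurable fun q : ℝ × Word × X => (q.2.1, q.1, q.2.2))
  refine StronglyMeasurable.ite ?_ ?_ stronglyMeasurable_const
  · have m₁ : Measurable fun q : ℝ × Word × ℝ × X => q.1 := by fun_prop
    have m₂ : Measurable fun q : ℝ × Word × ℝ × X => q.2.2.1 := by fun_prop
    exact (measurableSet_lt measurable_const m₁).inter (measurableSet_lt m₁ m₂)
  · exact (((continuous_expB B).stronglyMeasurable.comp_measurable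
      (by fun_prop : Measurable fun q : ℝ × Word × ℝ × X => (q.1, q.2.2.1))).mul
      stronglyMeasurable_const).mul (hK.comp_measurable
      (by fun_prop : Measurable fun q : ℝ × Word × ℝ × X => (q.1, q.2.1, q.2.2.2)))

lemma Word.length_erase (w : Word) (i : Fin w.1) : w.1 = (w.erase i).1 + 1 := by
  simpa [card_letters] using congrArg Multiset.card (w.letters_erase i)

open Classical in
-- The last-letter recursion replaces a study of sorting: it expresses the kernel on words of total
-- length at most `n` through letter sums of the kernel on shorter words. The cut-off by length
-- makes the induction hypothesis a statement about one globally defined function.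
lemma stronglyMeasurable_qsdeKernel_of_length [CompleteSpace 𝔨] (n : ℕ) :
    StronglyMeasurable fun q : ℝ × Word × Word × Word =>
      if q.2.1.1 + q.2.2.1.1 + q.2.2.2.1 < n then
        qsdeKernel A₁ A₀ Am₁ B s q.1 q.2.1 q.2.2.1 q.2.2.2 else 0 := by
  have hl := Word.measurable_length
  have hlen : Measurable fun q : ℝ × Word × Word × Word => q.2.1.1 + q.2.2.1.1 + q.2.2.2.1 := by
    fun_prop
  induction n with
  | zero => simpa using stronglyMeasurable_const
  | succ n ih =>
    have h₀ : StronglyMeasurable fun q : ℝ × Word × Word × Word =>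
        if q.2.1.1 + q.2.2.1.1 + q.2.2.2.1 = 0 then expB B s q.1 else 0 :=
      StronglyMeasurable.ite (measurableSet_eq_fun hlen measurable_const)
        (((continuous_expB B).comp (.prodMk_right s)).stronglyMeasurable.comp_measurable
          measurable_fst) stronglyMeasurable_const
    -- One term for each word that can lose a letter; for `τ` and `υ` the variables are permuted so
    -- that this word comes first.
    have h₁ := stronglyMeasurable_lastLetter B s A₁ (X := Word × Word) (K := fun r σ p =>
      if σ.1 + p.1.1 + p.2.1 < n then qsdeKernel A₁ A₀ Am₁ B s r σ p.1 p.2 else 0) ih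
    have h₂ := (stronglyMeasurable_lastLetter B s A₀ (X := Word × Word) (K := fun r τ p =>
      if p.1.1 + τ.1 + p.2.1 < n then qsdeKernel A₁ A₀ Am₁ B s r p.1 τ p.2 else 0)
      (ih.comp_measurable (by fun_prop : Measurable fun q : ℝ × Word × Word × Word =>
        (q.1, q.2.2.1, q.2.1, q.2.2.2)))).comp_measurable
      (by fun_prop : Measurable fun q : ℝ × Word × Word × Word =>
        (q.1, q.2.2.1, q.2.1, q.2.2.2))
    have h₃ := (stronglyMeasurable_lastLetter B s Am₁ (X := Word × Word) (K := fun r υ p =>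
      if p.1.1 + p.2.1 + υ.1 < n then qsdeKernel A₁ A₀ Am₁ B s r p.1 p.2 υ else 0)
      (ih.comp_measurable (by fun_prop : Measurable fun q : ℝ × Word × Word × Word =>
        (q.1, q.2.2.1, q.2.2.2, q.2.1)))).comp_measurable
      (by fun_prop : Measurable fun q : ℝ × Word × Word × Word =>
        (q.1, q.2.2.2, q.2.1, q.2.2.1))
    convert! (h₀.add ((h₁.add h₂).add h₃)).indicator
      (measurableSet_lt hlen (measurable_const (a := n + 1))) using 1
    funext ⟨t, σ, τ, υ⟩
    by_cases hn : σ.1 + τ.1 + υ.1 < n + 1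
    · rw [Set.indicator_of_mem (by exact hn), if_pos hn]
      rw [qsdeKernel_eq_letterSum]
      have e : ∀ (w : Word) (i : Fin w.1), (w.erase i).1 + 1 = w.1 :=
        fun w i => (w.length_erase i).symm
      simp only [Pi.add_apply, Function.comp]
      refine congrArg₂ _ rfl (congrArg₂ _ (congrArg₂ _ ?_ ?_) ?_) <;>
        refine Finset.sum_congr rfl fun i _ => ?_
      · have := e σ i
        simp only [show (σ.erase i).1 + τ.1 + υ.1 < n by omega, if_true]
      · have := e τ i
        simp only [show σ.1 + (τ.erase i).1 + υ.1 < n by omega, if_true]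
      · have := e υ i
        simp only [show σ.1 + τ.1 + (υ.erase i).1 < n by omega, if_true]
    · rw [Set.indicator_of_notMem (by exact hn), if_neg hn]

lemma stronglyMeasurable_qsdeKernel [CompleteSpace 𝔨] :
    StronglyMeasurable fun q : ℝ × Word × Word × Word =>
      qsdeKernel A₁ A₀ Am₁ B s q.1 q.2.1 q.2.2.1 q.2.2.2 := by
  classical
  refine stronglyMeasurable_of_tendsto Filter.atTop
    (stronglyMeasurable_qsdeKernel_of_length A₁ A₀ Am₁ B s) (tendsto_pi_nhds.2 fun q => ?_)
  refine tendsto_const_nhds.congr' ?_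
  filter_upwards [Filter.eventually_gt_atTop (q.2.1.1 + q.2.2.1.1 + q.2.2.2.1)] with n hn
  rw [if_pos hn]

lemma norm_orderedProduct_le (A : Fin 3 → (𝔨 →L[ℂ] 𝔨)) {E M s₀ t : ℝ}
    (hM : ∀ i, ‖A i‖ ≤ M) (hE : ∀ r r', s₀ ≤ r → r ≤ t → s₀ ≤ r' → r' ≤ t → ‖expB B r r'‖ ≤ E)
    (L : List (ℝ ×ₗ Fin 3)) (hL : ∀ p ∈ L, s₀ ≤ (ofLex p).1 ∧ (ofLex p).1 ≤ t) :
    ∀ s, s₀ ≤ s → s ≤ t → ‖orderedProduct A B t s L‖ ≤ E * (M * E) ^ L.length := by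
  induction L with
  | nil =>
    intro s hs hst
    simpa [orderedProduct, expB] using hE s t hs hst (hs.trans hst) le_rfl
  | cons p L ih =>
    intro s hs hst
    have hp := hL p (by simp)
    have hE0 : 0 ≤ E := (norm_nonneg _).trans (hE s s hs hst hs hst)
    have hM0 : 0 ≤ M := (norm_nonneg _).trans (hM 0)
    have h₁ := ih (fun q hq => hL q (by simp [hq])) _ hp.1 hp.2
    calc _ ≤ ‖orderedProduct A B t (ofLex p).1 L * A (ofLex p).2‖ * ‖expB B s (ofLex p).1‖ :=
          norm_mul_le _ _
      _ ≤ (E * (M * E) ^ L.length * M) * E := by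
          refine mul_le_mul ((norm_mul_le _ _).trans ?_) (hE _ _ hs hst hp.1 hp.2)
            (norm_nonneg _) (by positivity)
          exact mul_le_mul h₁ (hM _) (norm_nonneg _) (by positivity)
      _ = _ := by rw [List.length_cons, pow_succ]; ring

lemma exists_norm_qsdeKernel_le [CompleteSpace 𝔨] (T : ℝ) (n : ℕ) :
    ∃ C, ∀ t σ τ υ, s ≤ t → t ≤ T → σ.1 + τ.1 + υ.1 ≤ n →
      ‖qsdeKernel A₁ A₀ Am₁ B s t σ τ υ‖ ≤ C := by
  obtain ⟨E, hE⟩ := ((isCompact_Icc (a := s) (b := T)).prod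
    (isCompact_Icc (a := s) (b := T))).exists_bound_of_continuousOn (continuous_expB B).continuousOn
  set M := ‖A₁‖ + ‖A₀‖ + ‖Am₁‖
  have hM : ∀ i, ‖(![A₁, A₀, Am₁] : Fin 3 → (𝔨 →L[ℂ] 𝔨)) i‖ ≤ M := by
    intro i
    have h₁ := norm_nonneg A₁
    have h₂ := norm_nonneg A₀
    have h₃ := norm_nonneg Am₁
    fin_cases i <;> simp only [M] <;> simp <;> linarith
  have hM0 : 0 ≤ M := by positivity
  -- The product is at most `E (M E)ˡ` with `l ≤ n` letters. The base is enlarged to at least one so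
  -- that its powers increase with the exponent, and `max E 1` is positive whatever `E` is.
  refine ⟨max E 1 * (1 + M * max E 1) ^ n, fun t σ τ υ hst htT hn => ?_⟩
  have h1 : 1 ≤ max E 1 := le_max_right _ _
  rw [qsdeKernel_eq, configurationKernel]
  split_ifs with h
  · refine (norm_orderedProduct_le (s₀ := s) (t := t) (E := max E 1) B _ hM ?_ _ (fun p hp => ?_) s
      le_rfl hst).trans ?_
    · intro r r' h₁ h₂ h₃ h₄
      exact (hE (r, r') ⟨⟨h₁, h₂.trans htT⟩, ⟨h₃, h₄.trans htT⟩⟩).trans (le_max_left _ _)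
    · rw [Multiset.mem_sort] at hp
      exact ⟨(h.1 p hp).1.le, (h.1 p hp).2.le⟩
    · refine mul_le_mul_of_nonneg_left ?_ (by positivity)
      refine (pow_le_pow_left₀ (by positivity) (by linarith) _).trans
        (pow_le_pow_right₀ (by nlinarith) ?_)
      simpa [Word.labelled, add_assoc] using hn
  · rw [norm_zero]; positivity

lemma isAdmissibleKernel_qsdeKernel [CompleteSpace 𝔨] :
    IsAdmissibleKernel s (qsdeKernel A₁ A₀ Am₁ B s) where
  symm_left t _ τ υ := isSymmetricOnWords_of_letters fun v w h => by
    simp only [qsdeKernel_eq, Word.labelled_eq, h]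
  symm_mid t _ τ υ := isSymmetricOnWords_of_letters fun v w h => by
    simp only [qsdeKernel_eq, Word.labelled_eq, h]
  symm_right t _ τ υ := isSymmetricOnWords_of_letters fun v w h => by
    simp only [qsdeKernel_eq, Word.labelled_eq, h]
  locInt_joint := by
    rintro ⟨t, σ, τ, υ⟩ ⟨ht, -⟩
    obtain ⟨N₁, h₁⟩ := Word.exists_box_mem_nhds σ
    obtain ⟨N₂, h₂⟩ := Word.exists_box_mem_nhds τ
    obtain ⟨N₃, h₃⟩ := Word.exists_box_mem_nhds υ
    obtain ⟨C, hC⟩ := exists_norm_qsdeKernel_le A₁ A₀ Am₁ B s (t + 1) (N₁ + N₂ + N₃)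
    refine ⟨Set.Icc s (t + 1) ×ˢ Word.box N₁ ×ˢ Word.box N₂ ×ˢ Word.box N₃, ?_, ?_⟩
    · rw [nhdsWithin_prod_eq, nhdsWithin_univ]
      refine Filter.prod_mem_prod ?_ (prod_mem_nhds h₁ (prod_mem_nhds h₂ h₃))
      rw [← Set.Ici_inter_Iic, Set.inter_comm]
      exact Filter.inter_mem (mem_nhdsWithin_of_mem_nhds (Iic_mem_nhds (by linarith)))
        self_mem_nhdsWithin
    · refine Measure.integrableOn_of_bounded (M := C) ?_
        (stronglyMeasurable_qsdeKernel A₁ A₀ Am₁ B s).aestronglyMeasurable ?_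
      · simp only [Measure.prod_prod]
        have := fun N => (wordMeasure_box_lt_top N).ne
        exact ENNReal.mul_ne_top (by simp) (ENNReal.mul_ne_top (this _)
          (ENNReal.mul_ne_top (this _) (this _)))
      · refine (ae_restrict_iff' (measurableSet_Icc.prod ((Word.measurableSet_box _).prod
          ((Word.measurableSet_box _).prod (Word.measurableSet_box _))))).2 (.of_forall ?_)
        rintro ⟨r, σ, τ, υ⟩ ⟨hr, hσ, hτ, hυ⟩
        exact hC r σ τ υ hr.1 hr.2 (add_le_add (add_le_add hσ.1 hτ.1) hυ.1)
  locInt t ht := by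
    rintro ⟨σ, τ, υ⟩
    obtain ⟨N₁, h₁⟩ := Word.exists_box_mem_nhds σ
    obtain ⟨N₂, h₂⟩ := Word.exists_box_mem_nhds τ
    obtain ⟨N₃, h₃⟩ := Word.exists_box_mem_nhds υ
    obtain ⟨C, hC⟩ := exists_norm_qsdeKernel_le A₁ A₀ Am₁ B s t (N₁ + N₂ + N₃)
    refine ⟨Word.box N₁ ×ˢ Word.box N₂ ×ˢ Word.box N₃,
      prod_mem_nhds h₁ (prod_mem_nhds h₂ h₃), ?_⟩
    refine Measure.integrableOn_of_bounded (M := C) ?_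
      ((stronglyMeasurable_qsdeKernel A₁ A₀ Am₁ B s).comp_measurable
        measurable_prodMk_left).aestronglyMeasurable ?_
    · simp only [Measure.prod_prod]
      have := fun N => (wordMeasure_box_lt_top N).ne
      exact ENNReal.mul_ne_top (this _) (ENNReal.mul_ne_top (this _) (this _))
    · refine (ae_restrict_iff' ((Word.measurableSet_box _).prod
        ((Word.measurableSet_box _).prod (Word.measurableSet_box _)))).2 (.of_forall ?_)
      rintro ⟨σ, τ, υ⟩ ⟨hσ, hτ, hυ⟩
      exact hC t σ τ υ ht le_rfl (add_le_add (add_le_add hσ.1 hτ.1) hυ.1)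

end
end

/-! ### The sum-integral lemma. -/

section

open scoped ENNReal

lemma lintegral_wordMeasure (G : Word → ℝ≥0∞) : ∫⁻ w, G w ∂wordMeasure =
    ∑' n : ℕ, ENNReal.ofReal (1 / (n.factorial : ℝ)) * ∫⁻ v : Fin n → ℝ, G ⟨n, v⟩ := by
  rw [wordMeasure, lintegral_sum_measure]
  refine tsum_congr fun n => ?_
  rw [lintegral_smul_measure, (Word.measurableEmbedding_ofFn n).lintegral_map]
  rfl

lemma lintegral_removeNth {n : ℕ} (i : Fin (n + 1)) {G : ℝ → (Fin n → ℝ) → ℝ≥0∞}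
    (hG : Measurable fun q : ℝ × (Fin n → ℝ) => G q.1 q.2) :
    ∫⁻ v : Fin (n + 1) → ℝ, G (v i) (i.removeNth v) = ∫⁻ r, ∫⁻ v, G r v := by
  have h := volume_preserving_piFinSuccAbove (fun _ : Fin (n + 1) => ℝ) i
  rw [lintegral_lintegral hG.aemeasurable, ← Measure.volume_eq_prod, ← h.lintegral_comp hG]
  rfl

/-- On words of length `n + 1` each of the `n + 1` choices of a letter contributes the same
integral, by Fubini, and `(n + 1) / (n + 1)! = 1 / n!` is the weight of the words of length `n`. -/
lemma lintegral_letterSum_unit {H : ℝ → Word → ℝ≥0∞}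
    (hH : Measurable fun q : ℝ × Word => H q.1 q.2) :
    ∫⁻ w, letterSum (fun r w _ => H r w) w () ∂wordMeasure = ∫⁻ r, ∫⁻ w, H r w ∂wordMeasure := by
  have hm : ∀ n, Measurable fun q : ℝ × (Fin n → ℝ) => H q.1 ⟨n, q.2⟩ := fun n =>
    hH.comp (measurable_fst.prodMk ((Word.measurableEmbedding_ofFn n).measurable.comp measurable_snd))
  simp_rw [lintegral_wordMeasure]
  rw [tsum_eq_zero_add' ENNReal.summable, lintegral_tsum fun n =>
    ((hm n).lintegral_prod_right'.const_mul _).aemeasurable]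
  simp only [letterSum_ofFn_zero, lintegral_zero, mul_zero, zero_add]
  refine tsum_congr fun n => ?_
  rw [lintegral_const_mul _ (hm n).lintegral_prod_right']
  simp only [letterSum_ofFn_succ]
  rw [lintegral_finsetSum _ fun i _ => ?_]
  · have hr := fun i => lintegral_removeNth (G := fun r v => H r ⟨n, v⟩) i (hm n)
    simp only [hr]
    rw [Finset.sum_const, Finset.card_univ, Fintype.card_fin, nsmul_eq_mul, ← mul_assoc]
    congr 1
    rw [← ENNReal.ofReal_natCast, ← ENNReal.ofReal_mul (by positivity), Nat.factorial_succ]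
    congr 1
    push_cast
    have : (n.factorial : ℝ) ≠ 0 := by positivity
    field_simp
  · exact hH.comp (Word.measurable_erase_succ n i)

variable {X : Type*} [MeasurableSpace X] {μ : Measure X} [SFinite μ]

lemma lintegral_letterSum {H : ℝ → Word → X → ℝ≥0∞}
    (hH : Measurable fun q : ℝ × Word × X => H q.1 q.2.1 q.2.2) :
    ∫⁻ q : Word × X, letterSum H q.1 q.2 ∂(wordMeasure.prod μ) =
      ∫⁻ q : ℝ × Word × X, H q.1 q.2.1 q.2.2 ∂((volume : Measure ℝ).prod (wordMeasure.prod μ)) := by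
  rw [lintegral_prod _ (stronglyMeasurable_letterSum hH.stronglyMeasurable).measurable.aemeasurable,
    lintegral_prod _ hH.aemeasurable]
  have h₁ : ∀ r, ∫⁻ q : Word × X, H r q.1 q.2 ∂(wordMeasure.prod μ) =
      ∫⁻ w, ∫⁻ x, H r w x ∂μ ∂wordMeasure := fun r =>
    lintegral_prod _ (hH.comp measurable_prodMk_left).aemeasurable
  simp only [h₁]
  rw [← lintegral_letterSum_unit (H := fun r w => ∫⁻ x, H r w x ∂μ)]
  · refine lintegral_congr fun w => ?_
    simp only [letterSum]
    exact lintegral_finsetSum _ fun i _ => hH.comp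
      (by fun_prop : Measurable fun x => (w.2 i, w.erase i, x))
  · exact (hH.comp (by fun_prop : Measurable fun q : (ℝ × Word) × X =>
      (q.1.1, q.1.2, q.2))).lintegral_prod_right'

lemma integrable_letterSum {E : Type*} [NormedAddCommGroup E] {H : ℝ → Word → X → E}
    (hm : StronglyMeasurable fun q : ℝ × Word × X => H q.1 q.2.1 q.2.2)
    (hH : Integrable (fun q : ℝ × Word × X => H q.1 q.2.1 q.2.2)
      ((volume : Measure ℝ).prod (wordMeasure.prod μ))) :
    Integrable (fun q : Word × X => letterSum H q.1 q.2) (wordMeasure.prod μ) := by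
  refine ⟨(stronglyMeasurable_letterSum hm).aestronglyMeasurable, ?_⟩
  refine lt_of_le_of_lt ?_ hH.2
  rw [← lintegral_letterSum (H := fun r w x => ‖H r w x‖ₑ) hm.enorm]
  exact lintegral_mono fun q => enorm_sum_le _ _

lemma integral_letterSum_real {H : ℝ → Word → X → ℝ}
    (hm : Measurable fun q : ℝ × Word × X => H q.1 q.2.1 q.2.2)
    (hH : Integrable (fun q : ℝ × Word × X => H q.1 q.2.1 q.2.2)
      ((volume : Measure ℝ).prod (wordMeasure.prod μ))) :
    ∫ q : Word × X, letterSum H q.1 q.2 ∂(wordMeasure.prod μ) =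
      ∫ q : ℝ × Word × X, H q.1 q.2.1 q.2.2 ∂((volume : Measure ℝ).prod (wordMeasure.prod μ)) := by
  have key : ∀ {H : ℝ → Word → X → ℝ} (_ : ∀ r w x, 0 ≤ H r w x)
      (_ : Measurable fun q : ℝ × Word × X => H q.1 q.2.1 q.2.2),
      ∫ q : Word × X, letterSum H q.1 q.2 ∂(wordMeasure.prod μ) =
      ∫ q : ℝ × Word × X, H q.1 q.2.1 q.2.2 ∂((volume : Measure ℝ).prod (wordMeasure.prod μ)) := by
    intro H h0 hm
    have nn : ∀ q : Word × X, 0 ≤ letterSum H q.1 q.2 := fun q =>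
      Finset.sum_nonneg fun i _ => h0 _ _ _
    rw [integral_eq_lintegral_of_nonneg_ae (.of_forall nn)
        (stronglyMeasurable_letterSum hm.stronglyMeasurable).aestronglyMeasurable,
      integral_eq_lintegral_of_nonneg_ae (.of_forall fun q => h0 _ _ _) hm.aestronglyMeasurable,
      ← lintegral_letterSum (H := fun r w x => ENNReal.ofReal (H r w x)) hm.ennreal_ofReal]
    refine congrArg _ (lintegral_congr fun q => ?_)
    exact ENNReal.ofReal_sum_of_nonneg fun i _ => h0 _ _ _
  have e : ∀ q : ℝ × Word × X, H q.1 q.2.1 q.2.2 =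
      max (H q.1 q.2.1 q.2.2) 0 - max (-H q.1 q.2.1 q.2.2) 0 := fun q =>
    (max_zero_sub_max_neg_zero_eq_self _).symm
  have e' : ∀ q : Word × X, letterSum H q.1 q.2 = letterSum (fun r w x => max (H r w x) 0) q.1 q.2 -
      letterSum (fun r w x => max (-H r w x) 0) q.1 q.2 := fun q => by
    simp only [letterSum, ← Finset.sum_sub_distrib, max_zero_sub_max_neg_zero_eq_self]
  have m₁ := hm.max (measurable_const (a := (0 : ℝ)))
  have m₂ := hm.neg.max (measurable_const (a := (0 : ℝ)))
  rw [integral_congr_ae (.of_forall e), integral_congr_ae (.of_forall e'), integral_sub (integrable_letterSum m₁.stronglyMeasurable hH.pos_part)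
      (integrable_letterSum m₂.stronglyMeasurable hH.neg_part),
    integral_sub hH.pos_part hH.neg_part,
    key (fun _ _ _ => le_max_right _ _) m₁, key (fun _ _ _ => le_max_right _ _) m₂]

lemma integral_letterSum_of_stronglyMeasurable {H : ℝ → Word → X → ℂ}
    (hm : StronglyMeasurable fun q : ℝ × Word × X => H q.1 q.2.1 q.2.2)
    (hH : Integrable (fun q : ℝ × Word × X => H q.1 q.2.1 q.2.2)
      ((volume : Measure ℝ).prod (wordMeasure.prod μ))) :
    ∫ q : Word × X, letterSum H q.1 q.2 ∂(wordMeasure.prod μ) =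
      ∫ q : ℝ × Word × X, H q.1 q.2.1 q.2.2 ∂((volume : Measure ℝ).prod (wordMeasure.prod μ)) := by
  have hi := integrable_letterSum hm hH
  apply Complex.ext
  · rw [← Complex.reCLM_apply, ← Complex.reCLM_apply, ← Complex.reCLM.integral_comp_comm hi,
      ← Complex.reCLM.integral_comp_comm hH]
    rw [← integral_letterSum_real (H := fun r w x => Complex.reCLM (H r w x))
      (Complex.reCLM.measurable.comp hm.measurable) (Complex.reCLM.integrable_comp hH)]
    simp [letterSum]
  · rw [← Complex.imCLM_apply, ← Complex.imCLM_apply, ← Complex.imCLM.integral_comp_comm hi,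
      ← Complex.imCLM.integral_comp_comm hH]
    rw [← integral_letterSum_real (H := fun r w x => Complex.imCLM (H r w x))
      (Complex.imCLM.measurable.comp hm.measurable) (Complex.imCLM.integrable_comp hH)]
    simp [letterSum]

/-- The sum-integral lemma. -/
lemma integral_letterSum {H : ℝ → Word → X → ℂ}
    (hH : Integrable (fun q : ℝ × Word × X => H q.1 q.2.1 q.2.2)
      ((volume : Measure ℝ).prod (wordMeasure.prod μ))) :
    Integrable (fun q : Word × X => letterSum H q.1 q.2) (wordMeasure.prod μ) ∧
    ∫ q : Word × X, letterSum H q.1 q.2 ∂(wordMeasure.prod μ) =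
      ∫ q : ℝ × Word × X, H q.1 q.2.1 q.2.2 ∂((volume : Measure ℝ).prod (wordMeasure.prod μ)) := by
  obtain ⟨K, hK, hHK⟩ := hH.1
  have hKi := hH.congr hHK
  -- Replacing `H` by a measurable representative must not alter the letter sum. The nonnegative
  -- formula for the indicator of the exceptional set `S` shows that for almost every `(w, x)` no
  -- triple `(wᵢ, w ∖ wᵢ, x)` lies in `S`.
  obtain ⟨S, hS, hSm, hS0⟩ := exists_measurable_superset_of_null (ae_iff.1 hHK)
  have hz := lintegral_letterSum (μ := μ) (H := fun r w x => S.indicator (fun _ => 1) (r, w, x))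
    (measurable_const.indicator hSm)
  rw [lintegral_indicator_const hSm, hS0, mul_zero,
    lintegral_eq_zero_iff (stronglyMeasurable_letterSum
      (H := fun r w x => S.indicator (fun _ => (1 : ℝ≥0∞)) (r, w, x))
      (measurable_const.indicator hSm).stronglyMeasurable).measurable] at hz
  have hsum : (fun q : Word × X => letterSum (fun r w x => K (r, w, x)) q.1 q.2)
      =ᵐ[wordMeasure.prod μ] fun q => letterSum H q.1 q.2 := by
    filter_upwards [hz] with q hq
    refine Finset.sum_congr rfl fun i hi => ?_
    have h0 := Finset.sum_eq_zero_iff.1 hq i hi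
    by_contra hne
    have : (q.1.2 i, q.1.erase i, q.2) ∈ S := hS fun h => hne h.symm
    simp [this] at h0
  have hi := integrable_letterSum (H := fun r w x => K (r, w, x)) hK hKi
  refine ⟨hi.congr hsum, ?_⟩
  rw [← integral_congr_ae hsum, integral_letterSum_of_stronglyMeasurable hK hKi]
  exact (integral_congr_ae hHK).symm

/-- Allows the word that loses a letter to be any of the four variables, after a measure-preserving
rearrangement. -/
lemma integral_letterSum_equiv {P : Type*} [MeasurableSpace P] {ν : Measure P} [SFinite ν]
    (e : Word × X ≃ᵐ P) (he : MeasurePreserving e (wordMeasure.prod μ) ν) {H : ℝ → P → ℂ}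
    (hH : Integrable (fun q : ℝ × P => H q.1 q.2) ((volume : Measure ℝ).prod ν)) {T : P → ℂ}
    (hT : ∀ w x, T (e (w, x)) = letterSum (fun r w x => H r (e (w, x))) w x) :
    Integrable T ν ∧ ∫ p, T p ∂ν = ∫ q, H q.1 q.2 ∂((volume : Measure ℝ).prod ν) := by
  have hp : MeasurePreserving (Prod.map id e)
      ((volume : Measure ℝ).prod (wordMeasure.prod μ)) (volume.prod ν) := (MeasurePreserving.id _).prod he
  have hemb : MeasurableEmbedding (Prod.map (id : ℝ → ℝ) e) := .prodMap .id e.measurableEmbedding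
  obtain ⟨h₁, h₂⟩ := integral_letterSum (μ := μ) (H := fun r w x => H r (e (w, x)))
    ((hp.integrable_comp_emb hemb).2 hH)
  have hT' : T ∘ e = fun q : Word × X => letterSum (fun r w x => H r (e (w, x))) q.1 q.2 :=
    funext fun q => hT q.1 q.2
  refine ⟨(he.integrable_comp_emb e.measurableEmbedding).1 (hT' ▸ h₁), ?_⟩
  rw [← he.integral_comp e.measurableEmbedding T, ← hp.integral_comp hemb]
  exact (integral_congr_ae (.of_forall fun q : Word × X => hT q.1 q.2)).trans h₂

/-- The exchange of the first two factors. -/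
def prodLeftComm {α β γ : Type*} [MeasurableSpace α] [MeasurableSpace β] [MeasurableSpace γ] :
    α × β × γ ≃ᵐ β × α × γ :=
  MeasurableEquiv.prodAssoc.symm.trans
    ((MeasurableEquiv.prodCongr .prodComm (.refl _)).trans .prodAssoc)

lemma measurePreserving_prodLeftComm {α β γ : Type*} [MeasurableSpace α] [MeasurableSpace β]
    [MeasurableSpace γ] (μa : Measure α) (μb : Measure β) (μc : Measure γ) [SFinite μa] [SFinite μb]
    [SFinite μc] : MeasurePreserving prodLeftComm (μa.prod (μb.prod μc)) (μb.prod (μa.prod μc)) :=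
  ((measurePreserving_prodAssoc μa μb μc).symm _).trans
    ((Measure.measurePreserving_swap.prod (.id _)).trans (measurePreserving_prodAssoc μb μa μc))

end

/-! ### The explicit kernel satisfies the weak equation. -/

section

variable {𝔨 : Type*} [NormedAddCommGroup 𝔨] [InnerProductSpace ℂ 𝔨]
  {s : ℝ} {x : ℝ → Word → Word → Word → (𝔨 →L[ℂ] 𝔨)} {N : ℕ} {M M' : ℝ} {φ γ : ℝ → Word → 𝔨}

open Classical in
lemma IsBoxIntegrable.integral_ite_formIntegrand (hx : IsBoxIntegrable s x)
    (hφ : IsTestFamily N M φ) (hγ : IsTestFamily N M' γ) {t : ℝ} (ht : s ≤ t) :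
    Integrable (fun q : ℝ × Word × Word × Word × Word =>
      if s < q.1 ∧ q.1 < t then formIntegrand (x q.1) (φ q.1) (γ q.1) q.2 else 0)
      ((volume : Measure ℝ).prod wordMeasure₄) ∧
    ∫ q, (if s < q.1 ∧ q.1 < t then formIntegrand (x q.1) (φ q.1) (γ q.1) q.2 else 0)
      ∂((volume : Measure ℝ).prod wordMeasure₄) =
      ∫ r in s..t, kernelForm (x r) (φ r) (γ r) := by
  have hS : MeasurableSet (Set.Ioo s t ×ˢ (Set.univ : Set (Word × Word × Word × Word))) :=
    measurableSet_Ioo.prod .univ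
  have hμ : (volume.restrict (Set.Icc s t)).prod wordMeasure₄ =
      ((volume : Measure ℝ).prod wordMeasure₄).restrict (Set.Ioo s t ×ˢ Set.univ) := by
    rw [← Measure.restrict_congr_set Ioo_ae_eq_Icc, ← Measure.prod_restrict, Measure.restrict_univ]
  have he : (fun q : ℝ × Word × Word × Word × Word =>
      if s < q.1 ∧ q.1 < t then formIntegrand (x q.1) (φ q.1) (γ q.1) q.2 else 0) =
      (Set.Ioo s t ×ˢ Set.univ).indicator
        fun q => formIntegrand (x q.1) (φ q.1) (γ q.1) q.2 := by
    funext q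
    simp [Set.indicator_apply]
  have h := hx.integrable_formIntegrand_prod hφ hγ t
  rw [hx.integral_kernelForm hφ hγ ht, hμ]
  rw [hμ] at h
  rw [he]
  exact ⟨(integrable_indicator_iff hS).2 h, integral_indicator hS⟩

lemma IsBoxIntegrable.integral_integral_formIntegrand (hx : IsBoxIntegrable s x)
    (hφ : IsTestFamily N M φ) (hγ : IsTestFamily N M' γ) {t : ℝ} (ht : s ≤ t) :
    Integrable (fun p => ∫ r in s..t, formIntegrand (x r) (φ r) (γ r) p) wordMeasure₄ ∧
    ∫ p, (∫ r in s..t, formIntegrand (x r) (φ r) (γ r) p) ∂wordMeasure₄ =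
      ∫ r in s..t, kernelForm (x r) (φ r) (γ r) := by
  have h := hx.integrable_formIntegrand_prod hφ hγ t
  simp only [intervalIntegral.integral_of_le ht, ← integral_Icc_eq_integral_Ioc]
  exact ⟨h.integral_prod_right, (integral_integral_swap (f := fun r p =>
    formIntegrand (x r) (φ r) (γ r) p) h).symm⟩

lemma wordMeasure_length_eq_zero : wordMeasure {w : Word | w.1 = 0} = 1 := by
  rw [wordMeasure_apply (measurableSet_eq_fun Word.measurable_length measurable_const),
    tsum_eq_single 0]
  · have : Word.ofFn 0 ⁻¹' {w : Word | w.1 = 0} = Set.univ := by ext; simp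
    rw [this]
    simp [volume_pi]
  · intro n hn
    have : Word.ofFn n ⁻¹' {w : Word | w.1 = 0} = ∅ := by ext; simpa using hn
    rw [this]
    simp

open Classical in
lemma integral_length_eq_zero : ∫ w : Word, (if w.1 = 0 then (1 : ℂ) else 0) ∂wordMeasure = 1 := by
  have hS : MeasurableSet {w : Word | w.1 = 0} :=
    measurableSet_eq_fun Word.measurable_length measurable_const
  have : (fun w : Word => if w.1 = 0 then (1 : ℂ) else 0) =
      {w : Word | w.1 = 0}.indicator fun _ => 1 := by
    funext w; simp [Set.indicator_apply]
  rw [this, integral_indicator_const _ hS, measureReal_def, wordMeasure_length_eq_zero]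
  simp

open Classical in
-- The empty word is an atom of mass one, so the identity on empty `σ`, `τ`, `υ` contributes exactly
-- the initial term `⟨f|g⟩`.
lemma integral_empty_words (h : Word → ℂ) :
    ∫ p : Word × Word × Word × Word, (if p.1.1 + p.2.1.1 + p.2.2.1.1 = 0 then h p.2.2.2 else 0)
      ∂wordMeasure₄ = ∫ w, h w ∂wordMeasure := by
  have : ∀ p : Word × Word × Word × Word,
      (if p.1.1 + p.2.1.1 + p.2.2.1.1 = 0 then h p.2.2.2 else 0) =
      (if p.1.1 = 0 then (1 : ℂ) else 0) * ((if p.2.1.1 = 0 then (1 : ℂ) else 0) *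
        ((if p.2.2.1.1 = 0 then (1 : ℂ) else 0) * h p.2.2.2)) := by
    intro p
    by_cases h₁ : p.1.1 = 0 <;> by_cases h₂ : p.2.1.1 = 0 <;> by_cases h₃ : p.2.2.1.1 = 0 <;>
      simp [h₁, h₂, h₃]
  simp only [this]
  rw [integral_prod_mul (fun w : Word => if w.1 = 0 then (1 : ℂ) else 0)
      (fun q : Word × Word × Word => (if q.1.1 = 0 then (1 : ℂ) else 0) *
        ((if q.2.1.1 = 0 then (1 : ℂ) else 0) * h q.2.2)),
    integral_prod_mul (fun w : Word => if w.1 = 0 then (1 : ℂ) else 0)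
      (fun q : Word × Word => (if q.1.1 = 0 then (1 : ℂ) else 0) * h q.2),
    integral_prod_mul (fun w : Word => if w.1 = 0 then (1 : ℂ) else 0) h,
    integral_length_eq_zero]
  simp

lemma Word.letters_eq_zero {w : Word} (h : w.1 = 0) : w.letters = 0 := by
  rw [← Multiset.card_eq_zero, card_letters, h]

lemma letterSum_map {X E F : Type*} [AddCommMonoid E] [AddCommMonoid F] (L : E →+ F)
    (H : ℝ → Word → X → E) (w : Word) (x : X) :
    L (letterSum H w x) = letterSum (fun r w x => L (H r w x)) w x := map_sum L _ _

/-- The linear functional `X ↦ ⟨v, X w⟩` on operators. -/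
def matrixCoeff (v w : 𝔨) : (𝔨 →L[ℂ] 𝔨) →L[ℂ] ℂ :=
  (innerSL ℂ v).comp (ContinuousLinearMap.apply ℂ 𝔨 w)

lemma matrixCoeff_apply (v w : 𝔨) (X : 𝔨 →L[ℂ] 𝔨) : matrixCoeff v w X = inner ℂ v (X w) := rfl

variable [CompleteSpace 𝔨] (A₁ A₀ Am₁ B : 𝔨 →L[ℂ] 𝔨)

open Classical in
-- The pointwise equation for the kernel, seen through the functional `X ↦ ⟨v, X w⟩` with `v` and
-- `w` the values of `f` and `g`.
lemma formIntegrand_qsdeKernel {f g : Word → 𝔨} (hf : IsSymmetricOnWords f)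
    (hg : IsSymmetricOnWords g) {t : ℝ} (ht : s ≤ t) (σ τ υ ω : Word) :
    formIntegrand (qsdeKernel A₁ A₀ Am₁ B s t) f g (σ, τ, υ, ω) =
      (if σ.1 + τ.1 + υ.1 = 0 then inner ℂ (f ω) (g ω) else 0) +
      (letterSum (fun r σ _ => if s < r ∧ r < t then formIntegrand
          (leftMul A₁ (qsdeKernel A₁ A₀ Am₁ B s r)) (annihilate r f) g (σ, τ, υ, ω) else 0) σ () +
        letterSum (fun r τ _ => if s < r ∧ r < t then formIntegrand
          (leftMul A₀ (qsdeKernel A₁ A₀ Am₁ B s r)) (annihilate r f) (annihilate r g)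
            (σ, τ, υ, ω) else 0) τ () +
        letterSum (fun r υ _ => if s < r ∧ r < t then formIntegrand
          (leftMul Am₁ (qsdeKernel A₁ A₀ Am₁ B s r)) f (annihilate r g) (σ, τ, υ, ω) else 0) υ ()) +
      ∫ r in s..t, formIntegrand (leftMul B (qsdeKernel A₁ A₀ Am₁ B s r)) f g (σ, τ, υ, ω) := by
  obtain ⟨hi, he⟩ := hasIntegral_qsdeKernel A₁ A₀ Am₁ B s ht σ τ υ
  set v := f ((σ.append τ).append ω) with hv
  set w := g ((τ.append υ).append ω) with hw
  have h₀ : formIntegrand (qsdeKernel A₁ A₀ Am₁ B s t) f g (σ, τ, υ, ω) =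
    matrixCoeff v w (qsdeKernel A₁ A₀ Am₁ B s t σ τ υ) := rfl
  have hL : ∀ K : ℝ → Word → Unit → (𝔨 →L[ℂ] 𝔨), ∀ ξ, matrixCoeff v w (letterSum K ξ ()) =
      letterSum (fun r ξ x => matrixCoeff v w (K r ξ x)) ξ () := fun K ξ =>
    letterSum_map (matrixCoeff v w : (𝔨 →L[ℂ] 𝔨) →+ ℂ) K ξ ()
  rw [h₀, he, map_add, map_add, map_add, map_add, hL, hL, hL,
    ← (matrixCoeff v w).intervalIntegral_comp_comm hi]
  -- By symmetry the removed letter may be put in front, where it is read as an annihilation. A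
  -- letter of `σ` occurs only in the argument of `f`, one of `υ` only in that of `g`, one of `τ` in
  -- both.
  have hF : ∀ i, f (Word.cons (σ.2 i) (((σ.erase i).append τ).append ω)) = v := fun i =>
    hf.eq_of_letters_eq (by
      simp only [Word.letters_cons, Word.letters_append, σ.letters_erase i, Multiset.cons_add])
  have hF' : ∀ i, f (Word.cons (τ.2 i) ((σ.append (τ.erase i)).append ω)) = v := fun i =>
    hf.eq_of_letters_eq (by
      simp only [Word.letters_cons, Word.letters_append, τ.letters_erase i, Multiset.cons_add,
        Multiset.add_cons])
  have hG : ∀ i, g (Word.cons (τ.2 i) (((τ.erase i).append υ).append ω)) = w := fun i =>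
    hg.eq_of_letters_eq (by
      simp only [Word.letters_cons, Word.letters_append, τ.letters_erase i, Multiset.cons_add])
  have hG' : ∀ i, g (Word.cons (υ.2 i) ((τ.append (υ.erase i)).append ω)) = w := fun i =>
    hg.eq_of_letters_eq (by
      simp only [Word.letters_cons, Word.letters_append, υ.letters_erase i, Multiset.cons_add,
        Multiset.add_cons])
  refine congrArg₂ _ (congrArg₂ _ ?_ (congrArg₂ _ (congrArg₂ _ ?_ ?_) ?_)) rfl
  · split_ifs with h
    · have hσ : σ.letters = 0 := Word.letters_eq_zero (by omega)
      have hτ : τ.letters = 0 := Word.letters_eq_zero (by omega)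
      have hυ : υ.letters = 0 := Word.letters_eq_zero (by omega)
      rw [matrixCoeff_apply, hv, hw, hf.eq_of_letters_eq (w := ω) (by
          simp [Word.letters_append, hσ, hτ]), hg.eq_of_letters_eq (w := ω) (by
          simp [Word.letters_append, hυ, hτ])]
      rfl
    · exact map_zero _
  all_goals
    refine Finset.sum_congr rfl fun i _ => ?_
    dsimp only
    split_ifs with h
  · simp only [formIntegrand, annihilate, hF]; rfl
  · exact map_zero _
  · simp only [formIntegrand, annihilate, hF', hG]; rfl
  · exact map_zero _
  · simp only [formIntegrand, annihilate, hG']; rfl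
  · exact map_zero _

lemma integral_eq_sum_of_eq {P : Type*} [MeasurableSpace P] {ν : Measure P}
    {F a b c d e : P → ℂ} (hF : Integrable F ν) (hb : Integrable b ν) (hc : Integrable c ν)
    (hd : Integrable d ν) (he : Integrable e ν) (h : ∀ p, F p = a p + (b p + c p + d p) + e p) :
    ∫ p, F p ∂ν = (∫ p, a p ∂ν) + (∫ p, b p ∂ν) + (∫ p, c p ∂ν) + (∫ p, d p ∂ν) + ∫ p, e p ∂ν := by
  have hs : a = fun p => F p - (b p + c p + d p) - e p := funext fun p => by rw [h p]; ring
  have hbc : Integrable (fun p => b p + c p) ν := hb.add hc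
  have hbcd : Integrable (fun p => b p + c p + d p) ν := hbc.add hd
  have h₁ : Integrable (fun p => F p - (b p + c p + d p)) ν := hF.sub hbcd
  rw [hs, integral_sub h₁ he, integral_sub hF hbcd, integral_add hbc hd, integral_add hb hc]
  ring

theorem satisfiesQSDE_qsdeKernel :
    SatisfiesQSDE A₁ A₀ Am₁ B s (qsdeKernel A₁ A₀ Am₁ B s) := by
  classical
  intro f g t ht
  have hu := (isAdmissibleKernel_qsdeKernel A₁ A₀ Am₁ B s).isBoxIntegrable
  obtain ⟨N, M, hf, hf', hg, hg'⟩ := f.exists_isTestFamily₂ g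
  obtain ⟨i₁, e₁⟩ := (hu.leftMul A₁).integral_ite_formIntegrand hf' hg ht
  obtain ⟨i₂, e₂⟩ := (hu.leftMul A₀).integral_ite_formIntegrand hf' hg' ht
  obtain ⟨i₃, e₃⟩ := (hu.leftMul Am₁).integral_ite_formIntegrand hf hg' ht
  obtain ⟨i₄, e₄⟩ := (hu.leftMul B).integral_integral_formIntegrand hf hg ht
  have i₀ := hu.integrable_formIntegrand hf hg ht t t
  obtain ⟨j₁, k₁⟩ := integral_letterSum_equiv (H := fun r p => if s < r ∧ r < t then formIntegrand
      (leftMul A₁ (qsdeKernel A₁ A₀ Am₁ B s r)) (annihilate r f.1) g.1 p else 0) (.refl _)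
    (MeasurePreserving.id wordMeasure₄) i₁ (T := fun p => letterSum (fun r σ _ =>
      if s < r ∧ r < t then formIntegrand (leftMul A₁ (qsdeKernel A₁ A₀ Am₁ B s r))
        (annihilate r f.1) g.1 (σ, p.2) else 0) p.1 ()) fun w x => rfl
  obtain ⟨j₂, k₂⟩ := integral_letterSum_equiv (H := fun r p => if s < r ∧ r < t then formIntegrand
      (leftMul A₀ (qsdeKernel A₁ A₀ Am₁ B s r)) (annihilate r f.1) (annihilate r g.1) p else 0) prodLeftComm
    (measurePreserving_prodLeftComm wordMeasure wordMeasure (wordMeasure.prod wordMeasure)) i₂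
    (T := fun p => letterSum (fun r τ _ =>
      if s < r ∧ r < t then formIntegrand (leftMul A₀ (qsdeKernel A₁ A₀ Am₁ B s r))
        (annihilate r f.1) (annihilate r g.1) (p.1, τ, p.2.2) else 0) p.2.1 ()) fun w x => rfl
  obtain ⟨j₃, k₃⟩ := integral_letterSum_equiv (H := fun r p => if s < r ∧ r < t then formIntegrand
      (leftMul Am₁ (qsdeKernel A₁ A₀ Am₁ B s r)) f.1 (annihilate r g.1) p else 0) 
    (prodLeftComm.trans (MeasurableEquiv.prodCongr (.refl _) prodLeftComm))
    ((measurePreserving_prodLeftComm wordMeasure wordMeasure (wordMeasure.prod wordMeasure)).trans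
      ((MeasurePreserving.id _).prod
        (measurePreserving_prodLeftComm wordMeasure wordMeasure wordMeasure))) i₃
    (T := fun p => letterSum (fun r υ _ =>
      if s < r ∧ r < t then formIntegrand (leftMul Am₁ (qsdeKernel A₁ A₀ Am₁ B s r))
        f.1 (annihilate r g.1) (p.1, p.2.1, υ, p.2.2.2) else 0) p.2.2.1 ()) fun w x => rfl
  rw [← e₁, ← e₂, ← e₃, ← e₄, ← k₁, ← k₂, ← k₃, wordPairing,
    ← integral_empty_words fun w => inner ℂ (f.1 w) (g.1 w)]
  have key := fun p : Word × Word × Word × Word =>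
    formIntegrand_qsdeKernel A₁ A₀ Am₁ B f.2.1 g.2.1 ht p.1 p.2.1 p.2.2.1 p.2.2.2
  exact integral_eq_sum_of_eq i₀ j₁ j₂ j₃ i₄ key

end

/-! ### From test functions to indicators of compact symmetric sets. -/

section

open Filter Topology

variable {𝔨 : Type*} [NormedAddCommGroup 𝔨] [InnerProductSpace ℂ 𝔨]

lemma tendsto_kernelForm {F : Word → Word → Word → (𝔨 →L[ℂ] 𝔨)} {N : ℕ} {M M' : ℝ}
    (hF : IntegrableOn (fun q : Word × Word × Word => F q.1 q.2.1 q.2.2) (box₃ N) wordMeasure₃)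
    {f g : ℕ → Word → 𝔨} {f' g' : Word → 𝔨} (hf : ∀ k, IsTestFamily N M fun _ => f k)
    (hg : ∀ k, IsTestFamily N M' fun _ => g k)
    (hf' : ∀ w, Tendsto (fun k => f k w) atTop (𝓝 (f' w)))
    (hg' : ∀ w, Tendsto (fun k => g k w) atTop (𝓝 (g' w))) :
    Tendsto (fun k => kernelForm F (f k) (g k)) atTop (𝓝 (kernelForm F f' g')) := by
  refine tendsto_integral_of_dominated_convergence (fun p => M * M' * boxNorm N F p)
    (fun k => (integrable_formIntegrand_single (hf k) (hg k) hF).aestronglyMeasurable)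
    ((integrable_boxNorm_single hF).const_mul _)
    (fun k => .of_forall fun p => norm_formIntegrand_le ((hf k).mem_box 0) ((hg k).mem_box 0)
      ((hf k).norm_le 0) ((hg k).norm_le 0) F p) (.of_forall fun p => ?_)
  exact (hf' _).inner (((F p.1 p.2.1 p.2.2.1).continuous.tendsto _).comp (hg' _))

lemma Word.continuous_extend {E : Type*} [TopologicalSpace E] [Zero E] {m : ℕ}
    {φ : (Fin m → ℝ) → E} (hφ : Continuous φ) :
    Continuous (Function.extend (Word.ofFn m) φ 0) := by
  refine continuous_of_openEmbedding_cover (e := Word.ofFn) Word.isOpenEmbedding_ofFn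
    (fun w => ⟨w.1, w.2, rfl⟩) fun n => ?_
  by_cases h : n = m
  · subst h
    rwa [Function.extend_comp (Word.isOpenEmbedding_ofFn n).injective]
  · have : Function.extend (Word.ofFn m) φ 0 ∘ Word.ofFn n = fun _ => 0 := by
      funext v
      exact Function.extend_apply' _ _ _ fun ⟨w, e⟩ => h (congrArg Sigma.fst e).symm
    rw [this]
    exact continuous_const

/-- Thickened indicators depend only on the distance to `K`. Permuting coordinates is an isometry
that preserves `K`, so they are symmetric; the thickness is at most one, so they share a compact
support. -/
lemma exists_testFn_tendsto_indicator {m : ℕ} {K : Set (Fin m → ℝ)} (hK : IsCompact K)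
    (hsymm : ∀ (π : Equiv.Perm (Fin m)) (v : Fin m → ℝ), v ∘ π ∈ K ↔ v ∈ K) (u : 𝔨) :
    ∃ N, ∃ f : ℕ → TestFn 𝔨, (∀ k, IsTestFamily N ‖u‖ fun _ => (f k).1) ∧
      ∀ w, Tendsto (fun k => (f k).1 w) atTop
        (𝓝 ((Word.ofFn m '' K).indicator (fun _ => u) w)) := by
  have δpos : ∀ k : ℕ, 0 < (1 : ℝ) / (k + 1) := fun k => by positivity
  have hlim := thickenedIndicator_tendsto_indicator_closure δpos
    tendsto_one_div_add_atTop_nhds_zero_nat K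
  rw [tendsto_pi_nhds, hK.isClosed.closure_eq] at hlim
  set φ : ℕ → (Fin m → ℝ) → ℝ := fun k v => (thickenedIndicator (δpos k) K v : ℝ) with hφ
  have hφc : ∀ k, Continuous (φ k) := fun k =>
    NNReal.continuous_coe.comp (thickenedIndicator (δpos k) K).continuous
  have hφs : ∀ k (π : Equiv.Perm (Fin m)) v, φ k (v ∘ π) = φ k v := by
    intro k π v
    have hiso : Isometry fun v : Fin m → ℝ => v ∘ π := by
      refine Isometry.of_dist_eq fun v w => ?_
      refine le_antisymm ((dist_pi_le_iff dist_nonneg).2 fun i => dist_le_pi_dist v w (π i))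
        ((dist_pi_le_iff dist_nonneg).2 fun i => ?_)
      have := dist_le_pi_dist (v ∘ π) (w ∘ π) (π.symm i)
      simpa using this
    have himg : (fun v : Fin m → ℝ => v ∘ π) '' K = K := by
      ext v
      constructor
      · rintro ⟨w, hw, rfl⟩
        exact (hsymm π w).2 hw
      · intro hv
        exact ⟨v ∘ π.symm, (hsymm _ _).2 hv, by funext i; simp⟩
    have := Metric.infEDist_image (t := K) hiso (x := v)
    rw [himg] at this
    simp only [hφ, thickenedIndicator_apply, thickenedIndicatorAux, this]
  obtain ⟨N, hN⟩ := Word.exists_subset_box ((hK.cthickening (r := 1)).image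
    (Word.isOpenEmbedding_ofFn m).continuous)
  have hsupp : ∀ k v, φ k v ≠ 0 → Word.ofFn m v ∈ Word.box N := by
    intro k v hv
    refine hN ⟨v, ?_, rfl⟩
    by_contra hc
    refine hv (NNReal.coe_eq_zero.2 (thickenedIndicator_zero _ _ fun h => hc ?_))
    refine Metric.cthickening_mono ?_ K (Metric.thickening_subset_cthickening _ _ h)
    rw [div_le_one (by positivity)]
    simp
  set f : ℕ → Word → 𝔨 := fun k => Function.extend (Word.ofFn m) (fun v => (φ k v : ℂ) • u) 0
    with hf
  have happ : ∀ k v, f k (Word.ofFn m v) = (φ k v : ℂ) • u := fun k v =>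
    (Word.isOpenEmbedding_ofFn m).injective.extend_apply _ _ _
  have hout : ∀ k w, w ∉ Set.range (Word.ofFn m) → f k w = 0 := fun k w hw =>
    Function.extend_apply' _ _ _ hw
  have hfam : ∀ k, IsTestFamily N ‖u‖ fun _ => f k := by
    intro k
    refine ⟨(Word.continuous_extend ((Complex.continuous_ofReal.comp (hφc k)).smul
      continuous_const)).comp continuous_snd, fun _ w => ?_, fun _ w hw => ?_⟩
    · by_cases hw : w ∈ Set.range (Word.ofFn m)
      · obtain ⟨v, rfl⟩ := hw
        rw [happ, norm_smul]
        refine mul_le_of_le_one_left (norm_nonneg _) ?_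
        rw [Complex.norm_real, Real.norm_eq_abs, NNReal.abs_eq]
        exact_mod_cast thickenedIndicator_le_one (δpos k) K v
      · rw [hout k w hw, norm_zero]
        exact norm_nonneg _
    · by_cases hr : w ∈ Set.range (Word.ofFn m)
      · obtain ⟨v, rfl⟩ := hr
        refine hsupp k v fun h => hw ?_
        rw [happ, h]
        simp
      · exact absurd (hout k w hr) hw
  have hsym : ∀ k, IsSymmetricOnWords (f k) := by
    intro k n π v
    by_cases h : n = m
    · subst h
      exact (happ k _).trans ((congrArg (fun c : ℝ => (c : ℂ) • u) (hφs k π v)).trans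
        (happ k v).symm)
    · rw [hout, hout] <;> exact fun ⟨w, e⟩ => h (congrArg Sigma.fst e).symm
  refine ⟨N, fun k => ⟨f k, isTestFn_of_isTestFamily (hfam k) (hsym k)⟩, hfam, fun w => ?_⟩
  by_cases hw : w ∈ Set.range (Word.ofFn m)
  · obtain ⟨v, rfl⟩ := hw
    simp only [happ]
    have h₁ : Tendsto (fun k => (φ k v : ℂ)) atTop
        (𝓝 (((K.indicator (fun _ => (1 : NNReal)) v : NNReal) : ℝ) : ℂ)) :=
      ((Complex.continuous_ofReal.comp NNReal.continuous_coe).tendsto _).comp (hlim v)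
    convert! h₁.smul_const u using 2
    by_cases hv : v ∈ K
    · rw [Set.indicator_of_mem hv, Set.indicator_of_mem (Set.mem_image_of_mem _ hv)]
      simp
    · rw [Set.indicator_of_notMem hv, Set.indicator_of_notMem]
      · simp
      · rintro ⟨v', hv', e⟩
        exact hv ((Word.isOpenEmbedding_ofFn m).injective e ▸ hv')
  · rw [Set.indicator_of_notMem fun h => hw (Set.image_subset_range _ _ h)]
    simp only [hout _ w hw]
    exact tendsto_const_nhds

/-- If a form given by a kernel vanishes on the test functions, it vanishes on the indicators
of compact symmetric sets. -/
lemma kernelForm_indicator_eq_zero {F : Word → Word → Word → (𝔨 →L[ℂ] 𝔨)}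
    (hF : ∀ N, IntegrableOn (fun q : Word × Word × Word => F q.1 q.2.1 q.2.2) (box₃ N)
      wordMeasure₃)
    (h0 : ∀ f g : TestFn 𝔨, kernelForm F f.1 g.1 = 0) {m n : ℕ} {K : Set (Fin m → ℝ)}
    {K' : Set (Fin n → ℝ)} (hK : IsCompact K) (hK' : IsCompact K')
    (hs : ∀ (π : Equiv.Perm (Fin m)) (v : Fin m → ℝ), v ∘ π ∈ K ↔ v ∈ K)
    (hs' : ∀ (π : Equiv.Perm (Fin n)) (v : Fin n → ℝ), v ∘ π ∈ K' ↔ v ∈ K') (u u' : 𝔨) :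
    kernelForm F ((Word.ofFn m '' K).indicator fun _ => u)
      ((Word.ofFn n '' K').indicator fun _ => u') = 0 := by
  obtain ⟨N, f, hf, hf'⟩ := exists_testFn_tendsto_indicator hK hs u
  obtain ⟨N', g, hg, hg'⟩ := exists_testFn_tendsto_indicator hK' hs' u'
  have := tendsto_kernelForm (hF (max N N')) (fun k => (hf k).mono (le_max_left _ _) le_rfl)
    (fun k => (hg k).mono (le_max_right _ _) le_rfl) hf' hg'
  exact tendsto_nhds_unique this (by simp only [h0]; exact tendsto_const_nhds)

end

/-! ### Words near given centres; Lebesgue measure on triples of fixed lengths. -/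

section

section Pattern

variable {ι : Type*}

open Classical in
/-- The index of a centre `u l` at distance at most `ρ`, if there is one. -/
def nearest (u : ι → ℝ) (ρ r : ℝ) : Option ι :=
  if h : ∃ l, |r - u l| ≤ ρ then some h.choose else none

lemma nearest_eq_some_iff {u : ι → ℝ} {ρ : ℝ} (hsep : ∀ l l', l ≠ l' → 2 * ρ < |u l - u l'|)
    {r : ℝ} {l : ι} : nearest u ρ r = some l ↔ |r - u l| ≤ ρ := by
  have key : ∀ {l l'}, |r - u l| ≤ ρ → |r - u l'| ≤ ρ → l = l' := by
    intro l l' h h'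
    by_contra hne
    have h₂ : |u l - u l'| ≤ |r - u l'| + |r - u l| := by
      rw [show u l - u l' = (r - u l') - (r - u l) by ring]
      exact abs_sub _ _
    linarith [hsep l l' hne]
  unfold nearest
  split_ifs with h
  · rw [Option.some_inj]
    exact ⟨fun e => e ▸ h.choose_spec, fun h' => key h.choose_spec h'⟩
  · exact ⟨fun e => by simp at e, fun h' => absurd ⟨l, h'⟩ h⟩

/-- The multiset of the centres that are near to the letters of a word. -/
def Word.pattern (u : ι → ℝ) (ρ : ℝ) (w : Word) : Multiset (Option ι) :=
  w.letters.map (nearest u ρ)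

lemma Word.pattern_append (u : ι → ℝ) (ρ : ℝ) (v w : Word) :
    (v.append w).pattern u ρ = v.pattern u ρ + w.pattern u ρ := by
  simp only [pattern, letters_append, Multiset.map_add]

lemma Word.card_pattern (u : ι → ℝ) (ρ : ℝ) (w : Word) : (w.pattern u ρ).card = w.1 := by
  simp only [pattern, Multiset.card_map, card_letters]

/-- The tuples with a given pattern. -/
def patternSet (u : ι → ℝ) (ρ : ℝ) (m : ℕ) (X : Multiset ι) : Set (Fin m → ℝ) :=
  {v | Word.pattern u ρ ⟨m, v⟩ = X.map some}

lemma image_patternSet (u : ι → ℝ) (ρ : ℝ) {m : ℕ} {X : Multiset ι} (hm : X.card = m) :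
    Word.ofFn m '' patternSet u ρ m X = {w | w.pattern u ρ = X.map some} := by
  ext w
  constructor
  · rintro ⟨v, hv, rfl⟩
    exact hv
  · intro hw
    obtain ⟨n, v⟩ := w
    have : n = m := by
      rw [← hm, ← Multiset.card_map some X, ← (show _ = _ from hw), Word.card_pattern]
    subst this
    exact ⟨v, hw, rfl⟩

lemma comp_perm_mem_patternSet (u : ι → ℝ) (ρ : ℝ) (m : ℕ) (X : Multiset ι)
    (π : Equiv.Perm (Fin m)) (v : Fin m → ℝ) :
    v ∘ π ∈ patternSet u ρ m X ↔ v ∈ patternSet u ρ m X := by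
  have : Word.letters ⟨m, v ∘ π⟩ = Word.letters ⟨m, v⟩ := by
    simp only [Word.letters_ofFn, Multiset.coe_eq_coe]
    exact Equiv.Perm.ofFn_comp_perm π v
  change Multiset.map _ _ = _ ↔ Multiset.map _ _ = _
  rw [this]

/-- The set is a finite union of closed sup-norm balls, one for each assignment of centres to
coordinates that realizes `X`. -/
lemma isCompact_patternSet [Finite ι] {u : ι → ℝ} {ρ : ℝ} (hρ : 0 ≤ ρ)
    (hsep : ∀ l l', l ≠ l' → 2 * ρ < |u l - u l'|) (m : ℕ) (X : Multiset ι) :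
    IsCompact (patternSet u ρ m X) := by
  have h : patternSet u ρ m X =
      ⋃ e ∈ {e : Fin m → ι | Finset.univ.val.map e = X}, Metric.closedBall (u ∘ e) ρ := by
    ext v
    have hp : Word.pattern u ρ ⟨m, v⟩ = Finset.univ.val.map (nearest u ρ ∘ v) := by
      simp only [Word.pattern, Word.letters, Multiset.map_map]
    simp only [patternSet, Set.mem_ofPred_eq, hp, Set.mem_iUnion, exists_prop,
      mem_closedBall_iff_norm, pi_norm_le_iff_of_nonneg hρ]
    constructor
    · intro hv
      have : ∀ i, ∃ l, nearest u ρ (v i) = some l := by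
        intro i
        have hi : nearest u ρ (v i) ∈ X.map some := by
          rw [← hv]
          exact Multiset.mem_map_of_mem (nearest u ρ ∘ v) (Finset.mem_univ_val i)
        obtain ⟨l, -, e⟩ := Multiset.mem_map.1 hi
        exact ⟨l, e.symm⟩
      choose e he using this
      refine ⟨e, ?_, fun i => (nearest_eq_some_iff hsep).1 (he i)⟩
      refine Multiset.map_injective (Option.some_injective ι) ?_
      rw [← hv, Multiset.map_map]
      exact Multiset.map_congr rfl fun i _ => (he i).symm
    · rintro ⟨e, he, hv⟩
      rw [← he, Multiset.map_map]
      exact Multiset.map_congr rfl fun i _ => (nearest_eq_some_iff hsep).2 (hv i)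
  rw [h]
  exact (Set.toFinite _).isCompact_biUnion fun e _ => isCompact_closedBall _ _

/-- An element of `T + O` occurs in both `X + Z` and `Z + Y`, and `X`, `Y` are disjoint, so `T + O ≤
Z` by multiplicities. The cardinality of `T` leaves no room for `O`, and the rest follows by
cancellation. -/
lemma eq_of_pattern_add_eq {κ : Type*} {S T U O X Z Y : Multiset κ} (hnd : (X + Z + Y).Nodup)
    (h₁ : S + T + O = X + Z) (h₂ : T + U + O = Z + Y) (hT : Z.card ≤ T.card) :
    O = 0 ∧ S = X ∧ T = Z ∧ U = Y := by
  classical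
  have hle : T + O ≤ Z := by
    rw [Multiset.le_iff_count]
    intro i
    have e₁ := congrArg (Multiset.count i) h₁
    have e₂ := congrArg (Multiset.count i) h₂
    have e₃ := Multiset.nodup_iff_count_le_one.1 hnd i
    simp only [Multiset.count_add] at e₁ e₂ e₃ ⊢
    omega
  have hO : O.card = 0 := by
    have := Multiset.card_le_card hle
    rw [Multiset.card_add] at this
    omega
  rw [Multiset.card_eq_zero] at hO
  subst hO
  rw [add_zero] at h₁ h₂ hle
  obtain rfl := Multiset.eq_of_le_of_card_le hle hT
  exact ⟨rfl, add_right_cancel h₁, rfl, add_left_cancel h₂⟩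

end Pattern

/-- The triple of words of lengths `a`, `b`, `c` with given letters. -/
def tripleWord (a b c : ℕ) (p : Fin a ⊕ Fin b ⊕ Fin c → ℝ) : Word × Word × Word :=
  (⟨a, fun i => p (.inl i)⟩, ⟨b, fun i => p (.inr (.inl i))⟩, ⟨c, fun i => p (.inr (.inr i))⟩)

/-- Splitting of a tuple into three parts. -/
def splitTuple (a b c : ℕ) :
    (Fin a ⊕ Fin b ⊕ Fin c → ℝ) ≃ᵐ (Fin a → ℝ) × (Fin b → ℝ) × (Fin c → ℝ) :=
  (MeasurableEquiv.sumPiEquivProdPi fun _ => ℝ).trans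
    (MeasurableEquiv.prodCongr (.refl _) (MeasurableEquiv.sumPiEquivProdPi fun _ => ℝ))

lemma measurePreserving_splitTuple (a b c : ℕ) :
    MeasurePreserving (splitTuple a b c) volume
      ((volume : Measure (Fin a → ℝ)).prod
        ((volume : Measure (Fin b → ℝ)).prod (volume : Measure (Fin c → ℝ)))) :=
  (volume_measurePreserving_sumPiEquivProdPi fun _ => ℝ).trans
    ((MeasurePreserving.id _).prod (volume_measurePreserving_sumPiEquivProdPi fun _ => ℝ))

lemma tripleWord_eq (a b c : ℕ) : tripleWord a b c =
    Prod.map (Word.ofFn a) (Prod.map (Word.ofFn b) (Word.ofFn c)) ∘ splitTuple a b c := rfl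

lemma measurableEmbedding_tripleWord (a b c : ℕ) : MeasurableEmbedding (tripleWord a b c) := by
  rw [tripleWord_eq]
  exact ((Word.measurableEmbedding_ofFn a).prodMap ((Word.measurableEmbedding_ofFn b).prodMap
    (Word.measurableEmbedding_ofFn c))).comp (splitTuple a b c).measurableEmbedding

lemma range_tripleWord (a b c : ℕ) : Set.range (tripleWord a b c) =
    Set.range (Word.ofFn a) ×ˢ Set.range (Word.ofFn b) ×ˢ Set.range (Word.ofFn c) := by
  rw [tripleWord_eq, (splitTuple a b c).surjective.range_comp, Set.range_prodMap,
    Set.range_prodMap]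

lemma wordMeasure_restrict_range (n : ℕ) : wordMeasure.restrict (Set.range (Word.ofFn n)) =
    ENNReal.ofReal (1 / (n.factorial : ℝ)) • Measure.map (Word.ofFn n) volume := by
  have hr := (Word.measurableEmbedding_ofFn n).measurableSet_range
  ext S hS
  rw [Measure.restrict_apply hS, wordMeasure_apply (hS.inter hr), tsum_eq_single n,
    Measure.smul_apply, (Word.measurableEmbedding_ofFn n).map_apply, smul_eq_mul,
    Set.preimage_inter, Set.preimage_range, Set.inter_univ]
  intro k hk
  have : Word.ofFn k ⁻¹' (S ∩ Set.range (Word.ofFn n)) = ∅ := by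
    ext v
    simp only [Set.mem_preimage, Set.mem_inter_iff, Set.mem_range, Set.mem_empty_iff_false,
      iff_false, not_and]
    rintro - ⟨w, e⟩
    exact hk (congrArg Sigma.fst e).symm
  rw [this, measure_empty, mul_zero]

lemma exists_wordMeasure₃_restrict_range (a b c : ℕ) : ∃ k : ENNReal, k ≠ 0 ∧ k ≠ ⊤ ∧
    wordMeasure₃.restrict (Set.range (tripleWord a b c)) =
      k • Measure.map (tripleWord a b c) volume := by
  have h0 : ∀ n : ℕ, ENNReal.ofReal (1 / (n.factorial : ℝ)) ≠ 0 := fun n => by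
    simp [Nat.factorial_pos]
  refine ⟨ENNReal.ofReal (1 / (a.factorial : ℝ)) * (ENNReal.ofReal (1 / (b.factorial : ℝ)) *
    ENNReal.ofReal (1 / (c.factorial : ℝ))), mul_ne_zero (h0 a) (mul_ne_zero (h0 b) (h0 c)),
    by finiteness, ?_⟩
  have e : Measure.map (tripleWord a b c) volume =
      (Measure.map (Word.ofFn a) volume).prod
        ((Measure.map (Word.ofFn b) volume).prod (Measure.map (Word.ofFn c) volume)) := by
    rw [tripleWord_eq, ← Measure.map_map ((Word.measurableEmbedding_ofFn a).measurable.prodMap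
      ((Word.measurableEmbedding_ofFn b).measurable.prodMap
        (Word.measurableEmbedding_ofFn c).measurable)) (splitTuple a b c).measurable,
      (measurePreserving_splitTuple a b c).map_eq,
      ← Measure.map_prod_map _ _ (Word.measurableEmbedding_ofFn a).measurable
        ((Word.measurableEmbedding_ofFn b).measurable.prodMap
          (Word.measurableEmbedding_ofFn c).measurable),
      ← Measure.map_prod_map _ _ (Word.measurableEmbedding_ofFn b).measurable
        (Word.measurableEmbedding_ofFn c).measurable]
  rw [e, range_tripleWord, ← Measure.prod_restrict, ← Measure.prod_restrict,
    wordMeasure_restrict_range, wordMeasure_restrict_range, wordMeasure_restrict_range,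
    Measure.prod_smul_left, Measure.prod_smul_left, Measure.prod_smul_right, Measure.prod_smul_right,
    Measure.prod_smul_right, smul_smul, smul_smul, mul_assoc]

/-- The countably many triples of lengths cover the space, and on each of these pieces the measure
is a positive multiple of Lebesgue measure. -/
lemma ae_wordMeasure₃_iff {P : Word × Word × Word → Prop} :
    (∀ᵐ p ∂wordMeasure₃, P p) ↔ ∀ a b c, ∀ᵐ p, P (tripleWord a b c p) := by
  have hU : ⋃ i : ℕ × ℕ × ℕ, Set.range (tripleWord i.1 i.2.1 i.2.2) = Set.univ := by
    refine Set.eq_univ_of_forall fun p => Set.mem_iUnion.2 ⟨(p.1.1, p.2.1.1, p.2.2.1),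
      Sum.elim p.1.2 (Sum.elim p.2.1.2 p.2.2.2), rfl⟩
  rw [← Measure.restrict_univ (μ := wordMeasure₃), ← hU, ae_restrict_iUnion_iff]
  refine ⟨fun h a b c => ?_, fun h i => ?_⟩
  · obtain ⟨k, hk, -, e⟩ := exists_wordMeasure₃_restrict_range a b c
    have := h (a, b, c)
    rw [e, Measure.ae_ennreal_smul_measure_iff hk, (measurableEmbedding_tripleWord a b c).ae_map_iff] at this
    exact this
  · obtain ⟨k, hk, -, e⟩ := exists_wordMeasure₃_restrict_range i.1 i.2.1 i.2.2
    rw [e, Measure.ae_ennreal_smul_measure_iff hk, (measurableEmbedding_tripleWord _ _ _).ae_map_iff]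
    exact h _ _ _

end

/-! ### Neighbourhoods of a triple of words and their permuted copies. -/

section

open Filter Topology

lemma exists_perm_of_map_eq {ι κ : Type*} [Fintype ι] {g h : ι → κ} (hh : Function.Injective h)
    (e : Finset.univ.val.map g = Finset.univ.val.map h) : ∃ π : Equiv.Perm ι, ∀ i, g (π i) = h i := by
  have : ∀ i, ∃ j, g j = h i := by
    intro i
    have : h i ∈ Finset.univ.val.map g := e ▸ Multiset.mem_map_of_mem h (Finset.mem_univ_val i)
    obtain ⟨j, -, hj⟩ := Multiset.mem_map.1 this
    exact ⟨j, hj⟩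
  choose π hπ using this
  have hinj : Function.Injective π := fun i j hij => hh (by rw [← hπ, ← hπ, hij])
  exact ⟨Equiv.ofBijective π (Finite.injective_iff_bijective.1 hinj), hπ⟩

lemma mem_patternSet_map_iff {ι : Type*} {u : ι → ℝ} {ρ : ℝ}
    (hsep : ∀ l l', l ≠ l' → 2 * ρ < |u l - u l'|) {m : ℕ} {h : Fin m → ι}
    (hh : Function.Injective h) {v : Fin m → ℝ} :
    v ∈ patternSet u ρ m (Finset.univ.val.map h) ↔
      ∃ π : Equiv.Perm (Fin m), ∀ i, |v (π i) - u (h i)| ≤ ρ := by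
  constructor
  · intro hv
    have e : Finset.univ.val.map (nearest u ρ ∘ v) = Finset.univ.val.map (some ∘ h) := by
      rw [← Multiset.map_map, ← Multiset.map_map]
      exact hv
    obtain ⟨π, hπ⟩ := exists_perm_of_map_eq ((Option.some_injective ι).comp hh) e
    exact ⟨π, fun i => (nearest_eq_some_iff hsep).1 (hπ i)⟩
  · rintro ⟨π, hπ⟩
    rw [← comp_perm_mem_patternSet u ρ m _ π]
    change Multiset.map _ (Multiset.map _ _) = Multiset.map _ (Multiset.map _ _)
    rw [Multiset.map_map, Multiset.map_map]
    exact Multiset.map_congr rfl fun i _ => (nearest_eq_some_iff hsep).2 (hπ i)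

section Triple

variable {a b c : ℕ}

/-- Permutation of the three parts of a tuple. -/
def blockPerm (π : Equiv.Perm (Fin a) × Equiv.Perm (Fin b) × Equiv.Perm (Fin c)) :
    Equiv.Perm (Fin a ⊕ Fin b ⊕ Fin c) :=
  Equiv.sumCongr π.1 (Equiv.sumCongr π.2.1 π.2.2)

lemma blockPerm_injective : Function.Injective (blockPerm (a := a) (b := b) (c := c)) := by
  rintro ⟨π₁, π₂, π₃⟩ ⟨θ₁, θ₂, θ₃⟩ h
  have h' := fun l => Equiv.congr_fun h l
  refine Prod.ext (Equiv.ext fun i => ?_) (Prod.ext (Equiv.ext fun i => ?_) (Equiv.ext fun i => ?_))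
  · simpa [blockPerm] using h' (.inl i)
  · simpa [blockPerm] using h' (.inr (.inl i))
  · simpa [blockPerm] using h' (.inr (.inr i))

/-- The index set of the first part of a tuple. -/
def leftPart (a b c : ℕ) : Multiset (Fin a ⊕ Fin b ⊕ Fin c) := Finset.univ.val.map .inl

/-- The index set of the second part of a tuple. -/
def midPart (a b c : ℕ) : Multiset (Fin a ⊕ Fin b ⊕ Fin c) :=
  Finset.univ.val.map fun i => .inr (.inl i)

/-- The index set of the third part of a tuple. -/
def rightPart (a b c : ℕ) : Multiset (Fin a ⊕ Fin b ⊕ Fin c) :=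
  Finset.univ.val.map fun i => .inr (.inr i)

lemma card_leftPart : (leftPart a b c).card = a := by simp [leftPart]

lemma card_midPart : (midPart a b c).card = b := by simp [midPart]

lemma card_rightPart : (rightPart a b c).card = c := by simp [rightPart]

/-- The triples of words whose letters are near to the three parts of `u`. -/
def nearTriples (u : Fin a ⊕ Fin b ⊕ Fin c → ℝ) (ρ : ℝ) : Set (Word × Word × Word) :=
  (Word.ofFn a '' patternSet u ρ a (leftPart a b c)) ×ˢ
    (Word.ofFn b '' patternSet u ρ b (midPart a b c)) ×ˢ
      (Word.ofFn c '' patternSet u ρ c (rightPart a b c))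

variable {u : Fin a ⊕ Fin b ⊕ Fin c → ℝ} {ρ : ℝ}

lemma preimage_nearTriples (hρ : 0 ≤ ρ) (hsep : ∀ l l', l ≠ l' → 2 * ρ < |u l - u l'|) :
    tripleWord a b c ⁻¹' nearTriples u ρ =
      ⋃ π, (fun p => p ∘ blockPerm π) ⁻¹' Metric.closedBall u ρ := by
  ext p
  have hinj := fun n => (Word.isOpenEmbedding_ofFn n).injective
  have h₁ : Function.Injective (Sum.inl : Fin a → Fin a ⊕ Fin b ⊕ Fin c) := Sum.inl_injective
  have h₂ : Function.Injective fun i : Fin b => (.inr (.inl i) : Fin a ⊕ Fin b ⊕ Fin c) :=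
    Sum.inr_injective.comp Sum.inl_injective
  have h₃ : Function.Injective fun i : Fin c => (.inr (.inr i) : Fin a ⊕ Fin b ⊕ Fin c) :=
    Sum.inr_injective.comp Sum.inr_injective
  simp only [tripleWord, nearTriples, leftPart, midPart, rightPart, Set.mem_preimage, Set.mem_prod,
    (hinj _).mem_set_image, mem_patternSet_map_iff hsep h₁, mem_patternSet_map_iff hsep h₂,
    mem_patternSet_map_iff hsep h₃, Set.mem_iUnion, mem_closedBall_iff_norm,
    pi_norm_le_iff_of_nonneg hρ, Sum.forall, Prod.exists, blockPerm, Pi.sub_apply,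
    Function.comp_apply, Equiv.sumCongr_apply, Sum.map_inl, Sum.map_inr, Real.norm_eq_abs]
  constructor
  · rintro ⟨⟨π, h⟩, ⟨π', h'⟩, ⟨π'', h''⟩⟩
    exact ⟨π, π', π'', h, h', h''⟩
  · rintro ⟨π, π', π'', h, h', h''⟩
    exact ⟨⟨π, h⟩, ⟨π', h'⟩, ⟨π'', h''⟩⟩

lemma measurableSet_nearTriples (hρ : 0 ≤ ρ) (hsep : ∀ l l', l ≠ l' → 2 * ρ < |u l - u l'|) :
    MeasurableSet (nearTriples u ρ) := by
  have h := fun m X => (isCompact_patternSet hρ hsep m X).measurableSet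
  exact ((Word.measurableEmbedding_ofFn a).measurableSet_image.2 (h _ _)).prod
    (((Word.measurableEmbedding_ofFn b).measurableSet_image.2 (h _ _)).prod
      ((Word.measurableEmbedding_ofFn c).measurableSet_image.2 (h _ _)))

lemma nearTriples_subset_range : nearTriples u ρ ⊆ Set.range (tripleWord a b c) := by
  rw [range_tripleWord]
  exact Set.prod_mono (Set.image_subset_range _ _)
    (Set.prod_mono (Set.image_subset_range _ _) (Set.image_subset_range _ _))

lemma measurePreserving_comp_perm {ι : Type*} [Fintype ι] (π : Equiv.Perm ι) :
    MeasurePreserving (fun p : ι → ℝ => p ∘ π) volume volume :=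
  volume_preserving_arrowCongr' π.symm (.refl ℝ) (MeasurePreserving.id _)

lemma measurableEmbedding_comp_perm {ι : Type*} [Fintype ι] (π : Equiv.Perm ι) :
    MeasurableEmbedding (fun p : ι → ℝ => p ∘ π) :=
  (MeasurableEquiv.arrowCongr' π.symm (.refl ℝ)).measurableEmbedding

/-- The neighbourhood consists of the images of one ball under permutations within the three blocks.
The separation of the centres makes them disjoint, and the symmetry of `G` makes their integrals
equal. -/
lemma integral_preimage_nearTriples (hρ : 0 ≤ ρ)
    (hsep : ∀ l l', l ≠ l' → 2 * ρ < |u l - u l'|) {G : (Fin a ⊕ Fin b ⊕ Fin c → ℝ) → ℂ}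
    (hG : ∀ π p, G (p ∘ blockPerm π) = G p) (hi : IntegrableOn G (Metric.closedBall u ρ)) :
    ∫ p in tripleWord a b c ⁻¹' nearTriples u ρ, G p =
      (Fintype.card (Equiv.Perm (Fin a) × Equiv.Perm (Fin b) × Equiv.Perm (Fin c)) : ℂ) *
        ∫ p in Metric.closedBall u ρ, G p := by
  have hm := fun π => measurePreserving_comp_perm (blockPerm (a := a) (b := b) (c := c) π)
  have he := fun π => measurableEmbedding_comp_perm (blockPerm (a := a) (b := b) (c := c) π)
  rw [preimage_nearTriples hρ hsep, integral_iUnion_fintype]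
  · have : ∀ π, ∫ p in (fun p => p ∘ blockPerm π) ⁻¹' Metric.closedBall u ρ, G p =
        ∫ p in Metric.closedBall u ρ, G p := by
      intro π
      simpa only [hG] using (hm π).setIntegral_preimage_emb (he π) G (Metric.closedBall u ρ)
    simp only [this, Finset.sum_const, Finset.card_univ, nsmul_eq_mul]
  · exact fun π => (hm π).measurable Metric.isClosed_closedBall.measurableSet
  · intro π θ hne
    refine Set.disjoint_left.2 fun p h h' => hne (blockPerm_injective (Equiv.ext fun l => ?_))
    -- The centre nearest to each coordinate of `p` determines the permutation, so a point cannot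
    -- lie in two copies.
    have near : ∀ π, p ∘ blockPerm π ∈ Metric.closedBall u ρ → ∀ l,
        nearest u ρ (p (blockPerm π l)) = some l := fun π h l => by
      rw [mem_closedBall_iff_norm, pi_norm_le_iff_of_nonneg hρ] at h
      exact (nearest_eq_some_iff hsep).2 (h l)
    have e := near π h ((blockPerm π).symm (blockPerm θ l))
    rw [Equiv.apply_symm_apply, near θ h' l, Option.some_inj] at e
    exact (Equiv.eq_symm_apply _).1 e
  · intro π
    have := ((hm π).integrableOn_comp_preimage (he π)).2 hi
    exact this.congr_fun (fun p _ => hG π p) ((hm π).measurable Metric.isClosed_closedBall.measurableSet)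

lemma exists_integral_nearTriples (hρ : 0 ≤ ρ) (hsep : ∀ l l', l ≠ l' → 2 * ρ < |u l - u l'|) :
    ∃ k : ℝ, k ≠ 0 ∧ ∀ H : Word × Word × Word → ℂ, ∫ p in nearTriples u ρ, H p ∂wordMeasure₃ =
      k • ∫ p in tripleWord a b c ⁻¹' nearTriples u ρ, H (tripleWord a b c p) := by
  obtain ⟨k, hk, hk', e⟩ := exists_wordMeasure₃_restrict_range a b c
  refine ⟨k.toReal, ENNReal.toReal_ne_zero.2 ⟨hk, hk'⟩, fun H => ?_⟩
  have hr : (wordMeasure₃.restrict (Set.range (tripleWord a b c))).restrict (nearTriples u ρ) =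
      wordMeasure₃.restrict (nearTriples u ρ) := by
    rw [Measure.restrict_restrict (measurableSet_nearTriples hρ hsep),
      Set.inter_eq_left.2 nearTriples_subset_range]
  rw [← hr, e, Measure.restrict_smul, integral_smul_measure,
    (measurableEmbedding_tripleWord a b c).setIntegral_map]

lemma continuous_tripleWord : Continuous (tripleWord a b c) :=
  ((Word.isOpenEmbedding_ofFn a).continuous.comp (by fun_prop)).prodMk
    (((Word.isOpenEmbedding_ofFn b).continuous.comp (by fun_prop)).prodMk
      ((Word.isOpenEmbedding_ofFn c).continuous.comp (by fun_prop)))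

lemma locallyIntegrable_comp_tripleWord {E : Type*} [NormedAddCommGroup E]
    {F : Word × Word × Word → E} (hF : LocallyIntegrable F wordMeasure₃) :
    LocallyIntegrable (F ∘ tripleWord a b c) := by
  rw [locallyIntegrable_iff]
  intro K hK
  obtain ⟨k, hk, hk', e⟩ := exists_wordMeasure₃_restrict_range a b c
  have h := (hF.integrableOn_isCompact (hK.image continuous_tripleWord)).mono_measure
    (Measure.restrict_le_self (s := Set.range (tripleWord a b c)))
  rw [e, IntegrableOn, Measure.restrict_smul, integrable_smul_measure hk hk', ← IntegrableOn,
    (measurableEmbedding_tripleWord a b c).integrableOn_map_iff,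
    Set.preimage_image_eq _ (measurableEmbedding_tripleWord a b c).injective] at h
  exact h

end Triple

end

/-! ### A kernel with vanishing form is zero almost everywhere. -/

section

open Filter Topology

section Centres

variable {a b c : ℕ} {u : Fin a ⊕ Fin b ⊕ Fin c → ℝ} {ρ : ℝ}

lemma mem_nearTriples {p : Word × Word × Word} : p ∈ nearTriples u ρ ↔
    p.1.pattern u ρ = (leftPart a b c).map some ∧ p.2.1.pattern u ρ = (midPart a b c).map some ∧
      p.2.2.pattern u ρ = (rightPart a b c).map some := by
  rw [nearTriples, image_patternSet u ρ card_leftPart, image_patternSet u ρ card_midPart,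
    image_patternSet u ρ card_rightPart]
  rfl

lemma nodup_parts : ((leftPart a b c).map some + (midPart a b c).map some +
    (rightPart a b c).map some).Nodup := by
  rw [← Multiset.map_add, ← Multiset.map_add]
  refine Multiset.Nodup.map (Option.some_injective _) ?_
  simp only [Multiset.nodup_add, Multiset.disjoint_left, leftPart, midPart, rightPart]
  refine ⟨⟨Finset.univ.nodup.map Sum.inl_injective,
    Finset.univ.nodup.map (Sum.inr_injective.comp Sum.inl_injective), ?_⟩,
    Finset.univ.nodup.map (Sum.inr_injective.comp Sum.inr_injective), ?_⟩ <;> simp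

variable {𝔨 : Type*} [NormedAddCommGroup 𝔨] [InnerProductSpace ℂ 𝔨]

open Classical in
/-- On the indicators of neighbourhoods of `x + z` and `z + y` a kernel that vanishes on shorter
middle words acts only through its values near `(x, z, y)`. -/
lemma kernelForm_indicator_pattern (hρ : 0 ≤ ρ) (hsep : ∀ l l', l ≠ l' → 2 * ρ < |u l - u l'|)
    {F : Word → Word → Word → (𝔨 →L[ℂ] 𝔨)}
    (hF : ∀ᵐ p : Word × Word × Word ∂wordMeasure₃, p.2.1.1 < b → F p.1 p.2.1 p.2.2 = 0) (v w : 𝔨) :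
    kernelForm F
      ({ξ : Word | ξ.pattern u ρ = (leftPart a b c + midPart a b c).map some}.indicator fun _ => v)
      ({ξ : Word | ξ.pattern u ρ = (midPart a b c + rightPart a b c).map some}.indicator fun _ => w) =
      ∫ p in nearTriples u ρ, inner ℂ v (F p.1 p.2.1 p.2.2 w) ∂wordMeasure₃ := by
  set H : Word × Word × Word → ℂ := fun p => inner ℂ v (F p.1 p.2.1 p.2.2 w) with hH
  have h₁ : ∀ᵐ q ∂wordMeasure₃.prod wordMeasure, formIntegrand F
      ({ξ : Word | ξ.pattern u ρ = (leftPart a b c + midPart a b c).map some}.indicator fun _ => v)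
      ({ξ : Word | ξ.pattern u ρ = (midPart a b c + rightPart a b c).map some}.indicator fun _ => w)
      (wordAssoc q) =
      (nearTriples u ρ).indicator H q.1 * (if q.2.1 = 0 then 1 else 0) := by
    filter_upwards [Measure.quasiMeasurePreserving_fst.ae hF] with q hq
    obtain ⟨⟨σ, τ, υ⟩, ω⟩ := q
    change inner ℂ (Set.indicator _ _ ((σ.append τ).append ω))
      (F σ τ υ (Set.indicator _ _ ((τ.append υ).append ω))) = _
    by_cases hτ : τ.1 < b
    · have h0 : F σ τ υ = 0 := hq hτ
      have : H (σ, τ, υ) = 0 := by simp [hH, h0]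
      simp [h0, Set.indicator_apply, this]
    -- With `τ` of length at least `b`, the counting lemma applied to the patterns leaves only `ω =
    -- ∅` and an exact match of the three parts.
    · have hiff : ((σ.append τ).append ω).pattern u ρ = (leftPart a b c + midPart a b c).map some ∧
          ((τ.append υ).append ω).pattern u ρ = (midPart a b c + rightPart a b c).map some ↔
          (σ, τ, υ) ∈ nearTriples u ρ ∧ ω.1 = 0 := by
        simp only [Word.pattern_append, Multiset.map_add, mem_nearTriples]
        constructor
        · rintro ⟨e₁, e₂⟩
          obtain ⟨hO, hS, hT, hU⟩ := eq_of_pattern_add_eq nodup_parts e₁ e₂ (by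
            rw [Word.card_pattern, Multiset.card_map, card_midPart]
            exact not_lt.1 hτ)
          refine ⟨⟨hS, hT, hU⟩, ?_⟩
          rw [← Word.card_pattern u ρ, hO, Multiset.card_zero]
        · rintro ⟨⟨hS, hT, hU⟩, hω⟩
          have hO : ω.pattern u ρ = 0 := by
            rw [← Multiset.card_eq_zero, Word.card_pattern, hω]
          rw [hS, hT, hU, hO, add_zero, add_zero]
          exact ⟨rfl, rfl⟩
      by_cases h : (σ, τ, υ) ∈ nearTriples u ρ ∧ ω.1 = 0
      · obtain ⟨e₁, e₂⟩ := hiff.2 h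
        rw [Set.indicator_of_mem
            (s := {ξ : Word | ξ.pattern u ρ = (leftPart a b c + midPart a b c).map some}) e₁,
          Set.indicator_of_mem
            (s := {ξ : Word | ξ.pattern u ρ = (midPart a b c + rightPart a b c).map some}) e₂,
          Set.indicator_of_mem h.1,
          if_pos h.2, mul_one]
      · have hr : (nearTriples u ρ).indicator H (σ, τ, υ) * (if ω.1 = 0 then 1 else 0) = 0 := by
          by_cases h' : ω.1 = 0
          · rw [Set.indicator_of_notMem fun hm => h ⟨hm, h'⟩, zero_mul]
          · rw [if_neg h', mul_zero]
        refine Eq.trans ?_ hr.symm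
        by_cases e₁ : ((σ.append τ).append ω) ∈ {ξ : Word | ξ.pattern u ρ =
            (leftPart a b c + midPart a b c).map some}
        · rw [Set.indicator_of_notMem (a := (τ.append υ).append ω) fun e₂ => h (hiff.1 ⟨e₁, e₂⟩),
            map_zero, inner_zero_right]
        · rw [Set.indicator_of_notMem e₁, inner_zero_left]
  rw [kernelForm, ← measurePreserving_wordAssoc.integral_comp wordAssoc.measurableEmbedding,
    integral_congr_ae h₁, integral_prod_mul ((nearTriples u ρ).indicator H)
      (fun ω : Word => if ω.1 = 0 then (1 : ℂ) else 0), integral_length_eq_zero, mul_one,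
    integral_indicator (measurableSet_nearTriples hρ hsep)]

/-- It is enough to test with matrix coefficients. For each of them the vanishing form on two
indicators is the integral over the neighbourhood of the triple, which is a nonzero constant times
the integral over the ball: the constant comes from the factorials in the measure and the number of
block permutations. -/
lemma setIntegral_closedBall_eq_zero [CompleteSpace 𝔨] (hρ : 0 ≤ ρ)
    (hsep : ∀ l l', l ≠ l' → 2 * ρ < |u l - u l'|) {F : Word → Word → Word → (𝔨 →L[ℂ] 𝔨)}
    (hF : ∀ᵐ p : Word × Word × Word ∂wordMeasure₃, p.2.1.1 < b → F p.1 p.2.1 p.2.2 = 0)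
    (hi : LocallyIntegrable (fun p : Word × Word × Word => F p.1 p.2.1 p.2.2) wordMeasure₃)
    (h₁ : ∀ τ υ, IsSymmetricOnWords fun σ => F σ τ υ)
    (h₂ : ∀ σ υ, IsSymmetricOnWords fun τ => F σ τ υ)
    (h₃ : ∀ σ τ, IsSymmetricOnWords fun υ => F σ τ υ)
    (h0 : ∀ f g : TestFn 𝔨, kernelForm F f.1 g.1 = 0) :
    ∫ p in Metric.closedBall u ρ, F (tripleWord a b c p).1 (tripleWord a b c p).2.1
      (tripleWord a b c p).2.2 = 0 := by
  have hloc := locallyIntegrable_comp_tripleWord (a := a) (b := b) (c := c) hi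
  have hball := hloc.integrableOn_isCompact (isCompact_closedBall u ρ)
  have hbox := fun N => hi.integrableOn_isCompact (isCompact_box₃ N)
  have key : ∀ v w : 𝔨, matrixCoeff v w (∫ p in Metric.closedBall u ρ,
      F (tripleWord a b c p).1 (tripleWord a b c p).2.1 (tripleWord a b c p).2.2) = 0 := by
    intro v w
    refine ((matrixCoeff v w).integral_comp_comm hball).symm.trans ?_
    have hform := kernelForm_indicator_pattern hρ hsep hF v w
    rw [← image_patternSet u ρ (m := a + b)
      (by rw [Multiset.card_add, card_leftPart, card_midPart]), ← image_patternSet u ρ (m := b + c)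
      (by rw [Multiset.card_add, card_midPart, card_rightPart]),
      kernelForm_indicator_eq_zero hbox h0 (isCompact_patternSet hρ hsep _ _)
        (isCompact_patternSet hρ hsep _ _) (comp_perm_mem_patternSet _ _ _ _)
        (comp_perm_mem_patternSet _ _ _ _)] at hform
    obtain ⟨k, hk, e⟩ := exists_integral_nearTriples hρ hsep
    rw [e (fun p => inner ℂ v (F p.1 p.2.1 p.2.2 w)), integral_preimage_nearTriples hρ hsep
      (G := fun p => inner ℂ v (F (tripleWord a b c p).1 (tripleWord a b c p).2.1
        (tripleWord a b c p).2.2 w))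
      (fun π p => ?_) ((matrixCoeff v w).integrable_comp hball)] at hform
    · have := (smul_eq_zero.1 hform.symm).resolve_left hk
      exact (mul_eq_zero.1 this).resolve_left (by exact_mod_cast Fintype.card_ne_zero)
    · have : F (tripleWord a b c (p ∘ blockPerm π)).1 (tripleWord a b c (p ∘ blockPerm π)).2.1
          (tripleWord a b c (p ∘ blockPerm π)).2.2 = F (tripleWord a b c p).1
            (tripleWord a b c p).2.1 (tripleWord a b c p).2.2 :=
        (h₁ _ _ a π.1 fun i => p (.inl i)).trans ((h₂ _ _ b π.2.1 fun i => p (.inr (.inl i))).trans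
          (h₃ _ _ c π.2.2 fun i => p (.inr (.inr i))))
      rw [this]
  refine ContinuousLinearMap.ext fun w => ext_inner_left ℂ fun v => ?_
  rw [← matrixCoeff_apply, key]
  simp

end Centres

/-- Each diagonal `u l = u l'` with `l ≠ l'` is a proper linear subspace, hence null. -/
lemma ae_injective {ι : Type*} [Fintype ι] : ∀ᵐ u : ι → ℝ, Function.Injective u := by
  classical
  have : ∀ l l' : ι, l ≠ l' → ∀ᵐ u : ι → ℝ, u l ≠ u l' := by
    intro l l' h
    have hs := Measure.addHaar_submodule (volume : Measure (ι → ℝ))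
      (LinearMap.ker (LinearMap.proj (R := ℝ) (φ := fun _ : ι => ℝ) l - LinearMap.proj l')) (by
        intro htop
        have : (Pi.single l 1 : ι → ℝ) ∈ LinearMap.ker (LinearMap.proj (R := ℝ)
          (φ := fun _ : ι => ℝ) l - LinearMap.proj l') := htop ▸ Submodule.mem_top
        simp [h.symm] at this)
    rw [ae_iff]
    convert! hs using 2
    ext u
    simp [sub_eq_zero]
  have h : ∀ᵐ u : ι → ℝ, ∀ l l' : ι, l ≠ l' → u l ≠ u l' :=
    ae_all_iff.2 fun l => ae_all_iff.2 fun l' => by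
      by_cases h : l = l'
      · exact .of_forall fun u h' => absurd h h'
      · exact (this l l' h).mono fun u hu _ => hu
  exact h.mono fun u hu l l' e => not_imp_not.1 (hu l l') e

theorem ae_eq_zero_of_kernelForm_eq_zero {𝔨 : Type*} [NormedAddCommGroup 𝔨]
    [InnerProductSpace ℂ 𝔨] [CompleteSpace 𝔨] {F : Word → Word → Word → (𝔨 →L[ℂ] 𝔨)}
    (hi : LocallyIntegrable (fun p : Word × Word × Word => F p.1 p.2.1 p.2.2) wordMeasure₃)
    (h₁ : ∀ τ υ, IsSymmetricOnWords fun σ => F σ τ υ)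
    (h₂ : ∀ σ υ, IsSymmetricOnWords fun τ => F σ τ υ)
    (h₃ : ∀ σ τ, IsSymmetricOnWords fun υ => F σ τ υ)
    (h0 : ∀ f g : TestFn 𝔨, kernelForm F f.1 g.1 = 0) :
    ∀ᵐ p : Word × Word × Word ∂wordMeasure₃, F p.1 p.2.1 p.2.2 = 0 := by
  rw [ae_wordMeasure₃_iff]
  intro a b
  -- The induction is on the length of the middle word only. The outer lengths stay arbitrary, since
  -- the hypothesis is needed for every triple with a shorter middle word.
  induction b using Nat.strong_induction_on generalizing a with
  | _ b ih =>
  intro c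
  have hF : ∀ᵐ p : Word × Word × Word ∂wordMeasure₃, p.2.1.1 < b → F p.1 p.2.1 p.2.2 = 0 := by
    rw [ae_wordMeasure₃_iff]
    intro a' b' c'
    by_cases hb : b' < b
    · exact (ih b' hb a' c').mono fun p hp _ => hp
    · exact .of_forall fun p hp => absurd hp hb
  -- Almost every `u` has distinct coordinates and is a Lebesgue point. Once `ρ` is less than half
  -- the smallest gap between coordinates the averages over the balls around `u` are zero, so the
  -- value at `u` is zero.
  filter_upwards [ae_injective, IsUnifLocDoublingMeasure.ae_tendsto_average volume
    (locallyIntegrable_comp_tripleWord (a := a) (b := b) (c := c) hi) 1] with u hu hlim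
  have hsep : ∀ᶠ ρ in 𝓝[>] (0 : ℝ), ∀ l l', l ≠ l' → 2 * ρ < |u l - u l'| := by
    refine eventually_all.2 fun l => eventually_all.2 fun l' => ?_
    by_cases h : l = l'
    · exact .of_forall fun ρ h' => absurd h h'
    · filter_upwards [Ioo_mem_nhdsGT (half_pos (abs_pos.2 (sub_ne_zero.2 (hu.ne h))))] with ρ hρ _
      linarith [hρ.2]
  refine tendsto_nhds_unique (hlim (l := 𝓝[>] (0 : ℝ)) (fun _ => u) id tendsto_id ?_) ?_
  · filter_upwards [self_mem_nhdsWithin] with ρ hρ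
    exact Metric.mem_closedBall_self (by simpa using hρ.le)
  · refine tendsto_const_nhds.congr' ?_
    filter_upwards [hsep, self_mem_nhdsWithin] with ρ hρ h
    have := setIntegral_closedBall_eq_zero (u := u) (Set.mem_Ioi.1 h).le hρ hF hi h₁ h₂ h₃ h0
    rw [setAverage_eq]
    exact ((congrArg _ this).trans (smul_zero _)).symm

end

end

theorem theorem4p2p1 {𝔨 : Type*} [NormedAddCommGroup 𝔨] [InnerProductSpace ℂ 𝔨]
    [CompleteSpace 𝔨] [TopologicalSpace.SeparableSpace 𝔨]
    (A₁ A₀ Am₁ B : 𝔨 →L[ℂ] 𝔨) (s : ℝ) :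
    (∀ U : Set.Ici s → TestFn 𝔨 → TestFn 𝔨 → ℂ,
      IsQSDESolution A₁ A₀ Am₁ B s U ↔
        U = fun (t : Set.Ici s) (f g : TestFn 𝔨) => kernelForm (qsdeKernel A₁ A₀ Am₁ B s t) f.1 g.1) ∧
    (IsAdmissibleKernel s (qsdeKernel A₁ A₀ Am₁ B s) ∧
      SatisfiesQSDE A₁ A₀ Am₁ B s (qsdeKernel A₁ A₀ Am₁ B s) ∧
      QSDEIntegralsConverge A₁ A₀ Am₁ B s (qsdeKernel A₁ A₀ Am₁ B s)) ∧
    (∀ x : ℝ → Word → Word → Word → (𝔨 →L[ℂ] 𝔨),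
      IsAdmissibleKernel s x → SatisfiesQSDE A₁ A₀ Am₁ B s x →
        ∀ t, s ≤ t →
          ∀ᵐ p : Word × Word × Word ∂(wordMeasure.prod (wordMeasure.prod wordMeasure)),
            x t p.1 p.2.1 p.2.2 = qsdeKernel A₁ A₀ Am₁ B s t p.1 p.2.1 p.2.2) := by
  have hu := isAdmissibleKernel_qsdeKernel A₁ A₀ Am₁ B s
  have eu := satisfiesQSDE_qsdeKernel (s := s) A₁ A₀ Am₁ B
  have hzero : ∀ x : ℝ → Word → Word → Word → (𝔨 →L[ℂ] 𝔨), IsAdmissibleKernel s x →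
      SatisfiesQSDE A₁ A₀ Am₁ B s x → ∀ t, s ≤ t → ∀ f g : TestFn 𝔨,
        kernelForm (fun σ τ υ => x t σ τ υ - qsdeKernel A₁ A₀ Am₁ B s t σ τ υ) f.1 g.1 = 0 :=
    fun x hx ex t ht f g =>
      kernelForm_eq_of_satisfiesQSDE hx.isBoxIntegrable hu.isBoxIntegrable ex eu f g ht
  refine ⟨fun U => ⟨?_, ?_⟩, ⟨hu, eu, hu.isBoxIntegrable.qsdeIntegralsConverge A₁ A₀ Am₁ B⟩,
    fun x hx ex t ht => ?_⟩
  · rintro ⟨x, hx, hU, ex⟩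
    funext t f g
    obtain ⟨N, M, hf, -, hg, -⟩ := f.exists_isTestFamily₂ g
    exact (hU t f g).trans (sub_eq_zero.1 ((hx.isBoxIntegrable.kernelForm_sub hu.isBoxIntegrable
      hf hg t.2 0 0).symm.trans (hzero x hx ex t t.2 f g)))
  · rintro rfl
    exact ⟨_, hu, fun _ _ _ => rfl, eu⟩
  · have h := ae_eq_zero_of_kernelForm_eq_zero
      (F := fun σ τ υ => x t σ τ υ - qsdeKernel A₁ A₀ Am₁ B s t σ τ υ)
      ((hx.locInt t ht).sub (hu.locInt t ht))
      (fun τ υ n π v => congrArg₂ (· - ·) (hx.symm_left t ht τ υ n π v)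
        (hu.symm_left t ht τ υ n π v))
      (fun σ υ n π v => congrArg₂ (· - ·) (hx.symm_mid t ht σ υ n π v)
        (hu.symm_mid t ht σ υ n π v))
      (fun σ τ n π v => congrArg₂ (· - ·) (hx.symm_right t ht σ τ n π v)
        (hu.symm_right t ht σ τ n π v))
      (hzero x hx ex t ht)
    exact h.mono fun p hp => sub_eq_zero.1 hp
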